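/- Let $(\Omega,\mathscr F,\mathbb P)$ be a probability space with an invertible, bimeasurable, measure-preserving map $\Phi:\Omega\to\Omega$, let $\alpha\in\mathbb R^m$, let $\mathbb T^m=\mathbb R^m/\mathbb Z^m$, let $U\subset\mathbb R^{2d}$ be open and let $l\ge 1$ be an integer. For integers $r,s\ge 0$, a map $F_\varepsilon(z,\theta,\omega)=F(z,\theta,\varepsilon,\omega)$, $F:U\times\mathbb T^m\times\mathbb R\times\Omega\to\mathbb R^{2d}$, is of class $\mathcal L^\infty(C^{r,s,l})$ if it is jointly measurable in $(z,\theta,\omega)$ for each $\varepsilon$, and if for all $i\le r$, $j\le s$, $k\le l$ and almost every $\omega$ the derivative $D_\theta^iD_z^jD_\varepsilon^kF$ exists, is continuous in $(z,\theta,\varepsilon)$, and is bounded uniformly in $(z,\theta,\varepsilon)$ and almost every $\omega$. For fixed $\varepsilon$, $F_\varepsilon$ is of class $\mathcal L^\infty(C^r)$ if the same holds for the derivatives $D_\theta^iD_z^jF_\varepsilon$ with $i+j\le r$, as a function of $(z,\theta)$. A map $\kappa:\mathbb T^m\times\Omega\to\mathbb R^{2d}$ is in $\mathcal L^\infty(C^r)$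 if it is jointly measurable, $\kappa(\cdot,\omega)$ is $C^r$ for almost every $\omega$, and its $\theta$-derivatives up to order $r$ are bounded uniformly in $\theta$ and almost every $\omega$. Let $F_\varepsilon$ be of class $\mathcal L^\infty(C^{0,l,l})$, with $F_\varepsilon|_{\varepsilon=0}=F_0(z,\theta)$ independent of $\omega$ (almost surely). Let $K_0:\mathbb T^m\to U$ be continuous with $F_0(K_0(\theta),\theta)=K_0(\theta+\alpha)$, and suppose that this torus is normally hyperbolic: with $M_0(\theta)=D_zF_0(K_0(\theta),\theta)$ and $M_0(\theta,N)=M_0(\theta+(N-1)\alpha)\cdots M_0(\theta)$, there are a continuous splitting $\mathbb R^{2d}=E^S(\theta)\oplus E^U(\theta)$ and constants $C_0>0$, $0<\lambda_S<1<\lambda_U$ such that $M_0(\theta)E^S(\theta)\subset E^S(\theta+\alpha)$, $M_0(\theta)$ maps $E^U(\theta)$ bijectively onto $E^U(\theta+\alpha)$, and for all $\theta$ and $N\ge 0$ one has $|M_0(\theta,N)v|\le C_0\lambda_S^N|v|$ for $v\in E^S(\theta)$ and $|v|\le C_0\lambda_U^{-N}|M_0(\theta,N)v|$ for $v\in E^U(\theta)$.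 For $k\ge1$ put $$F_k(K_0,\dots,K_k)(\theta,\omega)=\frac1{k!}\frac{d^k}{d\varepsilon^k}\Big|_{\varepsilon=0}F_\varepsilon\Big(\sum_{i=0}^{k}\varepsilon^iK_i(\theta,\omega),\theta,\omega\Big),\qquad \mathcal R_{k-1}(K_0,\dots,K_{k-1})=F_k(K_0,\dots,K_{k-1},0),$$ where $K_0(\theta,\omega)=K_0(\theta)$. Then there are $\varepsilon_0>0$, $C$, maps $K_1,\dots,K_{l-1}:\mathbb T^m\times\Omega\to\mathbb R^{2d}$ and, for each $|\varepsilon|<\varepsilon_0$, a map $K_\varepsilon:\mathbb T^m\times\Omega\to U$ such that the following hold (equations and estimates hold for almost every $\omega$ and all $\theta$). 1. For $1\le k\le l-1$, $K_k\in\mathcal L^\infty(C^0)$ is the unique (up to a null set of $\omega$) solution in $\mathcal L^\infty(C^0)$ of $$M_0(\theta)K_k(\theta,\omega)-K_k(\theta+\alpha,\Phi\omega)=-\mathcal R_{k-1}(K_0,\dots,K_{k-1})(\theta,\omega),$$ and $K_k(\theta+\alpha,\Phi\omega)=F_k(K_0,\dots,K_k)(\theta,\omega)$. For $|\varepsilon|<\varepsilon_0$,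 $K_\varepsilon\in\mathcal L^\infty(C^0)$, $$F_\varepsilon(K_\varepsilon(\theta,\omega),\theta,\omega)=K_\varepsilon(\theta+\alpha,\Phi\omega),\qquad \Big|K_\varepsilon(\theta,\omega)-\sum_{k=0}^{l-1}\varepsilon^kK_k(\theta,\omega)\Big|\le C|\varepsilon|^l.$$ 2. For every integer $r\ge0$: if moreover $F_\varepsilon$ is of class $\mathcal L^\infty(C^{r,l,l})$ and, for each fixed $\varepsilon$, $F_\varepsilon$ is of class $\mathcal L^\infty(C^r)$ (which is automatic if $r\le l$), then $K_\varepsilon\in\mathcal L^\infty(C^r)$ for all $|\varepsilon|<\varepsilon_0$. -/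

import Mathlib

open MeasureTheory Set


namespace RandomTorus

/-- The phase space `ℝ^{2d}` with its Euclidean norm. -/
abbrev Phase (d : ℕ) : Type := EuclideanSpace ℝ (Fin (2 * d))

/-- `ℝ^m`, the universal cover of the torus. -/
abbrev Cover (m : ℕ) : Type := EuclideanSpace ℝ (Fin m)

/-- The torus `𝕋^m = ℝ^m / ℤ^m`. -/
abbrev Torus (m : ℕ) : Type := Fin m → UnitAddCircle

/-- The covering map `ℝ^m → 𝕋^m`. It is a local diffeomorphism, and derivatives with respect to
`θ ∈ 𝕋^m` are taken in the coordinate `t ∈ ℝ^m` with `θ = proj t`. -/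
def proj {m : ℕ} (t : Cover m) : Torus m := fun i => (t i : UnitAddCircle)

variable {d m : ℕ} {Ω : Type*} [MeasurableSpace Ω]

/-- `D_θ^i D_z^j D_ε^k F` at `(z, θ, ε, ω)`, where `θ = proj t`. -/
noncomputable def mixedDeriv (F : Phase d → Torus m → ℝ → Ω → Phase d) (i j k : ℕ) (ω : Ω)
    (z : Phase d) (t : Cover m) (ε : ℝ) :
    ContinuousMultilinearMap ℝ (fun _ : Fin i => Cover m)
      (ContinuousMultilinearMap ℝ (fun _ : Fin j => Phase d) (Phase d)) :=
  iteratedFDeriv ℝ i (fun t' => iteratedFDeriv ℝ j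
    (fun z' => iteratedDeriv k (fun s => F z' (proj t') s ω) ε) z) t

/-- The class `L^∞(C^Ξ)` of maps `F : U × 𝕋^m × ℝ × Ω → ℝ^{2d}`, for a set `Ξ` of indices
`(i, j, k)` closed under passing to smaller indices: for every `ε` the map is jointly measurable in
`(z, θ, ω)`; for every `(i, j, k) ∈ Ξ` and almost every `ω` the derivative `D_θ^i D_z^j D_ε^k F`
exists and is jointly continuous in `(z, θ, ε)`; and these derivatives are bounded uniformly in
`(z, θ, ε)` and in almost every `ω`. Values of `F` at points `z ∉ U` play no role. -/
structure LInfC (P : Measure Ω) (U : Set (Phase d)) (Ξ : Set (ℕ × ℕ × ℕ))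
    (F : Phase d → Torus m → ℝ → Ω → Phase d) : Prop where
  measurable : ∀ ε : ℝ, Measurable fun p : U × Torus m × Ω => F p.1 p.2.1 ε p.2.2
  diff_eps : ∀ i j k : ℕ, (i, j, k) ∈ Ξ → ∀ᵐ ω ∂P, ∀ z ∈ U, ∀ θ : Torus m,
    ContDiff ℝ k (fun s : ℝ => F z θ s ω)
  diff_z : ∀ i j k : ℕ, (i, j, k) ∈ Ξ → ∀ᵐ ω ∂P, ∀ (θ : Torus m) (ε : ℝ),
    ContDiffOn ℝ j (fun z => iteratedDeriv k (fun s => F z θ s ω) ε) U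
  diff_theta : ∀ i j k : ℕ, (i, j, k) ∈ Ξ → ∀ᵐ ω ∂P, ∀ z ∈ U, ∀ ε : ℝ,
    ContDiff ℝ i (fun t : Cover m => iteratedFDeriv ℝ j
      (fun z' => iteratedDeriv k (fun s => F z' (proj t) s ω) ε) z)
  continuous : ∀ i j k : ℕ, (i, j, k) ∈ Ξ → ∀ᵐ ω ∂P,
    ContinuousOn (fun p : Phase d × Cover m × ℝ => mixedDeriv F i j k ω p.1 p.2.1 p.2.2)
      (U ×ˢ univ)
  bounded : ∃ C : ℝ, ∀ i j k : ℕ, (i, j, k) ∈ Ξ → ∀ᵐ ω ∂P, ∀ z ∈ U, ∀ (t : Cover m) (ε : ℝ),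
    ‖mixedDeriv F i j k ω z t ε‖ ≤ C

/-- The index set of `C^{r,s,l}`: at most `r` derivatives in `θ`, `s` in `z` and `l` in `ε`. -/
def boxIndex (r s l : ℕ) : Set (ℕ × ℕ × ℕ) := {q | q.1 ≤ r ∧ q.2.1 ≤ s ∧ q.2.2 ≤ l}

/-- The index set of the (joint) `C^r` class in `(z, θ)`: `i + j ≤ r`, no derivative in `ε`. -/
def jointIndex (r : ℕ) : Set (ℕ × ℕ × ℕ) := {q | q.1 + q.2.1 ≤ r ∧ q.2.2 = 0}

/-- For a fixed value of `ε`, the map `F_ε` is of class `L^∞(C^r)` on `U × 𝕋^m`. -/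
def FrozenLInfC (P : Measure Ω) (U : Set (Phase d)) (r : ℕ)
    (F : Phase d → Torus m → ℝ → Ω → Phase d) (ε : ℝ) : Prop :=
  LInfC P U (jointIndex r) (fun z θ _ ω => F z θ ε ω)

/-- The class `L^∞(Ω, C^r(𝕋^m, ℝ^{2d}))` of random maps: jointly measurable, `C^r` in `θ` for almost
every `ω`, with derivatives up to order `r` bounded uniformly in `θ` and in almost every `ω`. -/
structure RandomMap (P : Measure Ω) (r : ℕ) (κ : Torus m → Ω → Phase d) : Prop where
  measurable : Measurable (fun p : Torus m × Ω => κ p.1 p.2)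
  contDiff : ∀ᵐ ω ∂P, ContDiff ℝ r (fun t : Cover m => κ (proj t) ω)
  bounded : ∃ C : ℝ, ∀ i : ℕ, i ≤ r → ∀ᵐ ω ∂P, ∀ t : Cover m,
    ‖iteratedFDeriv ℝ i (fun t' : Cover m => κ (proj t') ω) t‖ ≤ C

/-- The transfer matrix `M₀(θ) = D_z F₀(K₀(θ), θ)` of a deterministic torus. -/
noncomputable def transferMatrix (F₀ : Phase d → Torus m → Phase d) (K₀ : Torus m → Phase d)
    (θ : Torus m) : Phase d →L[ℝ] Phase d :=
  fderiv ℝ (fun z => F₀ z θ) (K₀ θ)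

/-- The forward cocycle `M(θ, N) = M(θ + (N-1)α) ⋯ M(θ + α) M(θ)`, with `M(θ, 0) = Id`. -/
noncomputable def cocycle (M : Torus m → Phase d →L[ℝ] Phase d) (α : Torus m) :
    ℕ → Torus m → Phase d →L[ℝ] Phase d
  | 0, _ => ContinuousLinearMap.id ℝ (Phase d)
  | N + 1, θ => (M (θ + N • α)).comp (cocycle M α N θ)

/-- Hyperbolicity of the linear skew-product `(v, θ) ↦ (M(θ) v, θ + α)`: there is a continuous
invariant splitting `ℝ^{2d} = E^S(θ) ⊕ E^U(θ)`, given by the complementary projections `PS`, `PU`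
onto `E^S(θ) = {v | PS θ v = v}` and `E^U(θ) = {v | PU θ v = v}`, on which `M` contracts,
respectively is invertible and expands, exponentially and uniformly.

Since `M(θ, N)` maps `E^U(θ)` bijectively onto `E^U(θ + Nα)`, `unstable` is the backward estimate
`|M(θ', -N) w| ≤ C λ_U^{-N} |w|` for `w ∈ E^U(θ')`, `θ' = θ + Nα`. No inverse of `M` outside `E^U`
is needed. The two estimates characterize the vectors of `E^S` and of `E^U`: a vector with a nonzero
component in the other bundle violates them. -/
structure HyperbolicSplitting (M : Torus m → Phase d →L[ℝ] Phase d) (α : Torus m)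
    (PS PU : Torus m → Phase d →L[ℝ] Phase d) (C lamS lamU : ℝ) : Prop where
  continuous_PS : Continuous PS
  continuous_PU : Continuous PU
  add_eq : ∀ θ v, PS θ v + PU θ v = v
  PS_PS : ∀ θ v, PS θ (PS θ v) = PS θ v
  PU_PU : ∀ θ v, PU θ (PU θ v) = PU θ v
  invariant_S : ∀ θ, MapsTo (M θ) {v | PS θ v = v} {v | PS (θ + α) v = v}
  invariant_U : ∀ θ, BijOn (M θ) {v | PU θ v = v} {v | PU (θ + α) v = v}
  C_pos : 0 < C
  lamS_pos : 0 < lamS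
  lamS_lt : lamS < 1
  lamU_gt : 1 < lamU
  stable : ∀ θ v, PS θ v = v → ∀ N : ℕ, ‖cocycle M α N θ v‖ ≤ C * lamS ^ N * ‖v‖
  unstable : ∀ θ v, PU θ v = v → ∀ N : ℕ, ‖v‖ ≤ C * (lamU ^ N)⁻¹ * ‖cocycle M α N θ v‖

/-- `K₀` parameterizes a normally hyperbolic continuous invariant torus, contained in `U`, of the
deterministic skew-product `(z, θ) ↦ (F₀(z, θ), θ + α)`. -/
structure NormallyHyperbolicTorus (U : Set (Phase d)) (F₀ : Phase d → Torus m → Phase d)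
    (α : Torus m) (K₀ : Torus m → Phase d) : Prop where
  continuous : Continuous K₀
  mem : ∀ θ, K₀ θ ∈ U
  invariant : ∀ θ, F₀ (K₀ θ) θ = K₀ (θ + α)
  hyperbolic : ∃ (PS PU : Torus m → Phase d →L[ℝ] Phase d) (C lamS lamU : ℝ),
    HyperbolicSplitting (transferMatrix F₀ K₀) α PS PU C lamS lamU

/-- The partial sum `κ₀ + ε κ₁ + ⋯ + ε^{n-1} κ_{n-1}`. -/
noncomputable def partialSum (κ : ℕ → Torus m → Ω → Phase d) (n : ℕ) (ε : ℝ) (θ : Torus m)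
    (ω : Ω) : Phase d :=
  ∑ i ∈ Finset.range n, ε ^ i • κ i θ ω

/-- The coefficient
`F_k(κ₀, …, κ_k) = (1/k!) (d/dε)^k F_ε(κ₀ + ε κ₁ + ⋯ + ε^k κ_k, θ, ε, ω)` at `ε = 0`. -/
noncomputable def coeff (F : Phase d → Torus m → ℝ → Ω → Phase d)
    (κ : ℕ → Torus m → Ω → Phase d) (k : ℕ) (θ : Torus m) (ω : Ω) : Phase d :=
  ((k.factorial : ℝ))⁻¹ • iteratedDeriv k (fun s => F (partialSum κ (k + 1) s θ ω) θ s ω) 0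

/-- The remainder `R_k(κ₀, …, κ_k)`: the part of `F_{k+1}` that does not involve `κ_{k+1}`, that is,
the value of `F_{k+1}(κ₀, …, κ_k, κ_{k+1})` for `κ_{k+1} = 0`. -/
noncomputable def remainder (F : Phase d → Torus m → ℝ → Ω → Phase d)
    (κ : ℕ → Torus m → Ω → Phase d) (k : ℕ) (θ : Torus m) (ω : Ω) : Phase d :=
  (((k + 1).factorial : ℝ))⁻¹ •
    iteratedDeriv (k + 1) (fun s => F (partialSum κ (k + 1) s θ ω) θ s ω) 0

/-- `κ` solves the linear cohomological equation
`M(θ) κ(θ, ω) - κ(θ + α, Φ ω) = - R(θ, ω)` for almost every `ω` and all `θ`. -/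
def SolvesCohomological (P : Measure Ω) (Φ : Ω → Ω) (α : Torus m)
    (M : Torus m → Phase d →L[ℝ] Phase d) (R κ : Torus m → Ω → Phase d) : Prop :=
  ∀ᵐ ω ∂P, ∀ θ : Torus m, M θ (κ θ ω) - κ (θ + α) (Φ ω) = -R θ ω

end RandomTorus

/-! Every assertion reduces to one inhomogeneous linear equation over the skew shift, `x (τ p) = M
(π p) (x p) + r p`. Hyperbolicity supplies Green kernels: the stable component of `x` is a series in
past defects, the unstable one a series in future defects, and both converge geometrically. Hence
bounded right-hand sides have bounded solutions, and bounded solutions are controlled by their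
defects, even after the linear part is perturbed by a small `η` (`norm_le_of_perturbation`). No
measurability or topology in `ω` enters these estimates: realizations are mere indices.

The estimate tolerates defects that grow along the orbit at the slow rate `weight lam`. Therefore
defects that are uniformly bounded and tend to zero at each fixed time, without uniformity in time,
force the solution to tend to zero (`tendsto_zero`). Applied to increments this gives continuity,
and applied to difference quotients minus a candidate derivative it gives differentiability
(`Dichotomy.exists_hasFDerivAt`).

The torus for small `ε` is `K₀ + v`, where `v` is the fixed point of the Green operator composed
with the nonlinear error; the contraction factor is `1/2` (`exists_solution`). Each coefficient
`K_k` solves the linear equation, because `F_k` is affine in `K_k` with linear part `M₀`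
(`coeff_eq`). The partial sum of order `l` is then invariant up to `O(|ε|^l)`, and the a priori
estimate converts this defect into the distance to `K_ε`.

For higher regularity, the base map is a translation, so the derivative of the invariance equation
in `θ` is again linear with a linear part close to `M₀`, and no growth of the base dynamics has to
be compensated. Regularity is gained one order at a time (`reg_of_linear`, `reg_of_nonlinear`) with
the same `η`, which is why `ε₀` does not depend on `r`. -/

namespace RandomTorus

set_option linter.unusedSectionVars false
set_option maxSynthPendingDepth 3

/-! ### Calculus of families with uniformly bounded derivatives in one variable. -/

section Regularity

universe u

open Filter Topology

/-- Mixed partial derivatives commute as soon as one of them is continuous. -/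
theorem hasFDerivAt_partial_swap {X Y W : Type*} [NormedAddCommGroup X] [NormedSpace ℝ X]
    [NormedAddCommGroup Y] [NormedSpace ℝ Y] [NormedAddCommGroup W] [NormedSpace ℝ W]
    {SX : Set X} {SY : Set Y} (hSX : IsOpen SX) (hSY : IsOpen SY)
    {g : X → Y → W} {gx : X → Y → X →L[ℝ] W} {gy : X → Y → Y →L[ℝ] W}
    {gxy : X → Y → Y →L[ℝ] X →L[ℝ] W}
    (hx : ∀ x ∈ SX, ∀ y ∈ SY, HasFDerivAt (fun x => g x y) (gx x y) x)
    (hy : ∀ x ∈ SX, ∀ y ∈ SY, HasFDerivAt (fun y => g x y) (gy x y) y)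
    (hxy : ∀ x ∈ SX, ∀ y ∈ SY, HasFDerivAt (fun y => gx x y) (gxy x y) y)
    {x₀ : X} {y₀ : Y} (hx₀ : x₀ ∈ SX) (hy₀ : y₀ ∈ SY)
    (hc : ContinuousAt (fun p : X × Y => gxy p.1 p.2) (x₀, y₀)) :
    HasFDerivAt (fun x => gy x y₀) (gxy x₀ y₀).flip x₀ := by
  rw [hasFDerivAt_iff_isLittleO, Asymptotics.isLittleO_iff]
  intro δ hδ
  have h1 : ∀ᶠ p in 𝓝 (x₀, y₀), p.1 ∈ SX ∧ p.2 ∈ SY ∧ ‖gxy p.1 p.2 - gxy x₀ y₀‖ ≤ δ := by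
    have a : ∀ᶠ p : X × Y in 𝓝 (x₀, y₀), p.1 ∈ SX :=
      continuousAt_fst.eventually (hSX.mem_nhds hx₀)
    have b : ∀ᶠ p : X × Y in 𝓝 (x₀, y₀), p.2 ∈ SY :=
      continuousAt_snd.eventually (hSY.mem_nhds hy₀)
    have c : ∀ᶠ p : X × Y in 𝓝 (x₀, y₀), ‖gxy p.1 p.2 - gxy x₀ y₀‖ < δ :=
      ContinuousAt.eventually_lt (f := fun p : X × Y => ‖gxy p.1 p.2 - gxy x₀ y₀‖)
        (g := fun _ => δ) (hc.sub continuousAt_const).norm continuousAt_const (by simpa using hδ)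
    filter_upwards [a, b, c] with p ha hb hc
    exact ⟨ha, hb, hc.le⟩
  obtain ⟨ρ, hρ, h2⟩ := Metric.eventually_nhds_iff_ball.1 h1
  have h3 : ∀ x ∈ Metric.ball x₀ ρ, ∀ y ∈ Metric.ball y₀ ρ,
      x ∈ SX ∧ y ∈ SY ∧ ‖gxy x y - gxy x₀ y₀‖ ≤ δ := by
    intro x hx y hy
    apply h2 (x, y)
    rw [← ball_prod_same]
    exact ⟨hx, hy⟩
  have hx₀b := Metric.mem_ball_self (x := x₀) hρ
  have hy₀b := Metric.mem_ball_self (x := y₀) hρ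
  filter_upwards [Metric.ball_mem_nhds x₀ hρ] with x hxb
  set L : Y →L[ℝ] X →L[ℝ] W := gxy x₀ y₀ with hL
  -- The double increment of `g` over a rectangle is compared with the bilinear form `L`: a mean
  -- value inequality in `y` for `gx - L`, followed below by one in `x`.
  have key : ∀ x' ∈ Metric.ball x₀ ρ, ∀ y ∈ Metric.ball y₀ ρ,
      ‖gx x' y - gx x' y₀ - L (y - y₀)‖ ≤ δ * ‖y - y₀‖ := by
    intro x' hx' y hyb
    have := (convex_ball y₀ ρ).norm_image_sub_le_of_norm_hasFDerivWithin_le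
      (f := fun y => gx x' y - L y) (f' := fun y => gxy x' y - L) (C := δ)
      (fun y hy => ((hxy x' (h3 x' hx' y hy).1 y (h3 x' hx' y hy).2.1).sub
        L.hasFDerivAt).hasFDerivWithinAt) (fun y hy => (h3 x' hx' y hy).2.2) hy₀b hyb
    refine le_trans (le_of_eq ?_) this
    congr 1
    simp only [map_sub]; abel
  have hder : HasFDerivAt (fun y => g x y - g x₀ y - L.flip (x - x₀) y)
      (gy x y₀ - gy x₀ y₀ - L.flip (x - x₀)) y₀ :=
    ((hy x (h3 x hxb y₀ hy₀b).1 y₀ hy₀).sub (hy x₀ hx₀ y₀ hy₀)).sub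
      (L.flip (x - x₀)).hasFDerivAt
  -- A Lipschitz bound at `y₀` with constant `δ * ‖x - x₀‖` bounds the derivative in `y`, which is
  -- exactly the remainder of `gy` to be estimated.
  refine hder.le_of_lip' (by positivity) ?_
  filter_upwards [Metric.ball_mem_nhds y₀ hρ] with y hyb
  have := (convex_ball x₀ ρ).norm_image_sub_le_of_norm_hasFDerivWithin_le
      (f := fun x => g x y - g x y₀ - L (y - y₀) x)
      (f' := fun x => gx x y - gx x y₀ - L (y - y₀)) (C := δ * ‖y - y₀‖)
      (fun x' hx' => (((hx x' (h3 x' hx' y hyb).1 y (h3 x' hx' y hyb).2.1).sub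
        (hx x' (h3 x' hx' y hyb).1 y₀ hy₀)).sub (L (y - y₀)).hasFDerivAt).hasFDerivWithinAt)
      (fun x' hx' => key x' hx' y hyb) hx₀b hxb
  refine le_trans (le_of_eq ?_) (this.trans (le_of_eq (by ring)))
  congr 1
  simp only [map_sub, ContinuousLinearMap.flip_apply, sub_apply]; abel

variable {ι Q : Type*} [TopologicalSpace Q]
variable {X Y T V W W₁ W₂ W₃ : Type u}
  [NormedAddCommGroup X] [NormedSpace ℝ X] [NormedAddCommGroup Y] [NormedSpace ℝ Y]
  [NormedAddCommGroup T] [NormedSpace ℝ T] [NormedAddCommGroup V] [NormedSpace ℝ V]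
  [NormedAddCommGroup W] [NormedSpace ℝ W]
  [NormedAddCommGroup W₁] [NormedSpace ℝ W₁] [NormedAddCommGroup W₂] [NormedSpace ℝ W₂]
  [NormedAddCommGroup W₃] [NormedSpace ℝ W₃]

/-- Families that are jointly continuous on `S × P` and bounded uniformly in the index. -/
def UCont (S : Set Y) (P : Set Q) (g : ι → Y → Q → W) : Prop :=
  (∀ i, ContinuousOn (fun p : Y × Q => g i p.1 p.2) (S ×ˢ P)) ∧
    ∃ C : ℝ, ∀ i, ∀ y ∈ S, ∀ q ∈ P, ‖g i y q‖ ≤ C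

/-- Families that are `r` times differentiable in the variable `y ∈ S`, with all derivatives
jointly continuous in `y` and the parameter `q ∈ P`, and bounded uniformly in the index. -/
def UReg (S : Set Y) (P : Set Q) : ℕ → ∀ {W : Type u} [NormedAddCommGroup W] [NormedSpace ℝ W],
    (ι → Y → Q → W) → Prop
  | 0, _, _, _, g => UCont S P g
  | r + 1, W, _, _, g => UCont S P g ∧ ∃ g' : ι → Y → Q → Y →L[ℝ] W,
      (∀ i, ∀ y ∈ S, ∀ q ∈ P, HasFDerivAt (fun y => g i y q) (g' i y q) y) ∧ UReg S P r g'

section OneVariable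

variable {S : Set Y} {P : Set Q} {r : ℕ}

theorem UCont.congr {g h : ι → Y → Q → W} (hg : UCont S P g)
    (e : ∀ i, ∀ y ∈ S, ∀ q ∈ P, g i y q = h i y q) : UCont S P h := by
  obtain ⟨a, C, b⟩ := hg
  exact ⟨fun i => (a i).congr fun p hp => (e i p.1 hp.1 p.2 hp.2).symm, C,
    fun i y hy q hq => e i y hy q hq ▸ b i y hy q hq⟩

theorem UCont.clm (L : W →L[ℝ] V) {g : ι → Y → Q → W} (hg : UCont S P g) :
    UCont S P (fun i y q => L (g i y q)) := by
  obtain ⟨a, C, b⟩ := hg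
  refine ⟨fun i => L.continuous.comp_continuousOn (a i), ‖L‖ * C, fun i y hy q hq => ?_⟩
  exact (L.le_opNorm _).trans (by gcongr; exact b i y hy q hq)

theorem UCont.add {g h : ι → Y → Q → W} (hg : UCont S P g) (hh : UCont S P h) :
    UCont S P (fun i y q => g i y q + h i y q) := by
  obtain ⟨a, C, b⟩ := hg
  obtain ⟨a', C', b'⟩ := hh
  exact ⟨fun i => (a i).add (a' i), C + C', fun i y hy q hq =>
    (norm_add_le _ _).trans (add_le_add (b i y hy q hq) (b' i y hy q hq))⟩

theorem UCont.bilin (B : W₁ →L[ℝ] W₂ →L[ℝ] W₃) {g : ι → Y → Q → W₁} {h : ι → Y → Q → W₂}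
    (hg : UCont S P g) (hh : UCont S P h) : UCont S P (fun i y q => B (g i y q) (h i y q)) := by
  obtain ⟨a, C, b⟩ := hg
  obtain ⟨a', C', b'⟩ := hh
  refine ⟨fun i => B.isBoundedBilinearMap.continuous.comp_continuousOn ((a i).prodMk (a' i)),
    ‖B‖ * C * C', fun i y hy q hq => (B.le_opNorm₂ _ _).trans ?_⟩
  have h0 : 0 ≤ C := (norm_nonneg _).trans (b i y hy q hq)
  gcongr
  exacts [b i y hy q hq, b' i y hy q hq]

theorem UReg.uCont : ∀ {r : ℕ} {g : ι → Y → Q → W}, UReg S P r g → UCont S P g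
  | 0, _, h => h
  | _ + 1, _, h => h.1

theorem UReg.of_succ {r : ℕ} {W : Type u} [NormedAddCommGroup W] [NormedSpace ℝ W]
    {g : ι → Y → Q → W} (h : UReg S P (r + 1) g) : UReg S P r g := by
  induction r generalizing W with
  | zero => exact h.1
  | succ r ih => exact ⟨h.1, h.2.choose, h.2.choose_spec.1, ih h.2.choose_spec.2⟩

theorem UReg.congr (hS : IsOpen S) {W : Type u} [NormedAddCommGroup W] [NormedSpace ℝ W]
    {g h : ι → Y → Q → W} (hg : UReg S P r g)
    (e : ∀ i, ∀ y ∈ S, ∀ q ∈ P, g i y q = h i y q) : UReg S P r h := by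
  cases r with
  | zero => exact UCont.congr hg e
  | succ r =>
    obtain ⟨a, g', b, c⟩ := hg
    refine ⟨a.congr e, g', fun i y hy q hq => (b i y hy q hq).congr_of_eventuallyEq ?_, c⟩
    filter_upwards [hS.mem_nhds hy] with z hz using (e i z hz q hq).symm

theorem UReg.clm {W V : Type u} [NormedAddCommGroup W] [NormedSpace ℝ W]
    [NormedAddCommGroup V] [NormedSpace ℝ V] (L : W →L[ℝ] V) {g : ι → Y → Q → W}
    (hg : UReg S P r g) : UReg S P r (fun i y q => L (g i y q)) := by
  induction r generalizing W V with
  | zero => exact UCont.clm L hg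
  | succ r ih =>
    obtain ⟨a, g', b, c⟩ := hg
    exact ⟨a.clm L, fun i y q => L.comp (g' i y q),
      fun i y hy q hq => L.hasFDerivAt.comp y (b i y hy q hq),
      ih (ContinuousLinearMap.compL ℝ Y W V L) c⟩

theorem UReg.add {W : Type u} [NormedAddCommGroup W] [NormedSpace ℝ W]
    {g h : ι → Y → Q → W} (hg : UReg S P r g) (hh : UReg S P r h) :
    UReg S P r (fun i y q => g i y q + h i y q) := by
  induction r generalizing W with
  | zero => exact UCont.add hg hh
  | succ r ih =>
    obtain ⟨a, g', b, c⟩ := hg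
    obtain ⟨a', h', b', c'⟩ := hh
    exact ⟨a.add a', _, fun i y hy q hq => (b i y hy q hq).add (b' i y hy q hq), ih c c'⟩

/-- Leibniz rule. Composition of operators, evaluation and scalar multiplication are all continuous
bilinear maps, so this one induction covers every product needed later. In each summand the
undifferentiated factor is downgraded by one order to match the other. -/
theorem UReg.bilin {W₁ W₂ W₃ : Type u} [NormedAddCommGroup W₁] [NormedSpace ℝ W₁]
    [NormedAddCommGroup W₂] [NormedSpace ℝ W₂] [NormedAddCommGroup W₃] [NormedSpace ℝ W₃]
    (B : W₁ →L[ℝ] W₂ →L[ℝ] W₃) {g : ι → Y → Q → W₁} {h : ι → Y → Q → W₂}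
    (hg : UReg S P r g) (hh : UReg S P r h) : UReg S P r (fun i y q => B (g i y q) (h i y q)) := by
  induction r generalizing W₁ W₂ W₃ with
  | zero => exact UCont.bilin B hg hh
  | succ r ih =>
    have hg0 := hg.of_succ
    have hh0 := hh.of_succ
    obtain ⟨a, g', b, c⟩ := hg
    obtain ⟨a', h', b', c'⟩ := hh
    exact ⟨a.bilin B a', _,
      fun i y hy q hq => B.hasFDerivAt_of_bilinear (b i y hy q hq) (b' i y hy q hq),
      (ih (B.precompR Y) hg0 c').add (ih (B.precompL Y) c hh0)⟩

theorem UReg.const {W : Type u} [NormedAddCommGroup W] [NormedSpace ℝ W] {c : ι → Q → W}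
    (hc : ∀ i, ContinuousOn (c i) P) {C : ℝ} (hC : ∀ i, ∀ q ∈ P, ‖c i q‖ ≤ C) :
    UReg S P r (fun i _ q => c i q) := by
  have h0 {W : Type u} [NormedAddCommGroup W] [NormedSpace ℝ W] {c : ι → Q → W}
      (hc : ∀ i, ContinuousOn (c i) P) {C : ℝ} (hC : ∀ i, ∀ q ∈ P, ‖c i q‖ ≤ C) :
      UCont S P (fun i (_ : Y) q => c i q) :=
    ⟨fun i => (hc i).comp continuousOn_snd fun p hp => hp.2, C, fun i y _ q hq => hC i q hq⟩
  induction r generalizing W C with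
  | zero => exact h0 hc hC
  | succ r ih =>
    exact ⟨h0 hc hC, fun _ _ _ => 0, fun i y _ q _ => hasFDerivAt_const _ _,
      ih (c := fun _ _ => 0) (C := 0) (fun i => continuousOn_const) (by simp)⟩

/-- Regular families have continuous and uniformly bounded iterated derivatives. -/
theorem UReg.iteratedFDeriv (hS : IsOpen S) {W : Type u} [NormedAddCommGroup W] [NormedSpace ℝ W]
    {g : ι → Y → Q → W} (hg : UReg S P r g) {k : ℕ} (hk : k ≤ r) :
    UCont S P (fun i y q => iteratedFDeriv ℝ k (fun y => g i y q) y) := by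
  induction r generalizing W k with
  | zero =>
    obtain rfl : k = 0 := by omega
    exact UCont.clm
      ((continuousMultilinearCurryFin0 ℝ Y W).symm.toContinuousLinearEquiv.toContinuousLinearMap) hg
  | succ r ih =>
    cases k with
    | zero =>
      exact hg.uCont.clm
        ((continuousMultilinearCurryFin0 ℝ Y W).symm.toContinuousLinearEquiv.toContinuousLinearMap)
    | succ k =>
      obtain ⟨a, g', b, c⟩ := hg
      have h1 := (ih c (by omega : k ≤ r)).clm
        ((continuousMultilinearCurryRightEquiv' ℝ k Y
          W).symm.toContinuousLinearEquiv.toContinuousLinearMap)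
      refine h1.congr fun i y hy q hq => ?_
      rw [iteratedFDeriv_succ_eq_comp_right]
      have : (fun y => g' i y q) =ᶠ[𝓝 y] fun y => fderiv ℝ (fun y => g i y q) y := by
        filter_upwards [hS.mem_nhds hy] with z hz using (b i z hz q hq).fderiv.symm
      simp only [Function.comp_apply]
      rw [(this.iteratedFDeriv ℝ k).eq_of_nhds]
      rfl

theorem UReg.contDiffOn (hS : IsOpen S) {W : Type u} [NormedAddCommGroup W] [NormedSpace ℝ W]
    {g : ι → Y → Q → W} (hg : UReg S P r g) {i : ι} {q : Q} (hq : q ∈ P) :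
    ContDiffOn ℝ r (fun y => g i y q) S := by
  have hc {W : Type u} [NormedAddCommGroup W] [NormedSpace ℝ W] {g : ι → Y → Q → W}
      (h : UCont S P g) : ContinuousOn (fun y => g i y q) S :=
    (h.1 i).comp (f := fun y => (y, q)) (by fun_prop) fun y hy => ⟨hy, hq⟩
  induction r generalizing W with
  | zero =>
    simpa using hc hg
  | succ r ih =>
    obtain ⟨a, g', b, c⟩ := hg
    push_cast
    rw [contDiffOn_succ_iff_fderiv_of_isOpen hS]
    refine ⟨fun y hy => (b i y hy q hq).differentiableAt.differentiableWithinAt, by simp, ?_⟩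
    exact (ih c).congr fun y hy => (b i y hy q hq).fderiv

/-- Continuity and boundedness of the iterated derivatives characterize regular families. -/
theorem UReg.of_iteratedFDeriv (hS : IsOpen S) {W : Type u} [NormedAddCommGroup W]
    [NormedSpace ℝ W] {g : ι → Y → Q → W}
    (hd : ∀ i, ∀ q ∈ P, ContDiffOn ℝ r (fun y => g i y q) S)
    (hc : ∀ k ≤ r, UCont S P (fun i y q => _root_.iteratedFDeriv ℝ k (fun y => g i y q) y)) :
    UReg S P r g := by
  have h0 : UCont S P g := ((hc 0 (by omega)).clm ((continuousMultilinearCurryFin0 ℝ Y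
      W).toContinuousLinearEquiv.toContinuousLinearMap)).congr fun i y _ q _ => by simp
  induction r generalizing W with
  | zero => exact h0
  | succ r ih =>
    have h1 : ∀ k ≤ r, UCont S P (fun i y q => _root_.iteratedFDeriv ℝ k
        (fun y => fderiv ℝ (fun y => g i y q) y) y) := by
      intro k hk
      refine ((hc (k + 1) (by omega)).clm ((continuousMultilinearCurryRightEquiv' ℝ k Y
        W).toContinuousLinearEquiv.toContinuousLinearMap)).congr fun i y hy q hq => ?_
      rw [iteratedFDeriv_succ_eq_comp_right]
      exact (continuousMultilinearCurryRightEquiv' ℝ k Y W).apply_symm_apply _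
    refine ⟨h0, fun i y q => fderiv ℝ (fun y => g i y q) y, fun i y hy q hq => ?_, ih ?_ h1 ?_⟩
    · exact (((hd i q hq).differentiableOn (by simp)).differentiableAt
        (hS.mem_nhds hy)).hasFDerivAt
    · intro i q hq
      have := hd i q hq
      push_cast at this
      exact ((contDiffOn_succ_iff_fderiv_of_isOpen hS).1 this).2.2
    · exact ((h1 0 (by omega)).clm ((continuousMultilinearCurryFin0 ℝ Y
        (Y →L[ℝ] W)).toContinuousLinearEquiv.toContinuousLinearMap)).congr fun i y _ q _ => by simp

end OneVariable

end Regularity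

/-! ### Mixed partial derivatives in two variables, and composition. -/

section TwoVariables

universe u

open Filter Topology

variable {ι Q : Type*} [TopologicalSpace Q]
variable {X Y T V W W₁ W₂ W₃ : Type u}
  [NormedAddCommGroup X] [NormedSpace ℝ X] [NormedAddCommGroup Y] [NormedSpace ℝ Y]
  [NormedAddCommGroup T] [NormedSpace ℝ T] [NormedAddCommGroup V] [NormedSpace ℝ V]
  [NormedAddCommGroup W] [NormedSpace ℝ W]

/-- A family of maps of `(x, y, q)` regarded as maps of `y`, with parameter `(x, q)`. -/
def asOuter (g : ι → X → Y → Q → W) : ι → Y → X × Q → W := fun i y p => g i p.1 y p.2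

variable {SX : Set X} {SY : Set Y} {r : ℕ}

/-- Families for which the derivatives `D_y^i D_x^j` with `i + j ≤ r` are continuous and bounded,
uniformly in the index. -/
def HReg (SX : Set X) (SY : Set Y) : ℕ → ∀ {W : Type u} [NormedAddCommGroup W] [NormedSpace ℝ W],
    (ι → X → Y → Q → W) → Prop
  | 0, _, _, _, g => UReg SY (SX ×ˢ univ) 0 (asOuter g)
  | r + 1, W, _, _, g => UReg SY (SX ×ˢ univ) (r + 1) (asOuter g) ∧
      ∃ gx : ι → X → Y → Q → X →L[ℝ] W,
      (∀ i, ∀ x ∈ SX, ∀ y ∈ SY, ∀ q, HasFDerivAt (fun x => g i x y q) (gx i x y q) x) ∧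
        HReg SX SY r gx

/-- Families all of whose partial derivatives in `x` and `y`, in any order and up to order `r`,
are continuous and bounded, uniformly in the index. -/
def JReg (SX : Set X) (SY : Set Y) : ℕ → ∀ {W : Type u} [NormedAddCommGroup W] [NormedSpace ℝ W],
    (ι → X → Y → Q → W) → Prop
  | 0, _, _, _, g => UCont SY (SX ×ˢ univ) (asOuter g)
  | r + 1, W, _, _, g => UCont SY (SX ×ˢ univ) (asOuter g) ∧
      ∃ (gx : ι → X → Y → Q → X →L[ℝ] W) (gy : ι → X → Y → Q → Y →L[ℝ] W),
      (∀ i, ∀ x ∈ SX, ∀ y ∈ SY, ∀ q, HasFDerivAt (fun x => g i x y q) (gx i x y q) x) ∧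
      (∀ i, ∀ x ∈ SX, ∀ y ∈ SY, ∀ q, HasFDerivAt (fun y => g i x y q) (gy i x y q) y) ∧
      JReg SX SY r gx ∧ JReg SX SY r gy

theorem HReg.clm {W V : Type u} [NormedAddCommGroup W] [NormedSpace ℝ W]
    [NormedAddCommGroup V] [NormedSpace ℝ V] (L : W →L[ℝ] V) {g : ι → X → Y → Q → W}
    (h : HReg SX SY r g) : HReg SX SY r (fun i x y q => L (g i x y q)) := by
  induction r generalizing W V with
  | zero => exact UReg.clm L h
  | succ r ih =>
    obtain ⟨a, gx, b, c⟩ := h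
    exact ⟨a.clm L, fun i x y q => L.comp (gx i x y q),
      fun i x hx y hy q => L.hasFDerivAt.comp x (b i x hx y hy q),
      ih (ContinuousLinearMap.compL ℝ X W V L) c⟩

/-- The outer derivative of a regular family is regular. -/
theorem HReg.outer_deriv (hSX : IsOpen SX) (hSY : IsOpen SY) {W : Type u} [NormedAddCommGroup W]
    [NormedSpace ℝ W] {g : ι → X → Y → Q → W} (h : HReg SX SY (r + 1) g)
    {gy : ι → X → Y → Q → Y →L[ℝ] W}
    (hy : ∀ i, ∀ x ∈ SX, ∀ y ∈ SY, ∀ q, HasFDerivAt (fun y => g i x y q) (gy i x y q) y) :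
    HReg SX SY r gy := by
  have hu {r : ℕ} {W : Type u} [NormedAddCommGroup W]
      [NormedSpace ℝ W] {g : ι → X → Y → Q → W} (h : HReg SX SY (r + 1) g)
      {gy : ι → X → Y → Q → Y →L[ℝ] W}
      (hy : ∀ i, ∀ x ∈ SX, ∀ y ∈ SY, ∀ q, HasFDerivAt (fun y => g i x y q) (gy i x y q) y) :
      UReg SY (SX ×ˢ univ) r (asOuter gy) := by
    obtain ⟨⟨a, g', b, c⟩, -⟩ := h
    exact c.congr hSY fun i y hy' q hq => (b i y hy' q hq).unique (hy i q.1 hq.1 y hy' q.2)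
  induction r generalizing W with
  | zero => exact hu h hy
  | succ r ih =>
    refine ⟨hu h hy, ?_⟩
    obtain ⟨-, gx, b, c⟩ := h
    obtain ⟨⟨-, gxy, d, e⟩, -⟩ := id c
    let gxy' : ι → X → Y → Q → Y →L[ℝ] X →L[ℝ] W := fun i x y q => gxy i y (x, q)
    have d' : ∀ i, ∀ x ∈ SX, ∀ y ∈ SY, ∀ q,
        HasFDerivAt (fun y => gx i x y q) (gxy' i x y q) y :=
      fun i x hx y hy q => d i y hy (x, q) ⟨hx, mem_univ _⟩
    -- The `x`-derivative of `gy` is the flip of the `y`-derivative of `gx`; the induction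
    -- hypothesis, applied to `gx`, makes the latter regular.
    refine ⟨fun i x y q => (gxy' i x y q).flip, fun i x hx y hy' q => ?_, ?_⟩
    · refine hasFDerivAt_partial_swap (g := fun x y => g i x y q) (gx := fun x y => gx i x y q)
        (gy := fun x y => gy i x y q) (gxy := fun x y => gxy' i x y q) hSX hSY
        (fun x hx y hy => b i x hx y hy q) (fun x hx y h => hy i x hx y h q)
        (fun x hx y hy => d' i x hx y hy q) hx hy' ?_
      have h1 := e.uCont.1 i
      have h2 : ContinuousOn (fun p : X × Y => gxy' i p.1 p.2 q) (SX ×ˢ SY) :=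
        h1.comp (f := fun p : X × Y => (p.2, (p.1, q))) (by fun_prop)
          fun p hp => ⟨hp.2, hp.1, mem_univ _⟩
      exact h2.continuousAt ((hSX.prod hSY).mem_nhds ⟨hx, hy'⟩)
    · exact (ih c d').clm (ContinuousLinearMap.flipₗᵢ ℝ Y X
        W).toContinuousLinearEquiv.toContinuousLinearMap

theorem HReg.jReg (hSX : IsOpen SX) (hSY : IsOpen SY) {W : Type u} [NormedAddCommGroup W]
    [NormedSpace ℝ W] {g : ι → X → Y → Q → W} (h : HReg SX SY r g) : JReg SX SY r g := by
  induction r generalizing W with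
  | zero => exact h
  | succ r ih =>
    obtain ⟨gy, hy⟩ : ∃ gy : ι → X → Y → Q → Y →L[ℝ] W,
        ∀ i, ∀ x ∈ SX, ∀ y ∈ SY, ∀ q, HasFDerivAt (fun y => g i x y q) (gy i x y q) y := by
      obtain ⟨⟨-, g', b, -⟩, -⟩ := h
      exact ⟨fun i x y q => g' i y (x, q), fun i x hx y hy q => b i y hy (x, q) ⟨hx, mem_univ _⟩⟩
    have h2 := h.outer_deriv hSX hSY hy
    obtain ⟨a, gx, b, c⟩ := h
    exact ⟨a.uCont, gx, gy, b, hy, ih c, ih h2⟩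

/-- Regularity from the iterated mixed derivatives `D_y^i D_x^j`. -/
theorem HReg.of_iteratedFDeriv (hSX : IsOpen SX) (hSY : IsOpen SY) {W : Type u}
    [NormedAddCommGroup W] [NormedSpace ℝ W] {g : ι → X → Y → Q → W}
    (hx : ∀ i, ∀ y ∈ SY, ∀ q, ContDiffOn ℝ r (fun x => g i x y q) SX)
    (hy : ∀ j k : ℕ, j + k ≤ r → ∀ i, ∀ x ∈ SX, ∀ q, ContDiffOn ℝ k
      (fun y => iteratedFDeriv ℝ j (fun x => g i x y q) x) SY)
    (hc : ∀ j k : ℕ, j + k ≤ r → UCont SY (SX ×ˢ univ) (asOuter fun i x y q =>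
      iteratedFDeriv ℝ k (fun y => iteratedFDeriv ℝ j (fun x => g i x y q) x) y)) :
    HReg SX SY r g := by
  induction r generalizing W with
  | zero =>
    refine ((hc 0 0 le_rfl).clm (((continuousMultilinearCurryFin0 ℝ Y _).trans
      (continuousMultilinearCurryFin0 ℝ X
        W)).toContinuousLinearEquiv.toContinuousLinearMap)).congr fun i y _ q _ => ?_
    simp [asOuter]
  | succ r ih =>
    -- Passing from `D_x^(j+1)` to `D_x^j` of the first derivative is a fixed linear isometry of the
    -- target, so it commutes with all derivatives in `y`.
    have iso : ∀ j : ℕ, ∀ i (q : X × Q) y, (fun y => iteratedFDeriv ℝ j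
        (fun x => fderiv ℝ (fun x => g i x y q.2) x) q.1) y =
        (continuousMultilinearCurryRightEquiv' ℝ j X W) ((fun y => iteratedFDeriv ℝ (j + 1)
          (fun x => g i x y q.2) q.1) y) := by
      intro j i q y
      simp only
      rw [iteratedFDeriv_succ_eq_comp_right]
      exact ((continuousMultilinearCurryRightEquiv' ℝ j X W).apply_symm_apply _).symm
    have iso' : ∀ j : ℕ, ∀ i (q : X × Q), (fun y => iteratedFDeriv ℝ j
        (fun x => fderiv ℝ (fun x => g i x y q.2) x) q.1) =
        (continuousMultilinearCurryRightEquiv' ℝ j X W).toContinuousLinearEquiv ∘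
          (fun y => iteratedFDeriv ℝ (j + 1) (fun x => g i x y q.2) q.1) :=
      fun j i q => funext fun y => iso j i q y
    refine ⟨?_, fun i x y q => fderiv ℝ (fun x => g i x y q) x, fun i x hx' y hy' q => ?_, ih ?_ ?_ ?_⟩
    · have e : ∀ i (q : X × Q), (fun y => iteratedFDeriv ℝ 0 (fun x => g i x y q.2) q.1) =
          ((continuousMultilinearCurryFin0 ℝ X W).symm.toContinuousLinearEquiv) ∘
            (fun y => asOuter g i y q) := by
        intro i q; ext y; simp [asOuter]
      refine UReg.of_iteratedFDeriv hSY (fun i q hq => ?_) fun k hk => ?_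
      · have := hy 0 (r + 1) (by omega) i q.1 hq.1 q.2
        rw [e i q] at this
        exact (ContinuousLinearEquiv.comp_contDiffOn_iff _).1 this
      · have := (hc 0 k (by omega)).clm ((continuousMultilinearCurryFin0 ℝ X
          W).toContinuousLinearEquiv.toContinuousLinearMap.compContinuousMultilinearMapL ℝ
            (fun _ : Fin k => Y) _ _)
        refine this.congr fun i y hy q hq => ?_
        simp only [asOuter]
        rw [e i q, ContinuousLinearEquiv.iteratedFDeriv_comp_left]
        ext v
        simp [asOuter]
    · exact (((hx i y hy' q).differentiableOn (by simp)).differentiableAt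
        (hSX.mem_nhds hx')).hasFDerivAt
    · intro i y hy' q
      have := hx i y hy' q
      push_cast at this
      exact ((contDiffOn_succ_iff_fderiv_of_isOpen hSX).1 this).2.2
    · intro j k hjk i x hx' q
      have := hy (j + 1) k (by omega) i x hx' q
      rw [iso' j i (x, q)]
      exact (ContinuousLinearEquiv.comp_contDiffOn_iff _).2 this
    · intro j k hjk
      have := (hc (j + 1) k (by omega)).clm ((continuousMultilinearCurryRightEquiv' ℝ j X
          W).toContinuousLinearEquiv.toContinuousLinearMap.compContinuousMultilinearMapL ℝ
            (fun _ : Fin k => Y) _ _)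
      refine this.congr fun i y hy q hq => ?_
      simp only [asOuter]
      rw [iso' j i q, ContinuousLinearEquiv.iteratedFDeriv_comp_left]
      rfl

theorem JReg.uCont {g : ι → X → Y → Q → W} (h : JReg SX SY r g) :
    UCont SY (SX ×ˢ univ) (asOuter g) := by
  cases r with
  | zero => exact h
  | succ r => exact h.1

theorem JReg.of_succ {W : Type u} [NormedAddCommGroup W] [NormedSpace ℝ W]
    {g : ι → X → Y → Q → W} (h : JReg SX SY (r + 1) g) : JReg SX SY r g := by
  induction r generalizing W with
  | zero => exact h.1
  | succ r ih =>
    obtain ⟨a, gx, gy, b, c, d, e⟩ := h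
    exact ⟨a, gx, gy, b, c, ih d, ih e⟩

theorem JReg.of_le {g : ι → X → Y → Q → W} {s : ℕ} (h : JReg SX SY r g) (hs : s ≤ r) :
    JReg SX SY s g := by
  induction r with
  | zero => obtain rfl : s = 0 := by omega
            exact h
  | succ r ih =>
    rcases Nat.lt_or_ge s (r + 1) with h' | h'
    · exact ih h.of_succ (by omega)
    · obtain rfl : s = r + 1 := by omega
      exact h

/-- Continuous partial derivatives give joint strict differentiability. -/
theorem hasStrictFDerivAt_of_partial (hSX : IsOpen SX) (hSY : IsOpen SY) {g : X → Y → W}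
    {gx : X → Y → X →L[ℝ] W} {gy : X → Y → Y →L[ℝ] W}
    (hx : ∀ x ∈ SX, ∀ y ∈ SY, HasFDerivAt (fun x => g x y) (gx x y) x)
    (hy : ∀ x ∈ SX, ∀ y ∈ SY, HasFDerivAt (fun y => g x y) (gy x y) y)
    (cx : ContinuousOn (fun p : X × Y => gx p.1 p.2) (SX ×ˢ SY))
    (cy : ContinuousOn (fun p : X × Y => gy p.1 p.2) (SX ×ˢ SY))
    {x : X} {y : Y} (hx' : x ∈ SX) (hy' : y ∈ SY) :
    HasStrictFDerivAt (fun p : X × Y => g p.1 p.2) ((gx x y).coprod (gy x y)) (x, y) := by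
  have hn : SX ×ˢ SY ∈ 𝓝 (x, y) := (hSX.prod hSY).mem_nhds ⟨hx', hy'⟩
  refine hasStrictFDerivAt_uncurry_coprod (u := (x, y)) (f := g) (f₁ := gx) (f₂ := gy)
    ?_ ?_ (cx.continuousAt hn) (cy.continuousAt hn)
  · filter_upwards [hn] with v hv using hx v.1 hv.1 v.2 hv.2
  · filter_upwards [hn] with v hv using hy v.1 hv.1 v.2 hv.2

theorem asOuter_continuousOn {g : ι → X → Y → Q → W} (h : UCont SY (SX ×ˢ univ) (asOuter g))
    (i : ι) : ContinuousOn (fun p : X × Y × Q => g i p.1 p.2.1 p.2.2) (SX ×ˢ SY ×ˢ univ) :=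
  (h.1 i).comp (f := fun p : X × Y × Q => (p.2.1, (p.1, p.2.2))) (by fun_prop)
    fun p hp => ⟨hp.2.1, hp.1, mem_univ _⟩

/-- Continuous families, with regular derivatives if `r ≥ 1`; no bound on the family itself. -/
def DReg (S : Set T) : ℕ → ∀ {W : Type u} [NormedAddCommGroup W] [NormedSpace ℝ W],
    (ι → T → Q → W) → Prop
  | 0, _, _, _, x => ∀ i, ContinuousOn (fun p : T × Q => x i p.1 p.2) (S ×ˢ univ)
  | r + 1, W, _, _, x => (∀ i, ContinuousOn (fun p : T × Q => x i p.1 p.2) (S ×ˢ univ)) ∧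
      ∃ x' : ι → T → Q → T →L[ℝ] W,
        (∀ i, ∀ t ∈ S, ∀ q, HasFDerivAt (fun t => x i t q) (x' i t q) t) ∧ UReg S univ r x'

variable {S : Set T}

theorem UReg.dReg {x : ι → T → Q → W} (h : UReg S univ r x) : DReg S r x := by
  cases r with
  | zero => exact h.1
  | succ r =>
    obtain ⟨a, x', b, c⟩ := h
    exact ⟨a.1, x', fun i t ht q => b i t ht q (mem_univ _), c⟩

/-- The coordinate on the cover is unbounded, hence not in `UReg`, but its derivative is constant.
Substituting it for `θ` is the reason to drop the bound of order zero in `DReg`. -/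
theorem dReg_id : DReg (ι := ι) (Q := Q) S r (fun _ t _ => t) := by
  cases r with
  | zero => exact fun i => by fun_prop
  | succ r =>
    exact ⟨fun i => by fun_prop, fun _ _ _ => ContinuousLinearMap.id ℝ T,
      fun i t _ q => hasFDerivAt_id t,
      UReg.const (c := fun _ _ => ContinuousLinearMap.id ℝ T) (fun i => continuousOn_const)
        (C := ‖ContinuousLinearMap.id ℝ T‖) (fun _ _ _ => le_rfl)⟩

theorem DReg.of_succ {x : ι → T → Q → W} (h : DReg S (r + 1) x) : DReg S r x := by
  cases r with
  | zero => exact h.1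
  | succ r => exact ⟨h.1, h.2.choose, h.2.choose_spec.1, h.2.choose_spec.2.of_succ⟩

theorem DReg.continuousOn {x : ι → T → Q → W} (h : DReg S r x) (i : ι) :
    ContinuousOn (fun p : T × Q => x i p.1 p.2) (S ×ˢ univ) := by
  cases r with
  | zero => exact h i
  | succ r => exact h.1 i

theorem JReg.comp_uCont {g : ι → X → Y → Q → W} {x : ι → T → Q → X} {y : ι → T → Q → Y}
    (hg : JReg SX SY r g) (hx : DReg S r x)
    (hy : DReg S r y) (mx : ∀ i, ∀ t ∈ S, ∀ q, x i t q ∈ SX)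
    (my : ∀ i, ∀ t ∈ S, ∀ q, y i t q ∈ SY) :
    UCont S univ (fun i t q => g i (x i t q) (y i t q) q) := by
  obtain ⟨C, hC⟩ := hg.uCont.2
  refine ⟨fun i => ?_, C, fun i t ht q _ => hC i _ (my i t ht q) (_, q)
    ⟨mx i t ht q, mem_univ _⟩⟩
  exact (asOuter_continuousOn hg.uCont i).comp
    (f := fun p : T × Q => (x i p.1 p.2, y i p.1 p.2, p.2))
    ((hx.continuousOn i).prodMk ((hy.continuousOn i).prodMk continuousOn_snd))
    fun p hp => ⟨mx i p.1 hp.1 p.2, my i p.1 hp.1 p.2, mem_univ _⟩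

/-- Regularity of compositions `g(x(t, q), y(t, q), q)`. -/
theorem JReg.comp (hSX : IsOpen SX) (hSY : IsOpen SY) {W : Type u}
    [NormedAddCommGroup W] [NormedSpace ℝ W] {g : ι → X → Y → Q → W}
    {x : ι → T → Q → X} {y : ι → T → Q → Y} (hg : JReg SX SY r g) (hx : DReg S r x)
    (hy : DReg S r y) (mx : ∀ i, ∀ t ∈ S, ∀ q, x i t q ∈ SX)
    (my : ∀ i, ∀ t ∈ S, ∀ q, y i t q ∈ SY) :
    UReg S univ r (fun i t q => g i (x i t q) (y i t q) q) := by
  induction r generalizing W with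
  | zero => exact hg.comp_uCont hx hy mx my
  | succ r ih =>
    have h0 := hg.comp_uCont hx hy mx my
    have hx0 := hx.of_succ
    have hy0 := hy.of_succ
    obtain ⟨-, gx, gy, a, b, c, d⟩ := hg
    obtain ⟨-, x', ex, ux⟩ := hx
    obtain ⟨-, y', ey, uy⟩ := hy
    have hd : ∀ i, ∀ t ∈ S, ∀ q, HasFDerivAt (fun t => g i (x i t q) (y i t q) q)
        ((gx i (x i t q) (y i t q) q).comp (x' i t q) +
          (gy i (x i t q) (y i t q) q).comp (y' i t q)) t := by
      intro i t ht q
      have hq : ContinuousOn (fun p : X × Y => (p.1, p.2, q)) (SX ×ˢ SY) := by fun_prop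
      have h1 := hasStrictFDerivAt_of_partial hSX hSY (g := fun x y => g i x y q)
        (gx := fun x y => gx i x y q) (gy := fun x y => gy i x y q)
        (fun x hx y hy => a i x hx y hy q) (fun x hx y hy => b i x hx y hy q)
        ((asOuter_continuousOn c.uCont i).comp hq fun p hp => ⟨hp.1, hp.2, mem_univ _⟩)
        ((asOuter_continuousOn d.uCont i).comp hq fun p hp => ⟨hp.1, hp.2, mem_univ _⟩)
        (mx i t ht q) (my i t ht q)
      have h2 := h1.hasFDerivAt.comp t ((ex i t ht q).prodMk (ey i t ht q))
      refine h2.congr_fderiv ?_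
      ext v
      simp
    -- The chain rule needs `gx` and `gy` along the same inner maps, one order lower; the induction
    -- therefore runs over the outer family, with the inner maps downgraded.
    have cx := ih c hx0 hy0
    have cy := ih d hx0 hy0
    exact ⟨h0, _, fun i t ht q _ => hd i t ht q,
      ((cx).bilin (ContinuousLinearMap.compL ℝ T X W) ux).add
        ((cy).bilin (ContinuousLinearMap.compL ℝ T Y W) uy)⟩

end TwoVariables

/-! ### Green operator of an exponential dichotomy and its a priori estimates. -/

section Dichotomy

open Filter Topology

variable {Θ V X : Type*} [AddCommGroup Θ] [NormedAddCommGroup V] [NormedSpace ℝ V]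

/-- Green kernels `GS k θ = M(θ - kα, k) P^S`, `GU k θ = M(θ + kα, -k) P^U` of an exponentially
dichotomic cocycle, characterized by their recursions in both directions. -/
structure Dichotomy (M : Θ → V →L[ℝ] V) (α : Θ) (GS GU : ℕ → Θ → V →L[ℝ] V) (C lam : ℝ) :
    Prop where
  C_nonneg : 0 ≤ C
  lam_pos : 0 < lam
  lam_lt : lam < 1
  add_zero : ∀ θ v, GS 0 θ v + GU 0 θ v = v
  GS_left : ∀ k θ v, GS (k + 1) (θ + α) v = M θ (GS k θ v)
  GU_left : ∀ k θ v, M θ (GU (k + 1) θ v) = GU k (θ + α) v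
  GS_right : ∀ (k : ℕ) θ v, GS k θ (M (θ + (-(k : ℤ) - 1) • α) v) = GS (k + 1) θ v
  GU_right : ∀ (k : ℕ) θ v, GU (k + 1) θ (M (θ + (k : ℤ) • α) v) = GU k θ v
  GS_le : ∀ k θ, ‖GS k θ‖ ≤ C * lam ^ k
  GU_le : ∀ k θ, ‖GU k θ‖ ≤ C * lam ^ k

/-- A growth rate `> 1`, slow compared with the dichotomy. -/
noncomputable def weight (lam : ℝ) : ℝ := 2 / (1 + lam)

/-- The norm of the Green operator on sequences of growth rate at most `weight lam`. -/
noncomputable def greenBound (C lam : ℝ) : ℝ := 2 * (C * weight lam / (1 - lam * weight lam))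

/-- The bounded solution of `x (n + 1) = M (θ + n α) (x n) + r n`, at `n = 0`. -/
noncomputable def green (GS GU : ℕ → Θ → V →L[ℝ] V) (θ : Θ) (r : ℤ → V) : V :=
  ∑' k : ℕ, GS k θ (r (-(k : ℤ) - 1)) - ∑' k : ℕ, GU (k + 1) θ (r k)

/-- The bounded solution of `x (τ p) = M (π p) (x p) + r p`. -/
noncomputable def greenMap (GS GU : ℕ → Θ → V →L[ℝ] V) (π : X → Θ) (τ : Equiv.Perm X)
    (r : X → V) (p : X) : V :=
  green GS GU (π p) fun n => r ((τ ^ n) p)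

namespace Dichotomy

variable {M : Θ → V →L[ℝ] V} {α : Θ} {GS GU : ℕ → Θ → V →L[ℝ] V} {C lam : ℝ}

theorem one_lt_weight (h : Dichotomy M α GS GU C lam) : 1 < weight lam := by
  have := h.lam_pos
  have := h.lam_lt
  rw [weight, lt_div_iff₀ (by linarith)]; linarith

theorem lam_mul_weight_lt (h : Dichotomy M α GS GU C lam) : lam * weight lam < 1 := by
  have := h.lam_pos
  have := h.lam_lt
  rw [weight, ← mul_div_assoc, div_lt_one (by linarith)]; linarith

theorem lam_mul_weight_nonneg (h : Dichotomy M α GS GU C lam) : 0 ≤ lam * weight lam :=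
  mul_nonneg h.lam_pos.le (zero_le_one.trans h.one_lt_weight.le)

theorem greenBound_nonneg (h : Dichotomy M α GS GU C lam) : 0 ≤ greenBound C lam := by
  have h1 := h.one_lt_weight
  have h2 := h.lam_mul_weight_lt
  have h3 := h.C_nonneg
  have : 0 ≤ 1 - lam * weight lam := by linarith
  unfold greenBound
  positivity

/-- Unfolding the equation into the past leaves only past defects and one boundary term, damped by
`GS K`. -/
theorem GS_iterate (h : Dichotomy M α GS GU C lam) {θ : Θ} {x r : ℤ → V}
    (hx : ∀ n : ℤ, x (n + 1) = M (θ + n • α) (x n) + r n) (K : ℕ) :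
    GS 0 θ (x 0) = ∑ k ∈ Finset.range K, GS k θ (r (-(k : ℤ) - 1)) + GS K θ (x (-(K : ℤ))) := by
  induction K with
  | zero => simp
  | succ K ih =>
    rw [ih, Finset.sum_range_succ, add_assoc]
    congr 1
    have := hx (-(K : ℤ) - 1)
    rw [sub_add_cancel] at this
    rw [this, map_add, h.GS_right, add_comm]
    push_cast
    ring_nf

/-- The unstable component is unfolded into the future instead, where `GU` decays. -/
theorem GU_iterate (h : Dichotomy M α GS GU C lam) {θ : Θ} {x r : ℤ → V}
    (hx : ∀ n : ℤ, x (n + 1) = M (θ + n • α) (x n) + r n) (K : ℕ) :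
    GU 0 θ (x 0) = GU K θ (x K) - ∑ k ∈ Finset.range K, GU (k + 1) θ (r k) := by
  induction K with
  | zero => simp
  | succ K ih =>
    rw [ih, Finset.sum_range_succ]
    push_cast
    rw [hx K, map_add, h.GU_right]
    abel

theorem sum_geometric_le (h : Dichotomy M α GS GU C lam) (K : ℕ) :
    ∑ k ∈ Finset.range K, (lam * weight lam) ^ k ≤ (1 - lam * weight lam)⁻¹ := by
  rw [← tsum_geometric_of_lt_one h.lam_mul_weight_nonneg h.lam_mul_weight_lt]
  exact (summable_geometric_of_lt_one h.lam_mul_weight_nonneg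
    h.lam_mul_weight_lt).sum_le_tsum _ fun k _ => pow_nonneg h.lam_mul_weight_nonneg k

/-- The a priori estimate for bounded solutions of the inhomogeneous linear equation. -/
theorem norm_le (h : Dichotomy M α GS GU C lam) {θ : Θ} {x r : ℤ → V} {b c : ℝ}
    (hb : ∀ n, ‖x n‖ ≤ b) (hx : ∀ n : ℤ, x (n + 1) = M (θ + n • α) (x n) + r n)
    (hr : ∀ n : ℤ, ‖r n‖ ≤ c * weight lam ^ n.natAbs) : ‖x 0‖ ≤ greenBound C lam * c := by
  have hw := h.one_lt_weight
  have hC := h.C_nonneg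
  have hl := h.lam_pos
  have hl1 := h.lam_lt
  have hc : 0 ≤ c := by simpa using (norm_nonneg _).trans (hr 0)
  set w := weight lam with hwdef
  set A := C * w * c / (1 - lam * w) with hA
  have hs : ∀ K : ℕ, ∑ k ∈ Finset.range K, C * w * c * (lam * w) ^ k ≤ A := by
    intro K
    rw [← Finset.mul_sum, hA, div_eq_mul_inv]
    exact mul_le_mul_of_nonneg_left (h.sum_geometric_le K) (by positivity)
  have h1 : ∀ K : ℕ, ‖∑ k ∈ Finset.range K, GS k θ (r (-(k : ℤ) - 1))‖ ≤ A := by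
    intro K
    refine (norm_sum_le_of_le _ fun k _ => ?_).trans (hs K)
    refine ((GS k θ).le_opNorm _).trans ?_
    refine (mul_le_mul (h.GS_le k θ) (hr _) (norm_nonneg _) (by positivity)).trans (le_of_eq ?_)
    have : (-(k : ℤ) - 1).natAbs = k + 1 := by omega
    rw [this]; ring
  have h2 : ∀ K : ℕ, ‖∑ k ∈ Finset.range K, GU (k + 1) θ (r k)‖ ≤ A := by
    intro K
    refine (norm_sum_le_of_le _ fun k _ => ?_).trans (hs K)
    refine ((GU (k + 1) θ).le_opNorm _).trans ?_
    refine (mul_le_mul (h.GU_le _ θ) (hr _) (norm_nonneg _) (by positivity)).trans ?_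
    have e1 : C * lam ^ (k + 1) * (c * w ^ (k : ℤ).natAbs) = C * lam * c * (lam * w) ^ k := by
      rw [Int.natAbs_natCast]; ring
    rw [e1]
    -- The future sum carries a factor `lam` where the past sum carries `w`; enlarging it lets both
    -- share the bound `A`.
    have : lam ≤ w := by linarith
    gcongr
  -- Boundedness of `x` is used only here: the boundary terms at times `K` and `-K` are at most `C *
  -- lam ^ K * b` and disappear in the limit.
  have h3 : ∀ K : ℕ, ‖x 0‖ ≤ greenBound C lam * c + 2 * (C * b) * lam ^ K := by
    intro K
    rw [← h.add_zero θ (x 0), h.GS_iterate hx K, h.GU_iterate hx K]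
    have e1 : ‖GS K θ (x (-(K : ℤ)))‖ ≤ C * lam ^ K * b :=
      ((GS K θ).le_opNorm _).trans
        (mul_le_mul (h.GS_le K θ) (hb _) (norm_nonneg _) (by positivity))
    have e2 : ‖GU K θ (x K)‖ ≤ C * lam ^ K * b :=
      ((GU K θ).le_opNorm _).trans
        (mul_le_mul (h.GU_le K θ) (hb _) (norm_nonneg _) (by positivity))
    have e3 : greenBound C lam * c = 2 * A := by rw [greenBound, hA]; ring
    refine (norm_add_le _ _).trans ?_
    have := norm_add_le (∑ k ∈ Finset.range K, GS k θ (r (-(k : ℤ) - 1))) (GS K θ (x (-(K : ℤ))))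
    have := norm_sub_le (GU K θ (x K)) (∑ k ∈ Finset.range K, GU (k + 1) θ (r k))
    have := h1 K
    have := h2 K
    linarith
  have h4 : Tendsto (fun K : ℕ => greenBound C lam * c + 2 * (C * b) * lam ^ K) atTop
      (𝓝 (greenBound C lam * c + 2 * (C * b) * 0)) :=
    ((tendsto_pow_atTop_nhds_zero_of_lt_one hl.le hl1).const_mul _).const_add _
  rw [mul_zero, _root_.add_zero] at h4
  exact ge_of_tendsto' h4 h3

/-- The a priori estimate for small perturbations of the linear equation. -/
theorem norm_le_of_perturbation (h : Dichotomy M α GS GU C lam) {η : ℝ} (hη : 0 ≤ η)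
    (hG : greenBound C lam * η ≤ 1 / 2) {θ : Θ} {x : ℤ → V} {b c : ℝ} (hc : 0 ≤ c)
    (hb : ∀ n, ‖x n‖ ≤ b)
    (hx : ∀ n : ℤ, ‖x (n + 1) - M (θ + n • α) (x n)‖ ≤ η * ‖x n‖ + c * weight lam ^ n.natAbs) :
    ‖x 0‖ ≤ 2 * greenBound C lam * c := by
  have hw := h.one_lt_weight
  have hg := h.greenBound_nonneg
  set w := weight lam with hwdef
  have hb0 : 0 ≤ b := (norm_nonneg _).trans (hb 0)
  have hw1 : ∀ n : ℤ, 1 ≤ w ^ n.natAbs := fun n => one_le_pow₀ hw.le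
  have hbd : BddAbove (range fun n : ℤ => ‖x n‖ / w ^ n.natAbs) := by
    refine ⟨b, ?_⟩
    rintro _ ⟨n, rfl⟩
    exact (div_le_self (norm_nonneg _) (hw1 n)).trans (hb n)
  -- This weighted supremum is finite because `x` is bounded. The estimate at every point of the
  -- orbit gives `N ≤ greenBound * (η N + c)`, and `greenBound * η ≤ 1/2` absorbs the term with `N`.
  set N := ⨆ n : ℤ, ‖x n‖ / w ^ n.natAbs with hN
  have hxN : ∀ n, ‖x n‖ ≤ N * w ^ n.natAbs := by
    intro n
    rw [← div_le_iff₀ (zero_lt_one.trans_le (hw1 n))]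
    exact le_ciSup hbd n
  have hN0 : 0 ≤ N := by simpa using (norm_nonneg _).trans (hxN 0)
  have key : ∀ n : ℤ, ‖x n‖ / w ^ n.natAbs ≤ greenBound C lam * (η * N + c) := by
    intro n
    rw [div_le_iff₀ (zero_lt_one.trans_le (hw1 n)), mul_assoc]
    have := h.norm_le (θ := θ + n • α) (x := fun k => x (n + k))
      (r := fun k => x (n + k + 1) - M (θ + n • α + k • α) (x (n + k))) (b := b)
      (c := (η * N + c) * w ^ n.natAbs) (fun k => hb _) (fun k => by rw [← add_assoc]; abel) ?_
    · simpa using this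
    · intro k
      rw [add_assoc θ, ← add_smul]
      -- Submultiplicativity of the weight: recentring the orbit at time `n` costs exactly the
      -- factor by which the claim is relaxed there.
      have h1 : w ^ (n + k).natAbs ≤ w ^ n.natAbs * w ^ k.natAbs := by
        rw [← pow_add]
        exact pow_le_pow_right₀ hw.le (Int.natAbs_add_le n k)
      calc _ ≤ η * ‖x (n + k)‖ + c * w ^ (n + k).natAbs := hx _
        _ ≤ η * (N * w ^ (n + k).natAbs) + c * w ^ (n + k).natAbs := by
          gcongr; exact hxN _
        _ = (η * N + c) * w ^ (n + k).natAbs := by ring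
        _ ≤ (η * N + c) * (w ^ n.natAbs * w ^ k.natAbs) := by gcongr
        _ = _ := by ring
  have h1 : N ≤ greenBound C lam * (η * N + c) := ciSup_le key
  have h2 : ‖x 0‖ ≤ N := by simpa using hxN 0
  nlinarith

/-- If the defects of bounded almost-solutions tend to zero along every orbit, then the solutions
tend to zero. -/
theorem tendsto_zero (h : Dichotomy M α GS GU C lam) {η : ℝ} (hη : 0 ≤ η)
    (hG : greenBound C lam * η ≤ 1 / 2) {H : Type*} {F : Filter H} {θ : H → Θ} {x : H → ℤ → V}
    {ρ : H → ℤ → ℝ} {b B : ℝ} (hb : ∀ᶠ s in F, ∀ n, ‖x s n‖ ≤ b)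
    (hx : ∀ᶠ s in F, ∀ n : ℤ,
      ‖x s (n + 1) - M (θ s + n • α) (x s n)‖ ≤ η * ‖x s n‖ + ρ s n)
    (hB : ∀ᶠ s in F, ∀ n, ρ s n ≤ B) (hρ : ∀ n, Tendsto (fun s => ρ s n) F (𝓝 0)) :
    Tendsto (fun s => x s 0) F (𝓝 0) := by
  rw [Metric.tendsto_nhds]
  intro δ hδ
  have hw := h.one_lt_weight
  have hg := h.greenBound_nonneg
  set c := δ / (2 * greenBound C lam + 1) with hc
  have hc0 : 0 < c := by positivity
  -- Beyond time `N` the growing weight beats the uniform bound `B`; the finitely many remaining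
  -- times are settled by convergence at each fixed time.
  obtain ⟨N, hN⟩ := pow_unbounded_of_one_lt (B / c) hw
  rw [div_lt_iff₀ hc0] at hN
  have hfin : ∀ᶠ s in F, ∀ n ∈ Finset.Icc (-(N : ℤ)) N, ρ s n < c := by
    rw [Filter.eventually_all_finset]
    exact fun n _ => (hρ n).eventually_lt_const hc0
  filter_upwards [hb, hx, hB, hfin] with s h1 h2 h3 h4
  have := h.norm_le_of_perturbation hη hG hc0.le h1 (fun n => (h2 n).trans ?_)
  · rw [dist_zero_right]
    refine this.trans_lt ?_
    rw [hc, ← mul_div_assoc, div_lt_iff₀ (by positivity)]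
    nlinarith
  · have : 1 ≤ weight lam ^ n.natAbs := one_le_pow₀ hw.le
    gcongr
    by_cases hn : n.natAbs ≤ N
    · refine (h4 n (by rw [Finset.mem_Icc]; omega)).le.trans ?_
      nlinarith
    · have : weight lam ^ N ≤ weight lam ^ n.natAbs := pow_le_pow_right₀ hw.le (by omega)
      refine (h3 n).trans ?_
      nlinarith

section Green

variable [CompleteSpace V]

theorem norm_GS_apply_le (h : Dichotomy M α GS GU C lam) {θ : Θ} {r : ℤ → V} {b : ℝ}
    (hr : ∀ n, ‖r n‖ ≤ b) (k : ℕ) : ‖GS k θ (r (-(k : ℤ) - 1))‖ ≤ C * b * lam ^ k := by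
  have := h.C_nonneg
  have := h.lam_pos
  refine ((GS k θ).le_opNorm _).trans
    ((mul_le_mul (h.GS_le k θ) (hr _) (norm_nonneg _) (by positivity)).trans (le_of_eq ?_))
  ring

theorem norm_GU_apply_le (h : Dichotomy M α GS GU C lam) {θ : Θ} {r : ℤ → V} {b : ℝ}
    (hr : ∀ n, ‖r n‖ ≤ b) (k : ℕ) : ‖GU (k + 1) θ (r k)‖ ≤ C * b * lam ^ k := by
  have := h.C_nonneg
  have := h.lam_pos
  have := h.lam_lt
  have hb : 0 ≤ b := (norm_nonneg _).trans (hr 0)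
  refine ((GU (k + 1) θ).le_opNorm _).trans
    ((mul_le_mul (h.GU_le _ θ) (hr _) (norm_nonneg _) (by positivity)).trans ?_)
  calc C * lam ^ (k + 1) * b = C * b * lam ^ k * lam := by ring
    _ ≤ C * b * lam ^ k := mul_le_of_le_one_right (by positivity) (by linarith)

theorem summable_bound (h : Dichotomy M α GS GU C lam) (b : ℝ) :
    Summable fun k : ℕ => C * b * lam ^ k :=
  (summable_geometric_of_lt_one h.lam_pos.le h.lam_lt).mul_left _

theorem summable_GS (h : Dichotomy M α GS GU C lam) {θ : Θ} {r : ℤ → V} {b : ℝ}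
    (hr : ∀ n, ‖r n‖ ≤ b) : Summable fun k : ℕ => GS k θ (r (-(k : ℤ) - 1)) :=
  .of_norm_bounded (h.summable_bound b) (h.norm_GS_apply_le hr)

theorem summable_GU (h : Dichotomy M α GS GU C lam) {θ : Θ} {r : ℤ → V} {b : ℝ}
    (hr : ∀ n, ‖r n‖ ≤ b) : Summable fun k : ℕ => GU (k + 1) θ (r k) :=
  .of_norm_bounded (h.summable_bound b) (h.norm_GU_apply_le hr)

theorem exists_norm_green_le (h : Dichotomy M α GS GU C lam) {b : ℝ} : ∃ B, ∀ (θ : Θ) (r : ℤ → V),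
    (∀ n, ‖r n‖ ≤ b) → ‖green GS GU θ r‖ ≤ B := by
  refine ⟨∑' k : ℕ, C * b * lam ^ k + ∑' k : ℕ, C * b * lam ^ k, fun θ r hr =>
    (norm_sub_le _ _).trans (add_le_add ?_ ?_)⟩
  · exact tsum_of_norm_bounded (h.summable_bound b).hasSum (h.norm_GS_apply_le hr)
  · exact tsum_of_norm_bounded (h.summable_bound b).hasSum (h.norm_GU_apply_le hr)

theorem green_step (h : Dichotomy M α GS GU C lam) {θ : Θ} {r : ℤ → V} {b : ℝ}
    (hr : ∀ n, ‖r n‖ ≤ b) :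
    green GS GU (θ + α) (fun n => r (n + 1)) = M θ (green GS GU θ r) + r 0 := by
  have s1 := h.summable_GS (θ := θ) hr
  have s2 := h.summable_GU (θ := θ) hr
  have s3 := h.summable_GS (θ := θ + α) (r := fun n => r (n + 1)) fun n => hr (n + 1)
  have s4 : Summable fun k : ℕ => GU k (θ + α) (r k) := by
    refine (s2.map (M θ) (M θ).continuous).congr fun k => ?_
    simp only [Function.comp_apply]
    exact h.GU_left _ _ _
  have e1 : M θ (∑' k : ℕ, GS k θ (r (-(k : ℤ) - 1))) =
      ∑' k : ℕ, GS (k + 1) (θ + α) (r (-(k : ℤ) - 1)) := by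
    rw [(M θ).map_tsum s1]
    exact tsum_congr fun k => (h.GS_left k θ _).symm
  have e2 : M θ (∑' k : ℕ, GU (k + 1) θ (r k)) = ∑' k : ℕ, GU k (θ + α) (r k) := by
    rw [(M θ).map_tsum s2]
    exact tsum_congr fun k => h.GU_left k θ _
  have e3 := s3.tsum_eq_zero_add
  have e4 := s4.tsum_eq_zero_add
  unfold green
  rw [map_sub, e1, e2, e3, e4]
  have e5 : ∀ k : ℕ, GS (k + 1) (θ + α) (r (-((k + 1 : ℕ) : ℤ) - 1 + 1)) =
      GS (k + 1) (θ + α) (r (-(k : ℤ) - 1)) := by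
    intro k
    congr 2
    push_cast
    ring
  simp only [e5]
  -- The shift moves the defect `r 0` from the future sum to the past sum; its two kernels of index
  -- zero add up to the identity.
  have := h.add_zero (θ + α) (r 0)
  push_cast at this ⊢
  nth_rewrite 3 [← this]
  abel

variable {π : X → Θ} {τ : Equiv.Perm X}

theorem greenMap_step (h : Dichotomy M α GS GU C lam) (hπ : ∀ p, π (τ p) = π p + α)
    {r : X → V} {b : ℝ} (hr : ∀ p, ‖r p‖ ≤ b) (p : X) :
    greenMap GS GU π τ r (τ p) = M (π p) (greenMap GS GU π τ r p) + r p := by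
  have := h.green_step (θ := π p) (r := fun n => r ((τ ^ n) p)) fun n => hr _
  unfold greenMap
  rw [hπ]
  simp only [zpow_zero, Equiv.Perm.coe_one, id_eq] at this
  rw [← this]
  congr 1
  ext n
  rw [zpow_add_one, Equiv.Perm.mul_apply]

theorem orbit_eq (hπ : ∀ p, π (τ p) = π p + α) (p : X) (n : ℤ) : π ((τ ^ n) p) = π p + n • α := by
  induction n with
  | zero => simp
  | succ n ih => rw [add_comm, zpow_add, Equiv.Perm.mul_apply, zpow_one, hπ, ih, add_smul]; simp; abel
  | pred n ih =>
    have h1 := hπ ((τ ^ (-(n : ℤ) - 1)) p)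
    have h2 : τ ((τ ^ (-(n : ℤ) - 1)) p) = (τ ^ (-(n : ℤ))) p := by
      rw [← Equiv.Perm.mul_apply, ← zpow_one_add]; congr 2; ring
    rw [h2, ih] at h1
    rw [sub_smul, one_smul, ← add_sub_assoc, h1]; abel

theorem orbit_succ (p : X) (n : ℤ) : (τ ^ (n + 1)) p = τ ((τ ^ n) p) := by
  rw [add_comm, zpow_add, Equiv.Perm.mul_apply, zpow_one]

/-- A bounded function on the base that almost solves the linear equation is small. -/
theorem norm_apply_le (h : Dichotomy M α GS GU C lam) (hπ : ∀ p, π (τ p) = π p + α)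
    {η : ℝ} (hη : 0 ≤ η) (hG : greenBound C lam * η ≤ 1 / 2) {x : X → V} {b c : ℝ} (hc : 0 ≤ c)
    (hb : ∀ p, ‖x p‖ ≤ b) (hx : ∀ p, ‖x (τ p) - M (π p) (x p)‖ ≤ η * ‖x p‖ + c) (p : X) :
    ‖x p‖ ≤ 2 * greenBound C lam * c := by
  have := h.norm_le_of_perturbation hη hG (θ := π p) (x := fun n => x ((τ ^ n) p)) hc
    (fun n => hb _) fun n => ?_
  · simpa using this
  · rw [orbit_succ, ← orbit_eq hπ]
    refine (hx _).trans ?_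
    have : 1 ≤ weight lam ^ n.natAbs := one_le_pow₀ h.one_lt_weight.le
    gcongr
    nlinarith

/-- The sharper estimate for exact solutions of the linear equation. -/
theorem norm_apply_le_of_eq (h : Dichotomy M α GS GU C lam) (hπ : ∀ p, π (τ p) = π p + α)
    {x r : X → V} {b c : ℝ} (hb : ∀ p, ‖x p‖ ≤ b) (hx : ∀ p, x (τ p) = M (π p) (x p) + r p)
    (hr : ∀ p, ‖r p‖ ≤ c) (p : X) : ‖x p‖ ≤ greenBound C lam * c := by
  have := h.norm_le (θ := π p) (x := fun n => x ((τ ^ n) p)) (r := fun n => r ((τ ^ n) p))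
    (c := c) (fun n => hb _) (fun n => ?_) fun n => ?_
  · simpa using this
  · rw [orbit_succ, ← orbit_eq hπ, hx]
  · have : 1 ≤ weight lam ^ n.natAbs := one_le_pow₀ h.one_lt_weight.le
    have := hr ((τ ^ n) p)
    have h0 := (norm_nonneg _).trans this
    nlinarith

theorem exists_norm_greenMap_le (h : Dichotomy M α GS GU C lam) {r : X → V} {b : ℝ}
    (hr : ∀ p, ‖r p‖ ≤ b) : ∃ B, ∀ p, ‖greenMap GS GU π τ r p‖ ≤ B := by
  obtain ⟨B, hB⟩ := h.exists_norm_green_le (b := b)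
  exact ⟨B, fun p => hB _ _ fun n => hr _⟩

/-- Summing the series gives some bound, and this makes the solution admissible for the a priori
estimate, which then supplies the constant `greenBound`. -/
theorem norm_greenMap_le (h : Dichotomy M α GS GU C lam) (hπ : ∀ p, π (τ p) = π p + α)
    {r : X → V} {b : ℝ} (hr : ∀ p, ‖r p‖ ≤ b) (p : X) :
    ‖greenMap GS GU π τ r p‖ ≤ greenBound C lam * b := by
  obtain ⟨B, hB⟩ := h.exists_norm_greenMap_le (π := π) (τ := τ) hr
  exact h.norm_apply_le_of_eq hπ hB (h.greenMap_step hπ hr) hr p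

theorem norm_greenMap_sub_le (h : Dichotomy M α GS GU C lam) (hπ : ∀ p, π (τ p) = π p + α)
    {r r' : X → V} {b c : ℝ} (hr : ∀ p, ‖r p‖ ≤ b) (hr' : ∀ p, ‖r' p‖ ≤ b)
    (hrr : ∀ p, ‖r p - r' p‖ ≤ c) (p : X) :
    ‖greenMap GS GU π τ r p - greenMap GS GU π τ r' p‖ ≤ greenBound C lam * c := by
  refine h.norm_apply_le_of_eq (x := fun p => greenMap GS GU π τ r p - greenMap GS GU π τ r' p)
    (r := fun p => r p - r' p) (b := greenBound C lam * b + greenBound C lam * b) hπ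
    (fun p => ?_) (fun p => ?_) hrr p
  · exact (norm_sub_le _ _).trans
      (add_le_add (h.norm_greenMap_le hπ hr p) (h.norm_greenMap_le hπ hr' p))
  · rw [h.greenMap_step hπ hr, h.greenMap_step hπ hr', map_sub]; abel

/-- Bounded solutions of small nonlinear perturbations of the linear equation. A class `S` of maps
that is preserved by the iteration and closed under uniform limits contains the solution. -/
theorem exists_solution (h : Dichotomy M α GS GU C lam) (hπ : ∀ p, π (τ p) = π p + α)
    {η : ℝ} (hη : 0 ≤ η) (hG : greenBound C lam * η ≤ 1 / 2) {ψ : X → V → V} {c : ℝ} (hc : 0 ≤ c)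
    (h0 : ∀ p, ‖ψ p 0‖ ≤ c)
    (hψ : ∀ p v v', ‖v‖ ≤ 2 * greenBound C lam * c → ‖v'‖ ≤ 2 * greenBound C lam * c →
      ‖ψ p v - ψ p v'‖ ≤ η * ‖v - v'‖)
    (S : (X → V) → Prop) (S0 : S 0)
    (ST : ∀ x, S x → (∀ p, ‖x p‖ ≤ 2 * greenBound C lam * c) →
      S (greenMap GS GU π τ fun p => ψ p (x p)))
    (Slim : ∀ (u : ℕ → X → V) (x : X → V), (∀ n, S (u n)) → TendstoUniformly u x atTop → S x) :
    ∃ x : X → V, S x ∧ (∀ p, ‖x p‖ ≤ 2 * greenBound C lam * c) ∧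
      ∀ p, x (τ p) = M (π p) (x p) + ψ p (x p) := by
  have hg := h.greenBound_nonneg
  set R := 2 * greenBound C lam * c with hR
  have hR0 : 0 ≤ R := by positivity
  set T : (X → V) → X → V := fun x => greenMap GS GU π τ fun p => ψ p (x p) with hT
  -- Since `greenBound * η ≤ 1/2`, the Lipschitz part contributes at most `η * R ≤ c`. The resulting
  -- bound `2 * c` is what the Green operator maps back into the ball of radius `R`.
  have hψb : ∀ x : X → V, (∀ p, ‖x p‖ ≤ R) → ∀ p, ‖ψ p (x p)‖ ≤ 2 * c := by
    intro x hx p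
    have h1 := hψ p (x p) 0 (hx p) (by simpa using hR0)
    have h2 := h0 p
    have h3 := norm_add_le (ψ p (x p) - ψ p 0) (ψ p 0)
    rw [sub_add_cancel] at h3
    rw [sub_zero] at h1
    have h4 : η * ‖x p‖ ≤ η * R := by gcongr; exact hx p
    have h5 : η * R ≤ c := by rw [hR]; nlinarith
    linarith
  have hTb : ∀ x : X → V, (∀ p, ‖x p‖ ≤ R) → ∀ p, ‖T x p‖ ≤ R := by
    intro x hx p
    refine (h.norm_greenMap_le hπ (hψb x hx) p).trans (le_of_eq ?_)
    rw [hR]; ring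
  set u : ℕ → X → V := fun n => T^[n] 0 with hu
  have us : ∀ n, u (n + 1) = T (u n) := fun n => Function.iterate_succ_apply' T n 0
  have ub : ∀ n p, ‖u n p‖ ≤ R := by
    intro n
    induction n with
    | zero => intro p; simpa [hu] using hR0
    | succ n ih => rw [us]; exact hTb _ ih
  have uS : ∀ n, S (u n) := by
    intro n
    induction n with
    | zero => exact S0
    | succ n ih => rw [us]; exact ST _ ih (ub n)
  -- The iteration contracts in the supremum norm by `greenBound * η ≤ 1/2`. Convergence is thus
  -- uniform in `p`, as the closure property of `S` requires.
  have ud : ∀ n p, ‖u (n + 1) p - u n p‖ ≤ R * (1 / 2) ^ n := by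
    intro n
    induction n with
    | zero => intro p; simpa [hu] using ub 1 p
    | succ n ih =>
      intro p
      have h1 := h.norm_greenMap_sub_le hπ (hψb _ (ub (n + 1))) (hψb _ (ub n))
        (c := η * (R * (1 / 2) ^ n))
        (fun p => (hψ p _ _ (ub (n + 1) p) (ub n p)).trans (by gcongr; exact ih p)) p
      rw [us (n + 1)]
      nth_rewrite 2 [us n]
      refine h1.trans ?_
      have : 0 ≤ R * (1 / 2) ^ n := by positivity
      rw [pow_succ]
      nlinarith
  have ud' : ∀ p n, dist (u n p) (u (n + 1) p) ≤ R * (1 / 2) ^ n := by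
    intro p n
    rw [dist_comm, dist_eq_norm]; exact ud n p
  have hlim : ∀ p, ∃ v, Tendsto (fun n => u n p) atTop (𝓝 v) := fun p =>
    cauchySeq_tendsto_of_complete (cauchySeq_of_le_geometric (1 / 2) R (by norm_num) (ud' p))
  choose x hx using hlim
  have hxb : ∀ p, ‖x p‖ ≤ R := fun p => le_of_tendsto' (hx p).norm fun n => ub n p
  refine ⟨x, Slim u x uS ?_, hxb, fun p => ?_⟩
  · rw [Metric.tendstoUniformly_iff]
    intro δ hδ
    have h1 : Tendsto (fun n : ℕ => R * (1 / 2 : ℝ) ^ n / (1 - 1 / 2)) atTop (𝓝 0) := by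
      have := ((tendsto_pow_atTop_nhds_zero_of_lt_one (r := (1 / 2 : ℝ)) (by norm_num)
        (by norm_num)).const_mul R).div_const (1 - 1 / 2)
      simpa using this
    filter_upwards [h1.eventually_lt_const hδ] with n hn p
    rw [dist_comm]
    exact (dist_le_of_le_geometric_of_tendsto (1 / 2) R (by norm_num) (ud' p) (hx p) n).trans_lt hn
  · have h1 : Tendsto (fun n => u (n + 1) (τ p)) atTop (𝓝 (x (τ p))) :=
      (hx (τ p)).comp (tendsto_add_atTop_nat 1)
    have h2 : Tendsto (fun n => ψ p (u n p)) atTop (𝓝 (ψ p (x p))) := by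
      rw [tendsto_iff_norm_sub_tendsto_zero]
      refine squeeze_zero (fun n => norm_nonneg _) (fun n => hψ p _ _ (ub n p) (hxb p)) ?_
      simpa using ((tendsto_iff_norm_sub_tendsto_zero.1 (hx p)).const_mul η)
    have h3 : Tendsto (fun n => M (π p) (u (n + 1) p) + ψ p (u n p)) atTop
        (𝓝 (M (π p) (x p) + ψ p (x p))) :=
      (((M (π p)).continuous.tendsto _).comp ((hx p).comp (tendsto_add_atTop_nat 1))).add h2
    refine tendsto_nhds_unique h1 (h3.congr fun n => ?_)
    rw [us]
    exact (h.greenMap_step hπ (hψb _ (ub n)) p).symm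

end Green

end Dichotomy

end Dichotomy

/-! ### Green kernels of a hyperbolic splitting over the torus. -/

section Splitting

open Filter Topology

variable {d m : ℕ} {M : Torus m → Phase d →L[ℝ] Phase d} {α : Torus m}
  {PS PU : Torus m → Phase d →L[ℝ] Phase d} {C lamS lamU : ℝ}

namespace HyperbolicSplitting

theorem PS_of_PU (h : HyperbolicSplitting M α PS PU C lamS lamU) {θ : Torus m} {v : Phase d}
    (hv : PU θ v = v) : PS θ v = 0 := by
  have := h.add_eq θ v
  rwa [hv, add_eq_right] at this

theorem PU_of_PS (h : HyperbolicSplitting M α PS PU C lamS lamU) {θ : Torus m} {v : Phase d}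
    (hv : PS θ v = v) : PU θ v = 0 := by
  have := h.add_eq θ v
  rwa [hv, add_eq_left] at this

theorem M_PS (h : HyperbolicSplitting M α PS PU C lamS lamU) (θ : Torus m) (v : Phase d) :
    PS (θ + α) (M θ v) = M θ (PS θ v) := by
  have h1 : PS (θ + α) (M θ (PS θ v)) = M θ (PS θ v) := h.invariant_S θ (h.PS_PS θ v)
  have h2 : PU (θ + α) (M θ (PU θ v)) = M θ (PU θ v) := (h.invariant_U θ).mapsTo (h.PU_PU θ v)
  nth_rewrite 1 [← h.add_eq θ v]
  rw [map_add, map_add, h1, h.PS_of_PU h2, add_zero]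

theorem M_PU (h : HyperbolicSplitting M α PS PU C lamS lamU) (θ : Torus m) (v : Phase d) :
    PU (θ + α) (M θ v) = M θ (PU θ v) := by
  have h1 : PS (θ + α) (M θ (PS θ v)) = M θ (PS θ v) := h.invariant_S θ (h.PS_PS θ v)
  have h2 : PU (θ + α) (M θ (PU θ v)) = M θ (PU θ v) := (h.invariant_U θ).mapsTo (h.PU_PU θ v)
  nth_rewrite 1 [← h.add_eq θ v]
  rw [map_add, map_add, h2, h.PU_of_PS h1, zero_add]

/-- `M θ` maps the unstable space onto the next one, and the projection lifts linearly through this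
surjection because vector spaces are projective. `J θ` is the inverse of `M θ` along the unstable
bundle, precomposed with the unstable projection. -/
theorem exists_inverse (h : HyperbolicSplitting M α PS PU C lamS lamU) (θ : Torus m) :
    ∃ J : Phase d →L[ℝ] Phase d, (∀ v, PU θ (J v) = J v) ∧ ∀ v, M θ (J v) = PU (θ + α) v := by
  let EU : Torus m → Submodule ℝ (Phase d) := fun θ =>
    LinearMap.eqLocus (PU θ : Phase d →ₗ[ℝ] Phase d) LinearMap.id
  have mem : ∀ θ v, v ∈ EU θ ↔ PU θ v = v := fun θ v => Iff.rfl
  let A : EU θ →ₗ[ℝ] EU (θ + α) := (M θ : Phase d →ₗ[ℝ] Phase d).restrict fun v hv =>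
    (h.invariant_U θ).mapsTo hv
  let p : Phase d →ₗ[ℝ] EU (θ + α) := (PU (θ + α) : Phase d →ₗ[ℝ] Phase d).codRestrict _
    fun v => h.PU_PU _ v
  have hA : Function.Surjective A := by
    rintro ⟨w, hw⟩
    obtain ⟨v, hv, e⟩ := (h.invariant_U θ).surjOn hw
    exact ⟨⟨v, hv⟩, Subtype.ext e⟩
  obtain ⟨J, hJ⟩ := Module.projective_lifting_property A p hA
  refine ⟨((EU θ).subtype ∘ₗ J).toContinuousLinearMap, fun v => (J v).2, fun v => ?_⟩
  exact congrArg Subtype.val (LinearMap.congr_fun hJ v)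

/-- A continuous hyperbolic splitting over the torus has continuous Green kernels. -/
theorem exists_dichotomy (h : HyperbolicSplitting M α PS PU C lamS lamU) (hM : Continuous M) :
    ∃ (GS GU : ℕ → Torus m → Phase d →L[ℝ] Phase d) (C' lam : ℝ),
      Dichotomy M α GS GU C' lam ∧ (∀ k, Continuous (GS k)) ∧ ∀ k, Continuous (GU k) := by
  choose J hJ1 hJ2 using h.exists_inverse
  have hC := h.C_pos
  have hU0 : 0 < lamU := zero_lt_one.trans h.lamU_gt
  have hinj : ∀ θ u, PU θ u = u → ‖u‖ ≤ C * lamU⁻¹ * ‖M θ u‖ := by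
    intro θ u hu
    have := h.unstable θ u hu 1
    simpa [cocycle] using this
  have hJM : ∀ θ v, J θ (M θ v) = PU θ v := by
    intro θ v
    refine (h.invariant_U θ).injOn (hJ1 θ _) (h.PU_PU θ v) ?_
    rw [hJ2, h.M_PU]
  have hJPU : ∀ θ v, J θ (PU (θ + α) v) = J θ v := by
    intro θ v
    refine (h.invariant_U θ).injOn (hJ1 θ _) (hJ1 θ _) ?_
    rw [hJ2, hJ2, h.PU_PU]
  -- No trivialization of the bundle is needed. The vector `PU θ (J θ₀ v) - J θ v` is unstable at
  -- `θ`, so expansion bounds it by its image under `M θ`; that image is controlled by continuous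
  -- data vanishing at `θ₀`.
  have hJc : Continuous J := by
    rw [continuous_iff_continuousAt]
    intro θ₀
    have c1 : Tendsto (fun θ => C * lamU⁻¹ * ‖(M θ).comp ((PU θ).comp (J θ₀)) - PU (θ + α)‖) (𝓝 θ₀)
        (𝓝 0) := by
      have : Continuous fun θ => C * lamU⁻¹ * ‖(M θ).comp ((PU θ).comp (J θ₀)) - PU (θ + α)‖ := by
        refine continuous_const.mul (Continuous.norm (Continuous.sub ?_ ?_))
        · exact hM.clm_comp (h.continuous_PU.clm_comp continuous_const)
        · exact h.continuous_PU.comp (continuous_add_const α)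
      have e := this.tendsto θ₀
      have e2 : (M θ₀).comp ((PU θ₀).comp (J θ₀)) - PU (θ₀ + α) = 0 := by
        ext1 v
        simp [hJ1, hJ2]
      rwa [e2, norm_zero, mul_zero] at e
    have c2 : Tendsto (fun θ => (PU θ).comp (J θ₀) - J θ) (𝓝 θ₀) (𝓝 0) := by
      refine squeeze_zero_norm (fun θ => ?_) c1
      refine ContinuousLinearMap.opNorm_le_bound _ (by positivity) fun v => ?_
      refine (hinj θ _ ?_).trans ?_
      · simp [hJ1, h.PU_PU]
      · have : M θ (((PU θ).comp (J θ₀) - J θ) v) =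
            ((M θ).comp ((PU θ).comp (J θ₀)) - PU (θ + α)) v := by simp [hJ2]
        rw [this, mul_assoc (C * lamU⁻¹)]
        gcongr
        exact ContinuousLinearMap.le_opNorm _ _
    have c3 : Tendsto (fun θ => (PU θ).comp (J θ₀)) (𝓝 θ₀) (𝓝 ((PU θ₀).comp (J θ₀))) :=
      (h.continuous_PU.clm_comp continuous_const).tendsto θ₀
    have c4 := c3.sub c2
    have e3 : (PU θ₀).comp (J θ₀) = J θ₀ := by ext1 v; exact hJ1 _ _
    simpa [ContinuousAt, e3] using c4
  let GS : ℕ → Torus m → Phase d →L[ℝ] Phase d := fun k =>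
    Nat.rec PS (fun _ G θ => (M (θ - α)).comp (G (θ - α))) k
  let GU : ℕ → Torus m → Phase d →L[ℝ] Phase d := fun k =>
    Nat.rec PU (fun _ G θ => (J θ).comp (G (θ + α))) k
  have GS0 : GS 0 = PS := rfl
  have GU0 : GU 0 = PU := rfl
  have GS1 : ∀ k θ, GS (k + 1) θ = (M (θ - α)).comp (GS k (θ - α)) := fun _ _ => rfl
  have GU1 : ∀ k θ, GU (k + 1) θ = (J θ).comp (GU k (θ + α)) := fun _ _ => rfl
  have GUP : ∀ k θ v, PU θ (GU k θ v) = GU k θ v := by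
    intro k θ v
    cases k with
    | zero => exact h.PU_PU θ v
    | succ k => exact hJ1 _ _
  obtain ⟨B₁, hB₁⟩ := isCompact_univ.exists_bound_of_continuousOn h.continuous_PS.continuousOn
  obtain ⟨B₂, hB₂⟩ := isCompact_univ.exists_bound_of_continuousOn h.continuous_PU.continuousOn
  set B := max B₁ B₂ with hB
  have hBS : ∀ θ, ‖PS θ‖ ≤ B := fun θ => (hB₁ θ (mem_univ _)).trans (le_max_left _ _)
  have hBU : ∀ θ, ‖PU θ‖ ≤ B := fun θ => (hB₂ θ (mem_univ _)).trans (le_max_right _ _)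
  have hB0 : 0 ≤ B := (norm_nonneg _).trans (hBS 0)
  -- The kernels are defined by recursion, which yields their algebraic relations; their relations
  -- to the cocycle serve to import the exponential estimates.
  have GScoc : ∀ k θ v, GS k (θ + k • α) v = cocycle M α k θ (PS θ v) := by
    intro k θ
    induction k with
    | zero => intro v; simp [GS0, cocycle]
    | succ k ih =>
      intro v
      have e : θ + (k + 1) • α - α = θ + k • α := by rw [add_smul, one_smul]; abel
      rw [GS1, e, cocycle]
      simp only [ContinuousLinearMap.comp_apply]
      rw [ih]
  have GUcoc : ∀ k θ v, cocycle M α k θ (GU k θ v) = PU (θ + k • α) v := by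
    intro k
    have hshift : ∀ (k : ℕ) θ v, cocycle M α (k + 1) θ v = cocycle M α k (θ + α) (M θ v) := by
      intro k θ v
      induction k with
      | zero => simp [cocycle]
      | succ k ih =>
        rw [cocycle]
        simp only [ContinuousLinearMap.comp_apply]
        rw [ih]
        conv_rhs => rw [cocycle]
        simp only [ContinuousLinearMap.comp_apply]
        congr 2
        rw [add_smul, one_smul]; abel
    induction k with
    | zero => intro θ v; simp [GU0, cocycle]
    | succ k ih =>
      intro θ v
      rw [hshift, GU1]
      simp only [ContinuousLinearMap.comp_apply]
      rw [hJ2, GUP, ih, add_smul, one_smul]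
      congr 2; abel
  set lam := max lamS lamU⁻¹ with hlam
  have hl0 : 0 < lam := h.lamS_pos.trans_le (le_max_left _ _)
  refine ⟨GS, GU, C * B, lam, ?_, ?_, ?_⟩
  · refine ⟨by positivity, hl0, max_lt h.lamS_lt (inv_lt_one_of_one_lt₀ h.lamU_gt), h.add_eq, ?_, ?_,
      ?_, ?_, ?_, ?_⟩
    · intro k θ v
      rw [GS1, add_sub_cancel_right]; rfl
    · intro k θ v
      rw [GU1]
      exact (hJ2 _ _).trans (GUP _ _ _)
    · intro k
      induction k with
      | zero =>
        intro θ v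
        have := h.M_PS (θ - α) v
        rw [sub_add_cancel] at this
        rw [GS1, GS0]
        simpa [sub_eq_add_neg] using this
      | succ k ih =>
        intro θ v
        rw [GS1, GS1 (k + 1)]
        simp only [ContinuousLinearMap.comp_apply]
        rw [← ih]
        congr 4
        push_cast
        rw [show (-((k : ℤ) + 1) - 1) = (-(k : ℤ) - 1) - 1 by ring, sub_smul (-(k : ℤ) - 1) 1,
          one_smul]
        abel
    · intro k
      induction k with
      | zero =>
        intro θ v
        rw [GU1, GU0]
        simp only [ContinuousLinearMap.comp_apply]
        rw [hJPU]
        simpa using hJM θ v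
      | succ k ih =>
        intro θ v
        have hk : θ + ((k + 1 : ℕ) : ℤ) • α = θ + α + (k : ℤ) • α := by
          push_cast
          rw [add_smul, one_smul]; abel
        rw [GU1 (k + 1), hk]
        exact congrArg (J θ) (ih _ _)
    · intro k θ
      refine ContinuousLinearMap.opNorm_le_bound _ (by positivity) fun v => ?_
      have e := GScoc k (θ - k • α) v
      rw [sub_add_cancel] at e
      rw [e]
      refine (h.stable _ _ (h.PS_PS _ _) k).trans ?_
      have h1 := (PS (θ - k • α)).le_of_opNorm_le (hBS _) v
      have h2 : lamS ^ k ≤ lam ^ k := pow_le_pow_left₀ h.lamS_pos.le (le_max_left _ _) k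
      calc _ ≤ C * lam ^ k * (B * ‖v‖) := by gcongr
        _ = _ := by ring
    · intro k θ
      refine ContinuousLinearMap.opNorm_le_bound _ (by positivity) fun v => ?_
      refine (h.unstable _ _ (GUP k θ v) k).trans ?_
      rw [GUcoc]
      have h1 := (PU (θ + k • α)).le_of_opNorm_le (hBU _) v
      have h2 : (lamU ^ k)⁻¹ ≤ lam ^ k := by
        rw [← inv_pow]
        exact pow_le_pow_left₀ (by positivity) (le_max_right _ _) k
      calc _ ≤ C * lam ^ k * (B * ‖v‖) := by gcongr
        _ = _ := by ring
  · intro k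
    induction k with
    | zero => exact h.continuous_PS
    | succ k ih =>
      have : GS (k + 1) = fun θ => (M (θ - α)).comp (GS k (θ - α)) := rfl
      rw [this]
      exact (hM.comp (continuous_sub_right α)).clm_comp (ih.comp (continuous_sub_right α))
  · intro k
    induction k with
    | zero => exact h.continuous_PU
    | succ k ih =>
      have : GU (k + 1) = fun θ => (J θ).comp (GU k (θ + α)) := rfl
      rw [this]
      exact hJc.clm_comp (ih.comp (continuous_add_const α))

end HyperbolicSplitting

end Splitting

/-! ### The torus and its universal cover. -/

section Covering

variable {m : ℕ}

theorem proj_add (s t : Cover m) : proj (s + t) = proj s + proj t := by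
  ext i; simp [proj]

theorem isOpenQuotientMap_proj : IsOpenQuotientMap (proj (m := m)) := by
  have h1 : IsOpenQuotientMap (Pi.map fun (_ : Fin m) (x : ℝ) => (x : UnitAddCircle)) :=
    IsOpenQuotientMap.piMap fun _ => QuotientAddGroup.isOpenQuotientMap_mk
  exact h1.comp (EuclideanSpace.equiv (Fin m) ℝ).toHomeomorph.isOpenQuotientMap

theorem continuous_proj : Continuous (proj (m := m)) := isOpenQuotientMap_proj.continuous

theorem proj_surjective : Function.Surjective (proj (m := m)) := isOpenQuotientMap_proj.surjective

/-- The torus is the image of a compact subset of its cover. -/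
theorem exists_isCompact_proj : ∃ Q : Set (Cover m), IsCompact Q ∧ ∀ θ, ∃ t ∈ Q, proj t = θ := by
  let e := (EuclideanSpace.equiv (Fin m) ℝ).toHomeomorph
  refine ⟨e.symm '' (Set.pi univ fun _ => Icc 0 1),
    (isCompact_univ_pi fun _ => isCompact_Icc).image e.symm.continuous, fun θ => ?_⟩
  have : ∀ i, ∃ x ∈ Icc (0 : ℝ) 1, (x : UnitAddCircle) = θ i := by
    intro i
    have h := AddCircle.coe_image_Icc_eq (1 : ℝ) 0
    have h2 : θ i ∈ (QuotientAddGroup.mk : ℝ → UnitAddCircle) '' Icc 0 (0 + 1) := by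
      rw [h]; exact mem_univ _
    simpa using h2
  choose x hx e2 using this
  exact ⟨e.symm x, mem_image_of_mem _ fun i _ => hx i, funext e2⟩

end Covering

/-! ### Continuity and differentiability of bounded solutions over a skew shift. -/

section Orbits

open Filter Topology

variable {A ι : Type*} [AddCommGroup A]

/-- The skew shift `(t, i) ↦ (t + a, σ i)`. -/
def skew (a : A) (σ : Equiv.Perm ι) : Equiv.Perm (A × ι) :=
  Equiv.prodCongr (Equiv.addRight a) σ

theorem skew_apply (a : A) (σ : Equiv.Perm ι) (p : A × ι) : skew a σ p = (p.1 + a, σ p.2) := rfl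

theorem skew_zpow (a : A) (σ : Equiv.Perm ι) (n : ℤ) (p : A × ι) :
    (skew a σ ^ n) p = (p.1 + n • a, (σ ^ n) p.2) := by
  have h1 : ((skew a σ ^ n) p).1 = p.1 + n • a :=
    Dichotomy.orbit_eq (π := Prod.fst) (τ := skew a σ) (α := a) (fun _ => rfl) p n
  have h2 : ∀ n : ℕ, ∀ p, ((skew a σ ^ n) p).2 = (σ ^ n) p.2 := by
    intro n
    induction n with
    | zero => intro p; rfl
    | succ n ih => intro p; rw [pow_succ', pow_succ', Equiv.Perm.mul_apply, skew_apply,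
        Equiv.Perm.mul_apply, ih]
  refine Prod.ext h1 ?_
  cases n with
  | ofNat n => exact h2 n p
  | negSucc n =>
    rw [zpow_negSucc, zpow_negSucc, Equiv.Perm.eq_inv_iff_eq, ← h2, ← Equiv.Perm.mul_apply,
      mul_inv_cancel, Equiv.Perm.one_apply]

variable {d m : ℕ} {M : Torus m → Phase d →L[ℝ] Phase d} {α : Cover m}
  {GS GU : ℕ → Torus m → Phase d →L[ℝ] Phase d} {C lam η : ℝ} {σ : Equiv.Perm ι}

/-- Families `ι → ℝ^m → W` that are `C^r` with bounds uniform in the index. -/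
def Reg {W : Type} [NormedAddCommGroup W] [NormedSpace ℝ W] (r : ℕ) (g : ι → Cover m → W) : Prop :=
  UReg univ (univ : Set Unit) r fun i t _ => g i t

section Reg

variable {W V : Type} [NormedAddCommGroup W] [NormedSpace ℝ W] [NormedAddCommGroup V]
  [NormedSpace ℝ V] {r : ℕ}

theorem reg_zero_iff {g : ι → Cover m → W} :
    Reg 0 g ↔ (∀ i, Continuous (g i)) ∧ ∃ B, ∀ i t, ‖g i t‖ ≤ B := by
  constructor
  · rintro ⟨a, B, b⟩
    refine ⟨fun i => ?_, B, fun i t => b i t (mem_univ _) () (mem_univ _)⟩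
    rw [← continuousOn_univ]
    exact (a i).comp (f := fun t => (t, ())) (by fun_prop) fun t _ => ⟨mem_univ _, mem_univ _⟩
  · rintro ⟨a, B, b⟩
    exact ⟨fun i => ((a i).comp continuous_fst).continuousOn, B, fun i t _ _ _ => b i t⟩

theorem reg_succ_iff {g : ι → Cover m → W} : Reg (r + 1) g ↔ Reg 0 g ∧
    ∃ g' : ι → Cover m → Cover m →L[ℝ] W, (∀ i t, HasFDerivAt (g i) (g' i t) t) ∧ Reg r g' := by
  constructor
  · rintro ⟨a, g', b, c⟩
    exact ⟨a, fun i t => g' i t (), fun i t => b i t (mem_univ _) () (mem_univ _), c⟩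
  · rintro ⟨a, g', b, c⟩
    exact ⟨a, fun i t _ => g' i t, fun i t _ _ _ => b i t, c⟩

theorem Reg.sum {κ : Type*} (s : Finset κ) {g : κ → ι → Cover m → W} (h : ∀ j ∈ s, Reg r (g j)) :
    Reg r fun i t => ∑ j ∈ s, g j i t := by
  classical
  induction s using Finset.induction_on with
  | empty =>
    simp only [Finset.sum_empty]
    exact UReg.const (c := fun _ _ => (0 : W)) (fun _ => continuousOn_const) (C := 0) (by simp)
  | insert j s hj ih =>
    simp only [Finset.sum_insert hj]
    exact UReg.add (h j (by simp)) (ih fun k hk => h k (by simp [hk]))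

/-- The linear map on `ℝ^m` with prescribed values on the standard basis. -/
noncomputable def ofBasis (y : Fin m → W) : Cover m →L[ℝ] W :=
  ∑ j, (EuclideanSpace.proj j : Cover m →L[ℝ] ℝ).smulRight (y j)

theorem ofBasis_apply (y : Fin m → W) (v : Cover m) : ofBasis y v = ∑ j, v j • y j := by
  simp [ofBasis]

theorem sum_single (v : Cover m) : v = ∑ j, v j • EuclideanSpace.single j (1 : ℝ) := by
  ext k
  simp [Finset.sum_apply, Pi.single_apply]

theorem ofBasis_eq (L : Cover m →L[ℝ] W) :
    ofBasis (fun j => L (EuclideanSpace.single j 1)) = L := by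
  ext1 v
  conv_rhs => rw [sum_single v, map_sum]
  simp [ofBasis_apply]

/-- The linear regularity result concerns solutions with values in the phase space. This reduces a
derivative, which is operator-valued, to its values on finitely many vectors. -/
theorem Reg.of_directional {g : ι → Cover m → Cover m →L[ℝ] W}
    (h : ∀ v, Reg r fun i t => g i t v) : Reg r g := by
  have : g = fun i t => ∑ j, (ContinuousLinearMap.smulRightL ℝ (Cover m) W
      (EuclideanSpace.proj j : Cover m →L[ℝ] ℝ)) (g i t (EuclideanSpace.single j 1)) := by
    ext1 i; ext1 t
    exact (ofBasis_eq (g i t)).symm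
  rw [this]
  exact Reg.sum _ fun j _ => UReg.clm _ (h _)

theorem Reg.exists_lipschitz {g : ι → Cover m → W} (h : Reg (r + 1) g) :
    ∃ B, 0 ≤ B ∧ ∀ i t s, ‖g i (t + s) - g i t‖ ≤ B * ‖s‖ := by
  obtain ⟨-, g', hd, hr⟩ := reg_succ_iff.1 h
  obtain ⟨-, B, hB⟩ := reg_zero_iff.1 hr.uCont
  refine ⟨max B 0, le_max_right _ _, fun i t s => ?_⟩
  have := convex_univ.norm_image_sub_le_of_norm_hasFDerivWithin_le (f := g i) (f' := g' i)
    (C := max B 0) (fun t _ => (hd i t).hasFDerivWithinAt)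
    (fun t _ => (hB i t).trans (le_max_left _ _)) (mem_univ t) (mem_univ (t + s))
  simpa using this

end Reg

/-- Bounded solutions of linear equations close to the dichotomic one. -/
theorem Dichotomy.exists_linear_solution {X : Type*} {π : X → Torus m} {τ : Equiv.Perm X}
    (h : Dichotomy M (proj α) GS GU C lam) (hπ : ∀ p, π (τ p) = π p + proj α) (hη : 0 ≤ η)
    (hG : greenBound C lam * η ≤ 1 / 2) {A : X → Phase d →L[ℝ] Phase d}
    (hA : ∀ p, ‖A p - M (π p)‖ ≤ η) {β : X → Phase d} {c : ℝ} (hβ : ∀ p, ‖β p‖ ≤ c) :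
    ∃ y : X → Phase d, (∃ B, ∀ p, ‖y p‖ ≤ B) ∧ ∀ p, y (τ p) = A p (y p) + β p := by
  obtain ⟨y, -, hb, hy⟩ := h.exists_solution hπ hη hG
    (ψ := fun p v => (A p - M (π p)) v + β p) (c := max c 0) (le_max_right _ _)
    (fun p => by simpa using Or.inl (hβ p))
    (fun p v v' _ _ => by
      rw [add_sub_add_right_eq_sub, ← map_sub]
      exact (A p - M (π p)).le_of_opNorm_le (hA p) _)
    (fun _ => True) trivial (fun _ _ _ => trivial) (fun _ _ _ _ => trivial)
  refine ⟨y, ⟨_, hb⟩, fun p => ?_⟩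
  rw [hy]
  simp only [sub_apply]
  abel

theorem proj_skew (p : Cover m × ι) : proj (skew α σ p).1 = proj p.1 + proj α := proj_add _ _

theorem proj_add_zsmul (t : Cover m) (n : ℤ) : proj (t + n • α) = proj t + n • proj α := by
  have := Dichotomy.orbit_eq (π := fun t : Cover m => proj t) (τ := Equiv.addRight α)
    (α := proj α) (fun t => proj_add t α) t n
  have e : (Equiv.addRight α ^ n) t = t + n • α := by simp
  rwa [e] at this

/-- A bounded solution of a linear equation with continuous coefficients is continuous. -/
theorem Dichotomy.continuous_of_linear (h : Dichotomy M (proj α) GS GU C lam) (hη : 0 ≤ η)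
    (hG : greenBound C lam * η ≤ 1 / 2) {A : ι → Cover m → Phase d →L[ℝ] Phase d}
    {β y : ι → Cover m → Phase d} (hA : Reg 0 A) (hβ : Reg 0 β)
    (hAM : ∀ i t, ‖A i t - M (proj t)‖ ≤ η) {b : ℝ} (hy : ∀ i t, ‖y i t‖ ≤ b)
    (he : ∀ i t, y (σ i) (t + α) = A i t (y i t) + β i t) (i : ι) : Continuous (y i) := by
  obtain ⟨cA, a, ha⟩ := reg_zero_iff.1 hA
  obtain ⟨cβ, B, hB⟩ := reg_zero_iff.1 hβ
  rw [continuous_iff_continuousAt]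
  intro t
  have hb0 : 0 ≤ b := (norm_nonneg _).trans (hy i t)
  -- The increment between the orbits of `s` and `t` solves the linear equation up to the increments
  -- of the coefficients. These tend to zero at every fixed time as `s → t`, which suffices.
  have key := h.tendsto_zero hη hG (F := 𝓝 t) (θ := fun _ => proj t)
    (x := fun s n => y ((σ ^ n) i) (s + n • α) - y ((σ ^ n) i) (t + n • α))
    (ρ := fun s n => ‖A ((σ ^ n) i) (s + n • α) - A ((σ ^ n) i) (t + n • α)‖ * b +
      ‖β ((σ ^ n) i) (s + n • α) - β ((σ ^ n) i) (t + n • α)‖) (b := b + b)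
    (B := (a + a) * b + (B + B))
    (Eventually.of_forall fun s n => (norm_sub_le _ _).trans (add_le_add (hy _ _) (hy _ _)))
    (Eventually.of_forall fun s n => ?_) (Eventually.of_forall fun s n => ?_) fun n => ?_
  · have := key.add_const (y i t)
    simpa [ContinuousAt] using this
  · have e1 : (σ ^ (n + 1)) i = σ ((σ ^ n) i) := orbit_succ i n
    have e2 : ∀ s : Cover m, s + (n + 1) • α = s + n • α + α := by
      intro s; rw [add_smul, one_smul]; abel
    rw [e1, e2, e2, he, he, ← proj_add_zsmul]
    set j := (σ ^ n) i
    set u := s + n • α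
    set v := t + n • α
    have e3 : A j u (y j u) + β j u - (A j v (y j v) + β j v) - M (proj v) (y j u - y j v) =
        (A j v - M (proj v)) (y j u - y j v) + ((A j u - A j v) (y j u) + (β j u - β j v)) := by
      simp only [sub_apply, map_sub]; abel
    rw [e3]
    refine (norm_add_le _ _).trans (add_le_add ((A j v - M (proj v)).le_of_opNorm_le (hAM j v) _)
      ((norm_add_le _ _).trans (add_le_add ?_ le_rfl)))
    exact ((A j u - A j v).le_opNorm _).trans (by gcongr; exact hy _ _)
  · have h1 := norm_sub_le (A ((σ ^ n) i) (s + n • α)) (A ((σ ^ n) i) (t + n • α))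
    have h2 := norm_sub_le (β ((σ ^ n) i) (s + n • α)) (β ((σ ^ n) i) (t + n • α))
    have h3 := ha ((σ ^ n) i) (s + n • α)
    have h4 := ha ((σ ^ n) i) (t + n • α)
    have h5 := hB ((σ ^ n) i) (s + n • α)
    have h6 := hB ((σ ^ n) i) (t + n • α)
    gcongr <;> linarith
  · have c1 : Continuous fun s => ‖A ((σ ^ n) i) (s + n • α) - A ((σ ^ n) i) (t + n • α)‖ * b +
        ‖β ((σ ^ n) i) (s + n • α) - β ((σ ^ n) i) (t + n • α)‖ :=
      ((((cA _).comp (continuous_add_const _)).sub continuous_const).norm.mul continuous_const).add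
        (((cβ _).comp (continuous_add_const _)).sub continuous_const).norm
    simpa using c1.tendsto t

/-- Differentiability of bounded solutions of equations with hyperbolic linearization. -/
theorem Dichotomy.exists_hasFDerivAt (h : Dichotomy M (proj α) GS GU C lam) (hη : 0 ≤ η)
    (hG : greenBound C lam * η ≤ 1 / 2) {A : ι → Cover m → Phase d →L[ℝ] Phase d}
    {β : ι → Cover m → Cover m →L[ℝ] Phase d} {x : ι → Cover m → Phase d}
    {f : ι → Phase d → Cover m → Phase d} {a b B h₀ : ℝ} (hB : 0 ≤ B) (hh₀ : 0 < h₀)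
    (hA : ∀ i t, ‖A i t‖ ≤ a) (hAM : ∀ i t, ‖A i t - M (proj t)‖ ≤ η)
    (hβ : ∀ i t, ‖β i t‖ ≤ B) (hxb : ∀ i t, ‖x i t‖ ≤ b)
    (he : ∀ i t, x (σ i) (t + α) = f i (x i t) t)
    (hz : ∀ i t s, ‖s‖ < h₀ → ‖f i (x i (t + s)) t - f i (x i t) t -
      M (proj t) (x i (t + s) - x i t)‖ ≤ η * ‖x i (t + s) - x i t‖)
    (ht : ∀ i t s, ‖s‖ < h₀ → ‖f i (x i (t + s)) (t + s) - f i (x i (t + s)) t‖ ≤ B * ‖s‖)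
    (hd : ∀ i t, HasFDerivAt (fun p : Phase d × Cover m => f i p.1 p.2)
      ((A i t).coprod (β i t)) (x i t, t)) :
    ∃ x' : ι → Cover m → Cover m →L[ℝ] Phase d, (∀ i t, HasFDerivAt (x i) (x' i t) t) ∧
      (∃ B', ∀ i t, ‖x' i t‖ ≤ B') ∧
      ∀ i t v, x' (σ i) (t + α) v = A i t (x' i t v) + β i t v := by
  set L := 2 * greenBound C lam * B with hL
  have hL0 : 0 ≤ L := by have := h.greenBound_nonneg; positivity
  -- For fixed `s` the increment is a bounded function on the whole base whose defect is at most `B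
  -- * ‖s‖` plus an absorbable part: Lipschitz continuity precedes differentiability.
  have hlip : ∀ i t s, ‖s‖ < h₀ → ‖x i (t + s) - x i t‖ ≤ L * ‖s‖ := by
    intro i t s hs
    have := h.norm_apply_le (π := fun p : Cover m × ι => proj p.1) (τ := skew α σ) proj_skew hη hG
      (x := fun p => x p.2 (p.1 + s) - x p.2 p.1) (b := b + b) (c := B * ‖s‖) (by positivity)
      (fun p => (norm_sub_le _ _).trans (add_le_add (hxb _ _) (hxb _ _))) (fun p => ?_) (t, i)
    · exact this.trans (le_of_eq (by rw [hL]; ring))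
    · obtain ⟨t, i⟩ := p
      simp only [skew_apply]
      rw [he, add_right_comm, he]
      have e : f i (x i (t + s)) (t + s) - f i (x i t) t - M (proj t) (x i (t + s) - x i t) =
        (f i (x i (t + s)) t - f i (x i t) t - M (proj t) (x i (t + s) - x i t)) +
          (f i (x i (t + s)) (t + s) - f i (x i (t + s)) t) := by abel
      rw [e]
      exact (norm_add_le _ _).trans (add_le_add (hz i t s hs) (ht i t s hs))
  -- Formal differentiation of the invariance equation in direction `v`. The variable `t` is a mere
  -- label here, so no continuity of the coefficients is required.
  have hy : ∀ v : Cover m, ∃ y : Cover m × ι → Phase d, (∃ B, ∀ p, ‖y p‖ ≤ B) ∧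
      ∀ p, y (skew α σ p) = A p.2 p.1 (y p) + β p.2 p.1 v := fun v =>
    h.exists_linear_solution (π := fun p : Cover m × ι => proj p.1) proj_skew hη hG
      (A := fun p => A p.2 p.1) (fun p => hAM _ _) (β := fun p => β p.2 p.1 v) (c := B * ‖v‖)
      fun p => (β p.2 p.1).le_of_opNorm_le (hβ _ _) v
  choose y hyb hye using hy
  choose D hD using hyb
  -- Using only the solutions for basis vectors makes the candidate linear in `v` by construction.
  let x' : ι → Cover m → Cover m →L[ℝ] Phase d := fun i t =>
    ofBasis fun j => y (EuclideanSpace.single j 1) (t, i)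
  have hx'b : ∃ B', ∀ i t, ‖x' i t‖ ≤ B' := by
    refine ⟨∑ j, ‖(EuclideanSpace.proj j : Cover m →L[ℝ] ℝ)‖ * D (EuclideanSpace.single j 1),
      fun i t => norm_sum_le_of_le _ fun j _ => ?_⟩
    rw [ContinuousLinearMap.norm_smulRight_apply]
    gcongr
    exact hD _ _
  have hx'e : ∀ i t v, x' (σ i) (t + α) v = A i t (x' i t v) + β i t v := by
    intro i t v
    have h2 : β i t v = ∑ j, v j • β i t (EuclideanSpace.single j 1) := by
      conv_lhs => rw [sum_single v, map_sum]
      simp only [map_smul]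
    rw [h2]
    simp only [x', ofBasis_apply, map_sum, map_smul]
    rw [← Finset.sum_add_distrib]
    refine Finset.sum_congr rfl fun j _ => ?_
    have := hye (EuclideanSpace.single j 1) (t, i)
    rw [skew_apply] at this
    rw [this, smul_add]
  refine ⟨x', fun i t => ?_, hx'b, hx'e⟩
  obtain ⟨B', hB'⟩ := hx'b
  have hB'0 : 0 ≤ B' := (norm_nonneg _).trans (hB' i t)
  have ha0 : 0 ≤ a := (norm_nonneg _).trans (hA i t)
  set e : ι → Cover m → Cover m → Phase d := fun i t s => x i (t + s) - x i t - x' i t s with hedef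
  set rem : ι → Cover m → Cover m → Phase d := fun i t s =>
    e (σ i) (t + α) s - A i t (e i t s) with hrem
  have hrem' : ∀ i t s, rem i t s = f i (x i (t + s)) (t + s) - f i (x i t) t -
      (A i t).coprod (β i t) (x i (t + s) - x i t, s) := by
    intro i t s
    simp only [hrem, hedef, hx'e, he, add_right_comm t α s, map_sub,
      ContinuousLinearMap.coprod_apply]
    abel
  have heb : ∀ i t s, ‖s‖ < h₀ → ‖e i t s‖ ≤ (L + B') * ‖s‖ := by
    intro i t s hs
    rw [add_mul]
    exact (norm_sub_le _ _).trans (add_le_add (hlip i t s hs) ((x' i t).le_of_opNorm_le (hB' i t) s))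
  have hnear : ∀ᶠ s : Cover m in 𝓝 0, ‖s‖ < h₀ := by
    have := Metric.ball_mem_nhds (0 : Cover m) hh₀
    filter_upwards [this] with s hs
    simpa using hs
  -- The convention `0⁻¹ = 0` keeps this true at `s = 0`, so the full neighbourhood filter can be
  -- used.
  have hscale : ∀ (s : Cover m) (c : ℝ), 0 ≤ c → ‖s‖⁻¹ * (c * ‖s‖) ≤ c := by
    intro s c hc
    rcases eq_or_ne ‖s‖ 0 with h0 | h0
    · simp [h0, hc]
    · rw [mul_comm c, inv_mul_cancel_left₀ h0]
  have hremlim : ∀ i t, Tendsto (fun s => ‖s‖⁻¹ * ‖rem i t s‖) (𝓝 0) (𝓝 0) := by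
    intro i t
    have c1 : Tendsto (fun s => x i (t + s)) (𝓝 0) (𝓝 (x i t)) := by
      rw [tendsto_iff_norm_sub_tendsto_zero]
      have : Tendsto (fun s : Cover m => L * ‖s‖) (𝓝 0) (𝓝 0) := by
        have : Continuous fun s : Cover m => L * ‖s‖ := by fun_prop
        simpa using this.tendsto 0
      refine squeeze_zero' (Eventually.of_forall fun s => norm_nonneg _) ?_ this
      filter_upwards [hnear] with s hs using hlip i t s hs
    have c2 : Tendsto (fun s => (x i (t + s), t + s)) (𝓝 0) (𝓝 (x i t, t)) := by
      refine c1.prodMk_nhds ?_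
      have : Continuous fun s : Cover m => t + s := by fun_prop
      simpa using this.tendsto 0
    have c3 := ((hd i t).isLittleO.comp_tendsto c2)
    have c4 : (fun s => rem i t s) =o[𝓝 0] fun s => s := by
      have e1 : ((fun p : Phase d × Cover m => f i p.1 p.2 - f i (x i t) t -
          (A i t).coprod (β i t) (p - (x i t, t))) ∘ fun s => (x i (t + s), t + s)) =
          fun s => rem i t s := by
        ext1 s
        rw [hrem']
        simp
      rw [← e1]
      refine c3.trans_isBigO (Asymptotics.IsBigO.of_bound (max L 1) ?_)
      filter_upwards [hnear] with s hs
      simp only [Function.comp_apply, Prod.mk_sub_mk, add_sub_cancel_left, Prod.norm_mk]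
      refine max_le ?_ ?_
      · exact (hlip i t s hs).trans (by gcongr; exact le_max_left _ _)
      · exact le_mul_of_one_le_left (norm_nonneg _) (le_max_right _ _)
    have c5 := c4.norm_norm.tendsto_div_nhds_zero
    refine c5.congr fun s => ?_
    rw [div_eq_inv_mul]
  -- The rescaled error stays bounded by the Lipschitz estimate. Its defect at time `n` is the
  -- remainder of the differential of `f` there, divided by `‖s‖`; it vanishes in the limit for each
  -- `n`, though perhaps not uniformly.
  have key := h.tendsto_zero hη hG (F := 𝓝 0) (θ := fun _ => proj t)
    (x := fun s n => ‖s‖⁻¹ • e ((σ ^ n) i) (t + n • α) s)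
    (ρ := fun s n => ‖s‖⁻¹ * ‖rem ((σ ^ n) i) (t + n • α) s‖) (b := L + B')
    (B := (L + B') + a * (L + B')) ?_ ?_ ?_ fun n => hremlim _ _
  · rw [hasFDerivAt_iff_isLittleO_nhds_zero, ← Asymptotics.isLittleO_norm_norm,
      Asymptotics.isLittleO_iff_tendsto]
    · have := key.norm
      simp only [norm_zero, zpow_zero, Equiv.Perm.coe_one, id_eq, zero_smul, _root_.add_zero,
        norm_smul,
        norm_inv, norm_norm] at this
      refine this.congr fun s => ?_
      rw [div_eq_inv_mul]
    · intro s hs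
      rw [norm_eq_zero] at hs
      simp [hs]
  · filter_upwards [hnear] with s hs n
    rw [norm_smul, norm_inv, norm_norm]
    refine le_trans ?_ (hscale s (L + B') (by positivity))
    gcongr
    exact heb _ _ s hs
  · refine Eventually.of_forall fun s n => ?_
    have e1 : (σ ^ (n + 1)) i = σ ((σ ^ n) i) := orbit_succ i n
    have e2 : t + (n + 1) • α = t + n • α + α := by rw [add_smul, one_smul]; abel
    rw [e1, e2, ← proj_add_zsmul]
    set j := (σ ^ n) i
    set u := t + n • α
    rw [map_smul, ← smul_sub, norm_smul, norm_smul, norm_inv, norm_norm]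
    have e3 : e (σ j) (u + α) s - M (proj u) (e j u s) =
        (A j u - M (proj u)) (e j u s) + rem j u s := by
      simp only [hrem, sub_apply]; abel
    rw [e3]
    have := (A j u - M (proj u)).le_of_opNorm_le (hAM j u) (e j u s)
    calc _ ≤ ‖s‖⁻¹ * (η * ‖e j u s‖ + ‖rem j u s‖) := by
          gcongr
          exact (norm_add_le _ _).trans (add_le_add this le_rfl)
      _ = _ := by ring
  · filter_upwards [hnear] with s hs n
    refine le_trans ?_ (hscale s ((L + B') + a * (L + B')) (by positivity))
    gcongr
    refine (norm_sub_le _ _).trans ?_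
    have h1 := heb (σ ((σ ^ n) i)) (t + n • α + α) s hs
    have h2 := (A ((σ ^ n) i) (t + n • α)).le_of_opNorm_le (hA _ _) (e ((σ ^ n) i) (t + n • α) s)
    have h3 := heb ((σ ^ n) i) (t + n • α) s hs
    calc _ ≤ (L + B') * ‖s‖ + a * ((L + B') * ‖s‖) :=
          add_le_add h1 (h2.trans (by gcongr))
      _ = _ := by ring

/-- Bounded solutions of linear equations are as regular as the coefficients. -/
theorem Dichotomy.reg_of_linear (h : Dichotomy M (proj α) GS GU C lam) (hη : 0 ≤ η)
    (hG : greenBound C lam * η ≤ 1 / 2) {A : ι → Cover m → Phase d →L[ℝ] Phase d}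
    (hAM : ∀ i t, ‖A i t - M (proj t)‖ ≤ η) {r : ℕ} (hA : Reg r A)
    {β y : ι → Cover m → Phase d} (hβ : Reg r β) {b : ℝ} (hy : ∀ i t, ‖y i t‖ ≤ b)
    (he : ∀ i t, y (σ i) (t + α) = A i t (y i t) + β i t) : Reg r y := by
  induction r generalizing β y b with
  | zero =>
    exact reg_zero_iff.2 ⟨fun i => h.continuous_of_linear hη hG hA hβ hAM hy he i, b, hy⟩
  | succ r ih =>
    have hy0 : Reg r y := ih (UReg.of_succ hA) (UReg.of_succ hβ) hy he
    obtain ⟨Ba, hBa0, hBa⟩ := hA.exists_lipschitz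
    obtain ⟨Bb, hBb0, hBb⟩ := hβ.exists_lipschitz
    obtain ⟨hA0, A', hA', rA'⟩ := reg_succ_iff.1 hA
    obtain ⟨hβ0, β', hβ', rβ'⟩ := reg_succ_iff.1 hβ
    -- The derivative of the equation has the same linear part `A` and the new inhomogeneity `A' y +
    -- β'`. The latter is `C^r` because `y` is already known to be, so the induction hypothesis
    -- applies to the derivative.
    let γ : ι → Cover m → Cover m →L[ℝ] Phase d := fun i t => (A' i t).flip (y i t) + β' i t
    have rγ : Reg r γ := UReg.add (UReg.bilin (ContinuousLinearMap.apply ℝ (Cover m →L[ℝ] Phase d)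
      : Phase d →L[ℝ] _) hy0 (UReg.clm (ContinuousLinearMap.flipₗᵢ ℝ (Cover m) (Phase d)
        (Phase d)).toContinuousLinearEquiv.toContinuousLinearMap rA')) rβ'
    obtain ⟨-, a, ha⟩ := reg_zero_iff.1 hA0
    obtain ⟨-, B, hB⟩ := reg_zero_iff.1 (show Reg 0 γ from rγ.uCont)
    obtain ⟨y', hy', ⟨B', hB'⟩, he'⟩ := h.exists_hasFDerivAt (σ := σ) hη hG (A := A) (β := γ)
      (x := y) (f := fun i z t => A i t z + β i t) (a := a) (b := b)
      (B := max B (Ba * max b 0 + Bb)) (h₀ := 1) (by positivity) one_pos ha hAM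
      (fun i t => (hB i t).trans (le_max_left _ _)) hy he
      (fun i t s _ => by
        rw [add_sub_add_right_eq_sub, ← map_sub, ← sub_apply]
        exact (A i t - M (proj t)).le_of_opNorm_le (hAM i t) _)
      (fun i t s _ => by
        have e : A i (t + s) (y i (t + s)) + β i (t + s) - (A i t (y i (t + s)) + β i t) =
            (A i (t + s) - A i t) (y i (t + s)) + (β i (t + s) - β i t) := by
          simp only [sub_apply]; abel
        rw [e]
        calc _ ≤ Ba * ‖s‖ * max b 0 + Bb * ‖s‖ := by
              refine (norm_add_le _ _).trans (add_le_add ?_ (hBb i t s))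
              refine ((A i (t + s) - A i t).le_of_opNorm_le (hBa i t s) _).trans ?_
              gcongr
              exact (hy _ _).trans (le_max_left _ _)
          _ = (Ba * max b 0 + Bb) * ‖s‖ := by ring
          _ ≤ _ := by gcongr; exact le_max_right _ _)
      (fun i t => by
        have h1 : HasFDerivAt (fun p : Phase d × Cover m => A i p.2) _ (y i t, t) :=
          (hA' i t).comp (y i t, t) hasFDerivAt_snd
        have h2 : HasFDerivAt (fun p : Phase d × Cover m => β i p.2) _ (y i t, t) :=
          (hβ' i t).comp (y i t, t) hasFDerivAt_snd
        refine ((h1.clm_apply hasFDerivAt_fst).add h2).congr_fderiv ?_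
        ext v <;> simp [γ])
    refine reg_succ_iff.2 ⟨hy0.uCont, y', hy', Reg.of_directional fun v => ?_⟩
    refine ih (b := B' * ‖v‖) (UReg.of_succ hA) (β := fun i t => γ i t v)
      (UReg.clm (ContinuousLinearMap.apply ℝ (Phase d) v) rγ)
      (fun i t => (y' i t).le_of_opNorm_le (hB' i t) v) fun i t => he' i t v

/-- Bounded continuous solutions of nonlinear equations with hyperbolic linearization are as
regular as the equation. -/
theorem Dichotomy.reg_of_nonlinear (h : Dichotomy M (proj α) GS GU C lam) (hη : 0 ≤ η)
    (hG : greenBound C lam * η ≤ 1 / 2) {U : Set (Phase d)} (hU : IsOpen U) {r : ℕ}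
    {f : ι → Phase d → Cover m → Unit → Phase d} (hf : JReg U univ r f)
    {K : Cover m → Phase d} {R h₀ : ℝ} (hh₀ : 0 < h₀) (hR : 0 < R)
    (hKU : ∀ t, Metric.ball (K t) R ⊆ U)
    (hK : ∀ t s, ‖s‖ < h₀ → dist (K (t + s)) (K t) < R / 2)
    (hlin : ∀ i t, ∀ z ∈ Metric.ball (K t) R, ∀ z' ∈ Metric.ball (K t) R,
      ‖f i z t () - f i z' t () - M (proj t) (z - z')‖ ≤ η * ‖z - z'‖)
    {x : ι → Cover m → Phase d} (hx : Reg 0 x) (hxK : ∀ i t, dist (x i t) (K t) < R / 2)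
    (he : ∀ i t, x (σ i) (t + α) = f i (x i t) t ()) : Reg r x := by
  cases r with
  | zero => exact hx
  | succ r =>
    obtain ⟨-, fz, ft, hz, ht, rz, rt⟩ := id hf
    have hball : ∀ i t, x i t ∈ Metric.ball (K t) R := fun i t =>
      (hxK i t).trans (by linarith)
    have hxU : ∀ i t, x i t ∈ U := fun i t => hKU t (hball i t)
    have hball' : ∀ i t s, ‖s‖ < h₀ → x i (t + s) ∈ Metric.ball (K t) R := fun i t s hs =>
      (dist_triangle _ _ _).trans_lt (by linarith [hxK i (t + s), hK t s hs])
    let A : ι → Cover m → Phase d →L[ℝ] Phase d := fun i t => fz i (x i t) t ()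
    let β : ι → Cover m → Cover m →L[ℝ] Phase d := fun i t => ft i (x i t) t ()
    have hcomp : ∀ {W : Type} [NormedAddCommGroup W] [NormedSpace ℝ W]
        {g : ι → Phase d → Cover m → Unit → W} {s : ℕ}, JReg U univ r g → s ≤ r → Reg s x →
        Reg s fun i t => g i (x i t) t () := by
      intro W _ _ g s hg hs hx
      exact (hg.of_le hs).comp hU isOpen_univ (x := fun i t _ => x i t) (y := fun _ t _ => t)
        (UReg.dReg hx) dReg_id (fun i t _ _ => hxU i t) (fun _ _ _ _ => mem_univ _)
    -- The Lipschitz closeness of `f` to `M` on the ball passes to the derivative of `f` at `x`, an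
    -- interior point of that ball.
    have hAM : ∀ i t, ‖A i t - M (proj t)‖ ≤ η := by
      intro i t
      refine ((hz i (x i t) (hxU i t) t (mem_univ _) ()).sub
        (M (proj t)).hasFDerivAt).le_of_lip' hη ?_
      filter_upwards [Metric.isOpen_ball.mem_nhds (hball i t)] with z hz
      refine le_trans (le_of_eq ?_) (hlin i t z hz _ (hball i t))
      simp only [map_sub, Pi.sub_apply]
      congr 1
      abel
    obtain ⟨-, b, hb⟩ := reg_zero_iff.1 hx
    obtain ⟨-, a, ha⟩ := reg_zero_iff.1 (hcomp rz (Nat.zero_le _) hx)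
    obtain ⟨B, hB⟩ := rt.uCont.2
    obtain ⟨x', hx', ⟨B', hB'⟩, he'⟩ := h.exists_hasFDerivAt (σ := σ) hη hG (A := A) (β := β)
      (x := x) (f := fun i z t => f i z t ()) (a := a) (b := b) (B := max B 0) (h₀ := h₀)
      (le_max_right _ _) hh₀ ha hAM
      (fun i t => (hB i t (mem_univ _) (x i t, ()) ⟨hxU i t, mem_univ _⟩).trans (le_max_left _ _))
      hb he
      (fun i t s hs => hlin i t _ (hball' i t s hs) _ (hball i t))
      (fun i t s hs => by
        have := convex_univ.norm_image_sub_le_of_norm_hasFDerivWithin_le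
          (f := fun t' => f i (x i (t + s)) t' ()) (f' := fun t' => ft i (x i (t + s)) t' ())
          (C := max B 0) (fun t' _ => (ht i _ (hxU i _) t' (mem_univ _) ()).hasFDerivWithinAt)
          (fun t' _ => (hB i t' (mem_univ _) (x i (t + s), ())
            ⟨hxU i _, mem_univ _⟩).trans (le_max_left _ _)) (mem_univ t) (mem_univ (t + s))
        simpa using this)
      (fun i t => (hasStrictFDerivAt_of_partial hU isOpen_univ (g := fun z t => f i z t ())
        (gx := fun z t => fz i z t ()) (gy := fun z t => ft i z t ())
        (fun z hz' t ht' => hz i z hz' t ht' ()) (fun z hz' t ht' => ht i z hz' t ht' ())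
        ((asOuter_continuousOn rz.uCont i).comp
          (f := fun p : Phase d × Cover m => (p.1, p.2, ())) (by fun_prop)
          fun p hp => ⟨hp.1, hp.2, mem_univ _⟩)
        ((asOuter_continuousOn rt.uCont i).comp
          (f := fun p : Phase d × Cover m => (p.1, p.2, ())) (by fun_prop)
          fun p hp => ⟨hp.1, hp.2, mem_univ _⟩) (hxU i t) (mem_univ _)).hasFDerivAt)
    -- Bootstrap: if `x` is `C^s`, then so are the coefficients evaluated along `x`, hence so is the
    -- solution `x'` of the linearized equation, and `x` is `C^(s+1)`.
    have key : ∀ s ≤ r + 1, Reg s x := by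
      intro s
      induction s with
      | zero => exact fun _ => hx
      | succ s ih =>
        intro hs
        have rs := ih (by omega)
        refine reg_succ_iff.2 ⟨hx, x', hx', Reg.of_directional fun v => ?_⟩
        exact h.reg_of_linear (σ := σ) hη hG hAM (hcomp rz (by omega) rs)
          (β := fun i t => β i t v)
          (UReg.clm (ContinuousLinearMap.apply ℝ (Phase d) v) (hcomp rt (by omega) rs))
          (b := B' * ‖v‖) (fun i t => (x' i t).le_of_opNorm_le (hB' i t) v) fun i t => he' i t v
    exact key _ le_rfl

end Orbits

/-! ### Taylor coefficients of curves, their comparison and measurability. -/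

section Taylor

open Filter Topology

variable {E : Type*} [NormedAddCommGroup E] [NormedSpace ℝ E]

/-- The Taylor coefficient of order `k` at `0`. -/
noncomputable def taylorCoef (f : ℝ → E) (k : ℕ) : E := ((k.factorial : ℝ))⁻¹ • iteratedDeriv k f 0

theorem hasDerivAt_sum_pow_succ (c : ℕ → E) (n : ℕ) (s : ℝ) :
    HasDerivAt (fun s => ∑ k ∈ Finset.range (n + 1), s ^ k • ((k.factorial : ℝ)⁻¹ • c k))
      (∑ k ∈ Finset.range n, s ^ k • ((k.factorial : ℝ)⁻¹ • c (k + 1))) s := by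
  simp_rw [Finset.sum_range_succ', pow_zero, one_smul]
  refine HasDerivAt.add_const _ ?_
  refine HasDerivAt.fun_sum fun k _ => ?_
  have h1 := (hasDerivAt_pow (k + 1) s).smul_const ((((k + 1).factorial : ℝ))⁻¹ • c (k + 1))
  refine h1.congr_deriv ?_
  rw [smul_smul, smul_smul, Nat.factorial_succ]
  congr 1
  have : (k.factorial : ℝ) ≠ 0 := by positivity
  have : (k : ℝ) + 1 ≠ 0 := by positivity
  push_cast
  field_simp

/-- Taylor expansion at the centre of an interval, with a bound on the remainder. -/
theorem norm_sub_taylor_le {s₀ : ℝ} {n : ℕ} {f : ℝ → E} {B : ℝ}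
    (hf : ContDiffOn ℝ n f (Ioo (-s₀) s₀))
    (hB : ∀ s ∈ Ioo (-s₀) s₀, ‖iteratedDeriv n f s‖ ≤ B) {s : ℝ} (hs : s ∈ Ioo (-s₀) s₀) :
    ‖f s - ∑ k ∈ Finset.range n, s ^ k • taylorCoef f k‖ ≤ B * |s| ^ n := by
  induction n generalizing f s with
  | zero => simpa using hB s hs
  | succ n ih =>
    have hs0 : 0 < s₀ := by linarith [hs.1, hs.2]
    push_cast at hf
    obtain ⟨hd, -, hf'⟩ := (contDiffOn_succ_iff_deriv_of_isOpen isOpen_Ioo).1 hf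
    have ih' := fun {s} (hs : s ∈ Ioo (-s₀) s₀) => ih (f := deriv f) (s := s) hf'
      (fun s hs => by rw [← iteratedDeriv_succ']; exact hB s hs) hs
    -- Subtracting the Taylor polynomial commutes with differentiation. The induction hypothesis
    -- bounds this derivative, and the mean value inequality from `0`, where the difference
    -- vanishes, gains a factor `|s|`.
    have hder : ∀ u ∈ Ioo (-s₀) s₀,
        HasDerivAt (fun u => f u - ∑ k ∈ Finset.range (n + 1), u ^ k • taylorCoef f k)
        (deriv f u - ∑ k ∈ Finset.range n, u ^ k • taylorCoef (deriv f) k) u := by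
      intro u hu
      have h1 := (hd.differentiableAt (isOpen_Ioo.mem_nhds hu)).hasDerivAt
      refine (h1.sub (hasDerivAt_sum_pow_succ (fun k => iteratedDeriv k f 0) n u)).congr_deriv ?_
      simp only [iteratedDeriv_succ']
      rfl
    have hsub : Icc (-|s|) |s| ⊆ Ioo (-s₀) s₀ := by
      intro u hu
      have : |s| < s₀ := abs_lt.2 hs
      exact ⟨by linarith [hu.1], by linarith [hu.2]⟩
    have h2 := (convex_Icc (-|s|) |s|).norm_image_sub_le_of_norm_hasDerivWithin_le
      (f := fun u => f u - ∑ k ∈ Finset.range (n + 1), u ^ k • taylorCoef f k)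
      (C := B * |s| ^ n) (x := 0) (y := s)
      (fun u hu => (hder u (hsub hu)).hasDerivWithinAt) (fun u hu => ?_)
      ⟨by simp, abs_nonneg s⟩ ⟨neg_abs_le s, le_abs_self s⟩
    · have e : f 0 - ∑ k ∈ Finset.range (n + 1), (0 : ℝ) ^ k • taylorCoef f k = 0 := by
        rw [Finset.sum_range_succ']
        simp [taylorCoef]
      rw [e] at h2
      rw [sub_zero, sub_zero, Real.norm_eq_abs] at h2
      rw [pow_succ, ← mul_assoc]
      exact h2
    · refine (ih' (hsub hu)).trans ?_
      have hB0 : 0 ≤ B := (norm_nonneg _).trans (hB 0 ⟨by linarith, hs0⟩)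
      exact mul_le_mul_of_nonneg_left (pow_le_pow_left₀ (abs_nonneg u) (abs_le.2 hu) n) hB0

/-- A polynomial of degree `n` that is `o(s ^ n)` vanishes. -/
theorem coef_eq_zero_of_isLittleO {n : ℕ} {a : ℕ → E}
    (h : (fun s : ℝ => ∑ k ∈ Finset.range (n + 1), s ^ k • a k) =o[𝓝[≠] 0] fun s : ℝ => s ^ n) :
    ∀ k ≤ n, a k = 0 := by
  have hcont : ∀ (n : ℕ) (a : ℕ → E), Continuous fun s : ℝ => ∑ k ∈ Finset.range n, s ^ k • a k :=
    fun n a => continuous_finsetSum _ fun k _ => (continuous_pow k).smul continuous_const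
  have h0 : ∀ {n : ℕ} {a : ℕ → E}, (fun s : ℝ => ∑ k ∈ Finset.range (n + 1), s ^ k • a k)
      =o[𝓝[≠] 0] (fun s : ℝ => s ^ n) → a 0 = 0 := by
    intro n a h
    have t1 : Tendsto (fun s : ℝ => ∑ k ∈ Finset.range (n + 1), s ^ k • a k) (𝓝[≠] 0)
        (𝓝 (a 0)) := by
      have := ((hcont (n + 1) a).tendsto 0).mono_left (nhdsWithin_le_nhds (s := {0}ᶜ))
      rw [Finset.sum_range_succ'] at this
      simpa using this
    have b : (fun s : ℝ => s ^ n) =O[𝓝[≠] 0] fun _ => (1 : ℝ) := by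
      have : Tendsto (fun s : ℝ => s ^ n) (𝓝[≠] 0) (𝓝 (0 ^ n)) :=
        ((continuous_pow n).tendsto 0).mono_left nhdsWithin_le_nhds
      exact this.isBigO_one ℝ
    exact tendsto_nhds_unique t1 ((Asymptotics.isLittleO_one_iff ℝ).1 (h.trans_isBigO b))
  induction n generalizing a with
  | zero =>
    intro k hk
    obtain rfl : k = 0 := by omega
    exact h0 h
  | succ n ih =>
    have h1 : (fun s : ℝ => ∑ k ∈ Finset.range (n + 1), s ^ k • a (k + 1)) =o[𝓝[≠] 0]
        fun s : ℝ => s ^ n := by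
      have h2 := (Asymptotics.isBigO_refl (fun s : ℝ => s⁻¹) (𝓝[≠] 0)).smul_isLittleO h
      refine h2.congr' ?_ ?_
      · filter_upwards [self_mem_nhdsWithin] with s hs
        have hs' : s ≠ 0 := hs
        rw [Finset.sum_range_succ', h0 h, smul_zero, add_zero, Finset.smul_sum]
        refine Finset.sum_congr rfl fun k _ => ?_
        rw [smul_smul, pow_succ]
        congr 1
        field_simp
      · filter_upwards [self_mem_nhdsWithin] with s hs
        have hs' : s ≠ 0 := hs
        rw [smul_eq_mul, pow_succ]
        field_simp
    intro k hk
    cases k with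
    | zero => exact h0 h
    | succ k => exact ih h1 k (by omega)

/-- Comparison of Taylor coefficients of functions that agree up to order `k`. -/
theorem taylorCoef_eq_add {s₀ : ℝ} (hs₀ : 0 < s₀) {k : ℕ} {f g : ℝ → E} {B B' : ℝ} {c : E}
    (hf : ContDiffOn ℝ (k + 1 : ℕ) f (Ioo (-s₀) s₀)) (hg : ContDiffOn ℝ (k + 1 : ℕ) g (Ioo (-s₀) s₀))
    (hB : ∀ s ∈ Ioo (-s₀) s₀, ‖iteratedDeriv (k + 1) f s‖ ≤ B)
    (hB' : ∀ s ∈ Ioo (-s₀) s₀, ‖iteratedDeriv (k + 1) g s‖ ≤ B')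
    (h : (fun s => f s - g s - s ^ k • c) =o[𝓝[≠] 0] fun s : ℝ => s ^ k) :
    taylorCoef f k = taylorCoef g k + c := by
  have hbig : ∀ {f : ℝ → E} {B : ℝ}, ContDiffOn ℝ (k + 1 : ℕ) f (Ioo (-s₀) s₀) →
      (∀ s ∈ Ioo (-s₀) s₀, ‖iteratedDeriv (k + 1) f s‖ ≤ B) →
      (fun s => f s - ∑ j ∈ Finset.range (k + 1), s ^ j • taylorCoef f j) =o[𝓝[≠] 0]
        fun s : ℝ => s ^ k := by
    intro f B hf hB
    have h1 : (fun s => f s - ∑ j ∈ Finset.range (k + 1), s ^ j • taylorCoef f j) =O[𝓝[≠] 0]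
        fun s : ℝ => s ^ (k + 1) := by
      refine Asymptotics.IsBigO.of_bound B ?_
      filter_upwards [nhdsWithin_le_nhds (Ioo_mem_nhds (neg_lt_zero.2 hs₀) hs₀)] with s hs
      rw [norm_pow, Real.norm_eq_abs]
      exact norm_sub_taylor_le hf hB hs
    have h2 : (fun s : ℝ => s ^ (k + 1)) =o[𝓝[≠] 0] fun s : ℝ => s ^ k :=
      (Asymptotics.isLittleO_pow_pow (Nat.lt_succ_self k)).mono nhdsWithin_le_nhds
    exact h1.trans_isLittleO h2
  have h1 := (h.sub (hbig hf hB)).add (hbig hg hB')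
  -- The polynomial with these coefficients is `o(s ^ k)`, hence zero; its coefficient of order `k`
  -- is the claim.
  let a : ℕ → E := fun j => taylorCoef f j - taylorCoef g j - if j = k then c else 0
  have h2 : (fun s : ℝ => ∑ j ∈ Finset.range (k + 1), s ^ j • a j) =o[𝓝[≠] 0]
      fun s : ℝ => s ^ k := by
    refine h1.congr_left fun s => ?_
    simp only [a, smul_sub, Finset.sum_sub_distrib, smul_ite, smul_zero, Finset.sum_ite_eq',
      Finset.mem_range, Nat.lt_succ_self, if_true]
    abel
  have h3 := coef_eq_zero_of_isLittleO h2 k le_rfl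
  simp only [a, if_true] at h3
  rw [sub_sub, sub_eq_zero] at h3
  exact h3

/-- Measurability is available only at fixed parameter. Derivatives inherit it as pointwise limits
of difference quotients along a sequence, at every point of the interval, so that the step can be
iterated. -/
theorem measurable_iteratedDeriv {X : Type*} [MeasurableSpace X] [MeasurableSpace E] [BorelSpace E]
    [SecondCountableTopology E]
    {s₀ : ℝ} {n : ℕ} {φ : X → ℝ → E}
    (hm : ∀ s ∈ Ioo (-s₀) s₀, Measurable fun p => φ p s)
    (hd : ∀ p, ContDiffOn ℝ n (φ p) (Ioo (-s₀) s₀)) {s : ℝ} (hs : s ∈ Ioo (-s₀) s₀) :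
    Measurable fun p => iteratedDeriv n (φ p) s := by
  induction n generalizing φ with
  | zero => simpa using hm s hs
  | succ n ih =>
    have hd' := fun p => (contDiffOn_succ_iff_deriv_of_isOpen isOpen_Ioo).1
      (by have := hd p; push_cast at this; exact this)
    simp_rw [iteratedDeriv_succ']
    refine ih (fun u hu => ?_) fun p => (hd' p).2.2
    -- The shift by `2` keeps `u + e j` strictly below `s₀`, also for `j = 0`.
    let e : ℕ → ℝ := fun j => (s₀ - u) / (j + 2)
    have he0 : ∀ j, 0 < e j := fun j => div_pos (by linarith [hu.2]) (by positivity)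
    have he1 : ∀ j, u + e j ∈ Ioo (-s₀) s₀ := by
      intro j
      refine ⟨by linarith [hu.1, he0 j], ?_⟩
      have : e j < s₀ - u := div_lt_self (by linarith [hu.2]) (by
        have : (0 : ℝ) ≤ j := by positivity
        linarith)
      linarith
    have helim : Tendsto e atTop (𝓝[≠] 0) := by
      refine tendsto_nhdsWithin_iff.2 ⟨?_, Eventually.of_forall fun j => (he0 j).ne'⟩
      refine tendsto_const_nhds.div_atTop ?_
      exact tendsto_atTop_add_const_right _ _ tendsto_natCast_atTop_atTop
    refine measurable_of_tendsto_metrizable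
      (f := fun j p => (e j)⁻¹ • (φ p (u + e j) - φ p u)) (fun j => ?_) ?_
    · exact ((hm _ (he1 j)).sub (hm u hu)).const_smul _
    · rw [tendsto_pi_nhds]
      intro p
      exact (((hd' p).1.differentiableAt
        (isOpen_Ioo.mem_nhds hu)).hasDerivAt.tendsto_slope_zero).comp helim

end Taylor

/-! ### Invariant sets of full measure. -/

section Dynamics

open Filter Topology

variable {Ω : Type*} [MeasurableSpace Ω]

theorem measurable_zpow (Φ : Ω ≃ᵐ Ω) (n : ℤ) : Measurable ⇑((Φ.toEquiv : Equiv.Perm Ω) ^ n) := by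
  induction n with
  | zero => exact measurable_id
  | succ n ih =>
    rw [zpow_add_one]
    exact ih.comp Φ.measurable
  | pred n ih =>
    rw [zpow_sub_one]
    exact ih.comp Φ.symm.measurable

theorem measurePreserving_zpow {P : Measure Ω} {Φ : Ω ≃ᵐ Ω} (hΦ : MeasurePreserving Φ P P) (n : ℤ) :
    MeasurePreserving ⇑((Φ.toEquiv : Equiv.Perm Ω) ^ n) P P := by
  induction n with
  | zero => exact MeasurePreserving.id P
  | succ n ih =>
    rw [zpow_add_one]
    exact ih.comp hΦ
  | pred n ih =>
    rw [zpow_sub_one]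
    exact ih.comp (hΦ.symm Φ)

/-- Almost sure properties hold on an invariant measurable set of full measure. -/
theorem exists_invariant {P : Measure Ω} {Φ : Ω ≃ᵐ Ω} (hΦ : MeasurePreserving Φ P P) {p : Ω → Prop}
    (hp : ∀ᵐ ω ∂P, p ω) : ∃ G : Set Ω, MeasurableSet G ∧ (∀ᵐ ω ∂P, ω ∈ G) ∧ (∀ ω ∈ G, p ω) ∧
      ∀ ω, Φ.toEquiv ω ∈ G ↔ ω ∈ G := by
  obtain ⟨N, hN, hNm, hN0⟩ := exists_measurable_superset_of_null (ae_iff.1 hp)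
  have hA : ∀ᵐ ω ∂P, ω ∉ N := by rwa [ae_iff, show {a | ¬a ∉ N} = N by ext; simp]
  -- The points whose entire orbit, past and future, avoids the exceptional null set: a countable
  -- intersection of sets of full measure.
  refine ⟨{ω | ∀ n : ℤ, ((Φ.toEquiv : Equiv.Perm Ω) ^ n) ω ∉ N}, ?_, ?_, ?_, ?_⟩
  · rw [ofPred_forall]
    exact MeasurableSet.iInter fun n => measurable_zpow Φ n hNm.compl
  · simp only [mem_ofPred_eq]
    rw [ae_all_iff]
    exact fun n => (measurePreserving_zpow hΦ n).quasiMeasurePreserving.ae hA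
  · intro ω hω
    by_contra h
    exact hω 0 (hN h)
  · intro ω
    have e : ∀ n : ℤ, ((Φ.toEquiv : Equiv.Perm Ω) ^ n) (Φ.toEquiv ω) =
        ((Φ.toEquiv : Equiv.Perm Ω) ^ (n + 1)) ω := fun n => by
      rw [zpow_add_one, Equiv.Perm.mul_apply]
    constructor
    · intro h n
      have := h (n - 1)
      rwa [e, sub_add_cancel] at this
    · intro h n
      rw [e]
      exact h (n + 1)

end Dynamics

/-! ### Regularity of a single realization. -/

section Fibre

open Filter Topology

variable {d m : ℕ} {U : Set (Phase d)} {l : ℕ} {C : ℝ}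

/-- The regularity `C^{0,l,l}` of a single realization, with the bound `C`. -/
structure FibreReg (U : Set (Phase d)) (l : ℕ) (C : ℝ) (f : Phase d → Torus m → ℝ → Phase d) :
    Prop where
  diff_eps : ∀ z ∈ U, ∀ θ, ContDiff ℝ l (f z θ)
  diff_z : ∀ k ≤ l, ∀ θ ε, ContDiffOn ℝ l (fun z => iteratedDeriv k (f z θ) ε) U
  continuous : ∀ j ≤ l, ∀ k ≤ l, ContinuousOn (fun p : Phase d × Cover m × ℝ =>
    iteratedFDeriv ℝ j (fun z => iteratedDeriv k (f z (proj p.2.1)) p.2.2) p.1) (U ×ˢ univ)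
  bounded : ∀ j ≤ l, ∀ k ≤ l, ∀ z ∈ U, ∀ (t : Cover m) (ε : ℝ),
    ‖iteratedFDeriv ℝ j (fun z => iteratedDeriv k (f z (proj t)) ε) z‖ ≤ C

/-- The orders of differentiation are countable in number, so their exceptional sets merge into one
null set, with one bound for all remaining realizations. -/
theorem LInfC.ae_fibreReg {Ω : Type*} [MeasurableSpace Ω] {P : Measure Ω}
    {F : Phase d → Torus m → ℝ → Ω → Phase d} (h : LInfC P U (boxIndex 0 l l) F) :
    ∃ C, ∀ᵐ ω ∂P, FibreReg U l C fun z θ s => F z θ s ω := by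
  obtain ⟨C, hC⟩ := h.bounded
  have mem : ∀ {j k : ℕ}, j ≤ l → k ≤ l → (0, j, k) ∈ boxIndex 0 l l :=
    fun hj hk => ⟨le_rfl, hj, hk⟩
  have h1 := h.diff_eps 0 l l (mem le_rfl le_rfl)
  have h2 : ∀ᵐ ω ∂P, ∀ k ≤ l, ∀ (θ : Torus m) (ε : ℝ),
      ContDiffOn ℝ l (fun z => iteratedDeriv k (fun s => F z θ s ω) ε) U := by
    refine ae_all_iff.2 fun k => ?_
    by_cases hk : k ≤ l
    · filter_upwards [h.diff_z 0 l k (mem le_rfl hk)] with ω hω _ using hω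
    · exact Eventually.of_forall fun ω hk' => absurd hk' hk
  have h3 : ∀ᵐ ω ∂P, ∀ j k : ℕ, j ≤ l → k ≤ l →
      ContinuousOn (fun p : Phase d × Cover m × ℝ => mixedDeriv F 0 j k ω p.1 p.2.1 p.2.2)
        (U ×ˢ univ) := by
    refine ae_all_iff.2 fun j => ae_all_iff.2 fun k => ?_
    by_cases hjk : j ≤ l ∧ k ≤ l
    · filter_upwards [h.continuous 0 j k (mem hjk.1 hjk.2)] with ω hω _ _ using hω
    · exact Eventually.of_forall fun ω hj hk => absurd ⟨hj, hk⟩ hjk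
  have h4 : ∀ᵐ ω ∂P, ∀ j k : ℕ, j ≤ l → k ≤ l → ∀ z ∈ U, ∀ (t : Cover m) (ε : ℝ),
      ‖mixedDeriv F 0 j k ω z t ε‖ ≤ C := by
    refine ae_all_iff.2 fun j => ae_all_iff.2 fun k => ?_
    by_cases hjk : j ≤ l ∧ k ≤ l
    · filter_upwards [hC 0 j k (mem hjk.1 hjk.2)] with ω hω _ _ using hω
    · exact Eventually.of_forall fun ω hj hk => absurd ⟨hj, hk⟩ hjk
  refine ⟨C, ?_⟩
  filter_upwards [h1, h2, h3, h4] with ω g1 g2 g3 g4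
  refine ⟨g1, g2, fun j hj k hk => ?_, fun j hj k hk z hz t ε => ?_⟩
  · have := (continuousMultilinearCurryFin0 ℝ (Cover m) (ContinuousMultilinearMap ℝ
      (fun _ : Fin j => Phase d) (Phase d))).continuous.comp_continuousOn (g3 j k hj hk)
    refine this.congr fun p hp => ?_
    simp [mixedDeriv]
  · have := g4 j k hj hk z hz t ε
    rwa [mixedDeriv, norm_iteratedFDeriv_zero] at this

/-- Here `ε` is the inner and `z` the outer variable, while `θ` is only a continuous parameter. The
class contains `D_z^j D_ε^k` for all `j, k ≤ l`, in particular for `j + k ≤ l`; the other orders of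
differentiation follow by commuting partial derivatives. -/
theorem FibreReg.jReg {ι : Type*} {G : ι → Phase d → Torus m → ℝ → Phase d} (hU : IsOpen U)
    (h : ∀ i, FibreReg U l C (G i)) :
    JReg univ U l (fun i (s : ℝ) z (t : Cover m) => G i z (proj t) s) := by
  refine HReg.jReg isOpen_univ hU (HReg.of_iteratedFDeriv isOpen_univ hU
    (fun i y hy q => ((h i).diff_eps y hy _).contDiffOn) ?_ ?_)
  · intro j k hjk i x _ q
    have e : (fun y => iteratedFDeriv ℝ j (fun x => G i y (proj q) x) x) =
        (ContinuousMultilinearMap.piFieldEquiv ℝ (Fin j) (Phase d)).toContinuousLinearEquiv ∘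
          fun y => iteratedDeriv j (G i y (proj q)) x := by
      ext1 y
      rw [iteratedFDeriv_eq_equiv_comp]; rfl
    rw [e, ContinuousLinearEquiv.comp_contDiffOn_iff]
    exact ((h i).diff_z j (by omega) _ _).of_le (by exact_mod_cast (by omega : k ≤ l))
  · intro j k hjk
    have e : ∀ i x (q : Cover m), (fun y => iteratedFDeriv ℝ j (fun x => G i y (proj q) x) x) =
        (ContinuousMultilinearMap.piFieldEquiv ℝ (Fin j) (Phase d)).toContinuousLinearEquiv ∘
          fun y => iteratedDeriv j (G i y (proj q)) x := by
      intro i x q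
      ext1 y
      rw [iteratedFDeriv_eq_equiv_comp]; rfl
    have h1 : UCont U (univ ×ˢ univ) (asOuter fun i (s : ℝ) z (t : Cover m) =>
        iteratedFDeriv ℝ k (fun y => iteratedDeriv j (G i y (proj t)) s) z) := by
      refine ⟨fun i => ?_, C, fun i y hy q _ => (h i).bounded k (by omega) j (by omega) y hy _ _⟩
      exact ((h i).continuous k (by omega) j (by omega)).comp
        (f := fun p : Phase d × ℝ × Cover m => (p.1, p.2.2, p.2.1)) (by fun_prop)
        fun p hp => ⟨hp.1, mem_univ _⟩
    refine (h1.clm ((ContinuousMultilinearMap.piFieldEquiv ℝ (Fin j)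
      (Phase d)).toContinuousLinearEquiv.toContinuousLinearMap.compContinuousMultilinearMapL ℝ
        (fun _ : Fin k => Phase d) _ _)).congr fun i y hy q hq => ?_
    simp only [asOuter]
    rw [e i q.1 q.2, ContinuousLinearEquiv.iteratedFDeriv_comp_left]
    rfl

variable {f : Phase d → Torus m → ℝ → Phase d}

theorem FibreReg.norm_sub_le (h : FibreReg U l C f) (hl : 1 ≤ l) {z : Phase d} (hz : z ∈ U)
    (θ : Torus m) (ε : ℝ) : ‖f z θ ε - f z θ 0‖ ≤ C * |ε| := by
  obtain ⟨t, rfl⟩ := proj_surjective θ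
  have := convex_univ.norm_image_sub_le_of_norm_deriv_le (f := f z (proj t)) (C := C) (x := 0)
    (y := ε) (fun s _ => ((h.diff_eps z hz _).differentiable (by positivity)).differentiableAt)
    (fun s _ => by
      have := h.bounded 0 (by omega) 1 hl z hz t s
      rwa [norm_iteratedFDeriv_zero, iteratedDeriv_one] at this) (mem_univ _) (mem_univ _)
  simpa using this

/-- The mixed derivative `D_z D_ε` is bounded by `C`: apply the mean value inequality in `z`, which
needs convexity of `S`, and then in `ε`. Thus the Lipschitz constant of `F_ε - F₀` in `z` is small
with `ε`. -/
theorem FibreReg.norm_sub_sub_le (h : FibreReg U l C f) (hl : 1 ≤ l) (hU : IsOpen U)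
    {S : Set (Phase d)} (hS : Convex ℝ S) (hSU : S ⊆ U) {z z' : Phase d} (hz : z ∈ S) (hz' : z' ∈ S)
    (θ : Torus m) (ε : ℝ) :
    ‖f z θ ε - f z' θ ε - (f z θ 0 - f z' θ 0)‖ ≤ C * ‖z - z'‖ * |ε| := by
  obtain ⟨t, rfl⟩ := proj_surjective θ
  have hd : ∀ z ∈ U, Differentiable ℝ (f z (proj t)) := fun z hz =>
    (h.diff_eps z hz _).differentiable (by positivity)
  have h1 : ∀ s, ‖deriv (f z (proj t)) s - deriv (f z' (proj t)) s‖ ≤ C * ‖z - z'‖ := by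
    intro s
    refine hS.norm_image_sub_le_of_norm_fderiv_le (f := fun z => deriv (f z (proj t)) s) (𝕜 := ℝ)
      (fun w hw => ?_) (fun w hw => ?_) hz' hz
    · have := (h.diff_z 1 hl (proj t) s).differentiableOn (by positivity)
      simp only [iteratedDeriv_one] at this
      exact this.differentiableAt (hU.mem_nhds (hSU hw))
    · have := h.bounded 1 hl 1 hl w (hSU hw) t s
      rw [norm_iteratedFDeriv_one] at this
      simpa only [iteratedDeriv_one] using this
  have := convex_univ.norm_image_sub_le_of_norm_deriv_le
    (f := fun s => f z (proj t) s - f z' (proj t) s) (C := C * ‖z - z'‖) (x := 0)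
    (y := ε) (fun s _ => ((hd z (hSU hz)) s).sub ((hd z' (hSU hz')) s))
    (fun s _ => by
      rw [deriv_fun_sub ((hd z (hSU hz)) s) ((hd z' (hSU hz')) s)]
      exact h1 s) (mem_univ _) (mem_univ _)
  simpa using this

end Fibre

/-! ### Systems that are regular for every realization. -/

section System

open Filter Topology

variable {d m : ℕ} {Ω : Type*} [MeasurableSpace Ω]

/-- Jointly measurable maps that are continuous in `θ` for every `ω`. -/
def GoodMap {E : Type*} [TopologicalSpace E] [MeasurableSpace E] (x : Torus m × Ω → E) : Prop :=
  Measurable x ∧ ∀ ω, Continuous fun θ => x (θ, ω)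

theorem GoodMap.of_tendstoUniformly {u : ℕ → Torus m × Ω → Phase d} {x : Torus m × Ω → Phase d}
    (hu : ∀ n, GoodMap (u n)) (h : TendstoUniformly u x atTop) : GoodMap x := by
  refine ⟨measurable_of_tendsto_metrizable (fun n => (hu n).1)
    (tendsto_pi_nhds.2 fun p => h.tendsto_at p), fun ω => ?_⟩
  have := h.comp fun θ : Torus m => (θ, ω)
  exact this.continuous (Frequently.of_forall fun n => (hu n).2 ω)

theorem GoodMap.apply_clm {G : Torus m → Phase d →L[ℝ] Phase d} (hG : Continuous G)
    {x : Torus m × Ω → Phase d} (hx : GoodMap x) : GoodMap fun p => G p.1 (x p) := by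
  refine ⟨?_, fun ω => hG.clm_apply (hx.2 ω)⟩
  have : Continuous fun q : Torus m × Phase d => G q.1 q.2 :=
    (hG.comp continuous_fst).clm_apply continuous_snd
  exact this.measurable.comp (measurable_fst.prodMk hx.1)

theorem GoodMap.add {x y : Torus m × Ω → Phase d} (hx : GoodMap x) (hy : GoodMap y) :
    GoodMap fun p => x p + y p := ⟨hx.1.add hy.1, fun ω => (hx.2 ω).add (hy.2 ω)⟩

theorem GoodMap.sub {x y : Torus m × Ω → Phase d} (hx : GoodMap x) (hy : GoodMap y) :
    GoodMap fun p => x p - y p := ⟨hx.1.sub hy.1, fun ω => (hx.2 ω).sub (hy.2 ω)⟩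

theorem GoodMap.of_torus {K : Torus m → Phase d} (hK : Continuous K) :
    GoodMap fun p : Torus m × Ω => K p.1 := ⟨hK.measurable.comp measurable_fst, fun _ => hK⟩

theorem GoodMap.tsum {g : ℕ → Torus m × Ω → Phase d} (hg : ∀ k, GoodMap (g k)) {u : ℕ → ℝ}
    (hu : Summable u) (hb : ∀ k p, ‖g k p‖ ≤ u k) : GoodMap fun p => ∑' k, g k p := by
  refine ⟨?_, fun ω => continuous_tsum (fun k => (hg k).2 ω) hu fun k θ => hb k _⟩
  refine measurable_of_tendsto_metrizable
    (f := fun n p => ∑ k ∈ Finset.range n, g k p) (fun n => ?_) (tendsto_pi_nhds.2 fun p => ?_)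
  · exact Finset.measurable_fun_sum _ fun k _ => (hg k).1
  · exact (Summable.of_norm_bounded hu fun k => hb k p).hasSum.tendsto_sum_nat

theorem GoodMap.shift {x : Torus m × Ω → Phase d} (hx : GoodMap x) (a : Torus m) (Φ : Ω ≃ᵐ Ω)
    (n : ℤ) : GoodMap fun p => x ((skew a Φ.toEquiv ^ n) p) := by
  simp_rw [skew_zpow]
  refine ⟨hx.1.comp ?_, fun ω => ?_⟩
  · exact (measurable_fst.add_const _).prodMk ((measurable_zpow Φ n).comp measurable_snd)
  · exact (hx.2 ((Φ.toEquiv ^ n) ω)).comp (g := fun θ => x (θ, _)) (continuous_add_const (n • a))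

/-- The kernels are deterministic and continuous, and the two series are dominated by geometric
ones. Measurability and continuity in `θ` therefore survive the summation. -/
theorem GoodMap.greenMap {M : Torus m → Phase d →L[ℝ] Phase d} {a : Torus m}
    {GS GU : ℕ → Torus m → Phase d →L[ℝ] Phase d} {C lam : ℝ} (h : Dichotomy M a GS GU C lam)
    (hS : ∀ k, Continuous (GS k)) (hU : ∀ k, Continuous (GU k)) (Φ : Ω ≃ᵐ Ω)
    {r : Torus m × Ω → Phase d} (hr : GoodMap r) {b : ℝ} (hb : ∀ p, ‖r p‖ ≤ b) :
    GoodMap (greenMap GS GU Prod.fst (skew a Φ.toEquiv) r) :=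
  GoodMap.sub
    (GoodMap.tsum (fun k => GoodMap.apply_clm (hS k) (hr.shift a Φ _)) (h.summable_bound b)
      fun k p => h.norm_GS_apply_le (r := fun n => r ((skew a Φ.toEquiv ^ n) p)) (fun _ => hb _) k)
    (GoodMap.tsum (fun k => GoodMap.apply_clm (hU (k + 1)) (hr.shift a Φ _)) (h.summable_bound b)
      fun k p => h.norm_GU_apply_le (r := fun n => r ((skew a Φ.toEquiv ^ n) p)) (fun _ => hb _) k)

theorem GoodMap.randomMap {P : Measure Ω} {κ : Torus m → Ω → Phase d}
    (h : GoodMap fun p : Torus m × Ω => κ p.1 p.2) {B : ℝ} (hB : ∀ θ ω, ‖κ θ ω‖ ≤ B) :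
    RandomMap P 0 κ := by
  refine ⟨h.1, Eventually.of_forall fun ω => ?_, B, fun i hi => Eventually.of_forall fun ω t => ?_⟩
  · have := (h.2 ω).comp continuous_proj
    rw [Nat.cast_zero]
    exact contDiff_zero.2 this
  · obtain rfl : i = 0 := by omega
    rw [norm_iteratedFDeriv_zero]
    exact hB _ _

/-- A random system all of whose realizations are regular, with a common deterministic limit. -/
structure UniformSystem (U : Set (Phase d)) (l : ℕ) (C : ℝ) (a : Torus m)
    (F : Phase d → Torus m → ℝ → Ω → Phase d) (F₀ : Phase d → Torus m → Phase d)
    (K₀ : Torus m → Phase d) : Prop where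
  isOpen : IsOpen U
  one_le : 1 ≤ l
  fibre : ∀ ω, FibreReg U l C fun z θ s => F z θ s ω
  measurable : ∀ ε : ℝ, Measurable fun p : U × Torus m × Ω => F p.1 p.2.1 ε p.2.2
  zero : ∀ ω, ∀ z ∈ U, ∀ θ, F z θ 0 ω = F₀ z θ
  continuous_K : Continuous K₀
  mem : ∀ θ, K₀ θ ∈ U
  invariant : ∀ θ, F₀ (K₀ θ) θ = K₀ (θ + a)
  nonempty : Nonempty Ω

namespace UniformSystem

variable {U : Set (Phase d)} {l : ℕ} {C : ℝ} {a : Torus m}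
  {F : Phase d → Torus m → ℝ → Ω → Phase d} {F₀ : Phase d → Torus m → Phase d}
  {K₀ : Torus m → Phase d}

theorem jReg (h : UniformSystem U l C a F F₀ K₀) :
    JReg univ U l (fun ω (s : ℝ) z (t : Cover m) => F z (proj t) s ω) :=
  FibreReg.jReg (G := fun ω z θ s => F z θ s ω) h.isOpen h.fibre

theorem goodMap_comp (h : UniformSystem U l C a F F₀ K₀) {x : Torus m × Ω → Phase d}
    (hx : GoodMap x) (hxU : ∀ p, x p ∈ U) (ε : ℝ) : GoodMap fun p => F (x p) p.1 ε p.2 := by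
  refine ⟨?_, fun ω => ?_⟩
  · exact (h.measurable ε).comp
      (g := fun p : U × Torus m × Ω => F p.1 p.2.1 ε p.2.2)
      (f := fun p : Torus m × Ω => ((⟨x p, hxU p⟩ : U), p.1, p.2))
      ((hx.1.subtype_mk).prodMk measurable_id)
  · rw [← isOpenQuotientMap_proj.continuous_comp_iff, ← continuousOn_univ]
    exact (asOuter_continuousOn h.jReg.uCont ω).comp
      (f := fun t : Cover m => (ε, x (proj t, ω), t))
      (continuous_const.prodMk (((hx.2 ω).comp continuous_proj).prodMk
        continuous_id)).continuousOn fun t _ => ⟨mem_univ _, hxU _, mem_univ _⟩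

/-- Regularity of the transfer matrix. -/
theorem exists_deriv (h : UniformSystem U l C a F F₀ K₀) :
    ∃ A : Phase d → Cover m → Phase d →L[ℝ] Phase d,
      (∀ z ∈ U, ∀ t, HasFDerivAt (fun z => F₀ z (proj t)) (A z t) z) ∧
      ContinuousOn (fun p : Phase d × Cover m => A p.1 p.2) (U ×ˢ univ) := by
  -- `F₀` carries no regularity of its own; it inherits it from any realization at `ε = 0`.
  obtain ⟨ω⟩ := h.nonempty
  obtain ⟨-, -, gz, -, hz, -, rz⟩ := h.jReg.of_le h.one_le
  refine ⟨fun z t => gz ω 0 z t, fun z hz' t => ?_, ?_⟩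
  · refine (hz ω 0 (mem_univ _) z hz' t).congr_of_eventuallyEq ?_
    filter_upwards [h.isOpen.mem_nhds hz'] with w hw using (h.zero ω w hw _).symm
  · exact (asOuter_continuousOn rz.uCont ω).comp
      (f := fun p : Phase d × Cover m => ((0 : ℝ), p.1, p.2)) (by fun_prop)
      fun p hp => ⟨mem_univ _, hp.1, mem_univ _⟩

theorem continuous_transferMatrix (h : UniformSystem U l C a F F₀ K₀) :
    Continuous (transferMatrix F₀ K₀) := by
  obtain ⟨A, hA, cA⟩ := h.exists_deriv
  rw [← isOpenQuotientMap_proj.continuous_comp_iff]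
  have e : transferMatrix F₀ K₀ ∘ proj = fun t => A (K₀ (proj t)) t := by
    ext1 t
    exact (hA _ (h.mem _) t).fderiv
  rw [e, ← continuousOn_univ]
  exact cA.comp (f := fun t : Cover m => (K₀ (proj t), t))
    ((h.continuous_K.comp continuous_proj).prodMk continuous_id).continuousOn
    fun t _ => ⟨h.mem _, mem_univ _⟩

/-- Uniform linear approximation of the deterministic map near the torus. -/
theorem exists_radius (h : UniformSystem U l C a F F₀ K₀) {η : ℝ} (hη : 0 < η) :
    ∃ R > 0, ∀ θ, Metric.ball (K₀ θ) R ⊆ U ∧ ∀ z ∈ Metric.ball (K₀ θ) R,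
      ∀ z' ∈ Metric.ball (K₀ θ) R,
        ‖F₀ z θ - F₀ z' θ - transferMatrix F₀ K₀ θ (z - z')‖ ≤ η * ‖z - z'‖ := by
  obtain ⟨A, hA, cA⟩ := h.exists_deriv
  obtain ⟨Q, hQ, hQs⟩ := exists_isCompact_proj (m := m)
  have hM := h.continuous_transferMatrix
  have hUo : IsOpen (U ×ˢ (univ : Set (Cover m))) := h.isOpen.prod isOpen_univ
  have hc : ContinuousOn (fun p : Phase d × Cover m =>
      ‖A p.1 p.2 - transferMatrix F₀ K₀ (proj p.2)‖) (U ×ˢ univ) :=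
    (cA.sub (hM.comp (continuous_proj.comp continuous_snd)).continuousOn).norm
  have hV := hc.isOpen_inter_preimage hUo (isOpen_Iio (a := η))
  set V := U ×ˢ (univ : Set (Cover m)) ∩ (fun p : Phase d × Cover m =>
      ‖A p.1 p.2 - transferMatrix F₀ K₀ (proj p.2)‖) ⁻¹' Iio η with hVdef
  have hcomp : IsCompact ((fun t : Cover m => (K₀ (proj t), t)) '' Q) :=
    hQ.image ((h.continuous_K.comp continuous_proj).prodMk continuous_id)
  -- The derivative is given on the cover, so compactness is applied to the graph of `K₀` over a
  -- compact set covering the torus. This makes `R` uniform in `θ`.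
  obtain ⟨R, hR, hRV⟩ := hcomp.exists_thickening_subset_open hV (by
    rintro _ ⟨t, -, rfl⟩
    refine ⟨⟨h.mem _, mem_univ _⟩, ?_⟩
    have : A (K₀ (proj t)) t = transferMatrix F₀ K₀ (proj t) := ((hA _ (h.mem _) t).fderiv).symm
    simpa [this] using hη)
  have key : ∀ t ∈ Q, ∀ z ∈ Metric.ball (K₀ (proj t)) R, (z, t) ∈ V := by
    intro t ht z hz
    refine hRV (Metric.mem_thickening_iff.2 ⟨_, mem_image_of_mem _ ht, ?_⟩)
    rw [Prod.dist_eq]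
    simpa [hR] using hz
  refine ⟨R, hR, fun θ => ?_⟩
  obtain ⟨t, ht, rfl⟩ := hQs θ
  refine ⟨fun z hz => (key t ht z hz).1.1, fun z hz z' hz' => ?_⟩
  have := (convex_ball (K₀ (proj t)) R).norm_image_sub_le_of_norm_hasFDerivWithin_le
    (f := fun z => F₀ z (proj t) - transferMatrix F₀ K₀ (proj t) z)
    (f' := fun z => A z t - transferMatrix F₀ K₀ (proj t)) (C := η)
    (fun w hw => ((hA w (key t ht w hw).1.1 t).sub
      (transferMatrix F₀ K₀ (proj t)).hasFDerivAt).hasFDerivWithinAt)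
    (fun w hw => (key t ht w hw).2.le) hz' hz
  refine le_trans (le_of_eq ?_) this
  congr 1
  simp only [map_sub]; abel

theorem bound_nonneg (h : UniformSystem U l C a F F₀ K₀) : 0 ≤ C := by
  obtain ⟨ω⟩ := h.nonempty
  exact (norm_nonneg _).trans
    ((h.fibre ω).bounded 0 (Nat.zero_le _) 0 (Nat.zero_le _) (K₀ 0) (h.mem 0) 0 0)

/-- The linear approximation for small `ε`. -/
theorem norm_linearization_le (h : UniformSystem U l C a F F₀ K₀) {η R : ℝ}
    (hR : ∀ θ, Metric.ball (K₀ θ) R ⊆ U ∧ ∀ z ∈ Metric.ball (K₀ θ) R,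
      ∀ z' ∈ Metric.ball (K₀ θ) R,
        ‖F₀ z θ - F₀ z' θ - transferMatrix F₀ K₀ θ (z - z')‖ ≤ η / 2 * ‖z - z'‖)
    {ε : ℝ} (hε : C * |ε| ≤ η / 2) (ω : Ω) (θ : Torus m) {z z' : Phase d}
    (hz : z ∈ Metric.ball (K₀ θ) R) (hz' : z' ∈ Metric.ball (K₀ θ) R) :
    ‖F z θ ε ω - F z' θ ε ω - transferMatrix F₀ K₀ θ (z - z')‖ ≤ η * ‖z - z'‖ := by
  have h1 := (h.fibre ω).norm_sub_sub_le h.one_le h.isOpen (convex_ball (K₀ θ) R) (hR θ).1 hz hz'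
    θ ε
  have h2 := (hR θ).2 z hz z' hz'
  rw [h.zero ω z ((hR θ).1 hz), h.zero ω z' ((hR θ).1 hz')] at h1
  have e : F z θ ε ω - F z' θ ε ω - transferMatrix F₀ K₀ θ (z - z') =
      (F z θ ε ω - F z' θ ε ω - (F₀ z θ - F₀ z' θ)) +
        (F₀ z θ - F₀ z' θ - transferMatrix F₀ K₀ θ (z - z')) := by abel
  rw [e]
  refine (norm_add_le _ _).trans ((add_le_add h1 h2).trans ?_)
  have := norm_nonneg (z - z')
  nlinarith

end UniformSystem

end System

/-! ### Regular families of curves. -/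

section OneParameter

open Filter Topology

variable {ι Q : Type*} [TopologicalSpace Q] {S : Set ℝ} {P : Set Q} {r : ℕ}
  {W : Type} [NormedAddCommGroup W] [NormedSpace ℝ W]

theorem UReg.iteratedDeriv (hS : IsOpen S) {g : ι → ℝ → Q → W} (hg : UReg S P r g) {k : ℕ}
    (hk : k ≤ r) : UCont S P (fun i y q => iteratedDeriv k (fun y => g i y q) y) :=
  (hg.iteratedFDeriv hS hk).clm (ContinuousMultilinearMap.apply ℝ (fun _ : Fin k => ℝ) W fun _ => 1)

theorem uReg_id {s₀ : ℝ} : UReg (ι := ι) (Ioo (-s₀) s₀) P r (fun _ s _ => s) := by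
  have h0 : UCont (ι := ι) (Ioo (-s₀) s₀) P (fun _ s _ => s) :=
    ⟨fun _ => continuousOn_fst, s₀, fun _ s hs _ _ => (abs_lt.2 hs).le⟩
  cases r with
  | zero => exact h0
  | succ r =>
    exact ⟨h0, fun _ _ _ => ContinuousLinearMap.id ℝ ℝ, fun _ s _ _ _ => hasFDerivAt_id s,
      UReg.const (c := fun _ _ => ContinuousLinearMap.id ℝ ℝ) (fun _ => continuousOn_const)
        (C := ‖ContinuousLinearMap.id ℝ ℝ‖) (fun _ _ _ => le_rfl)⟩

theorem uReg_pow {s₀ : ℝ} (n : ℕ) : UReg (ι := ι) (Ioo (-s₀) s₀) P r (fun _ s _ => s ^ n) := by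
  induction n with
  | zero =>
    simp_rw [pow_zero]
    exact UReg.const (c := fun _ _ => (1 : ℝ)) (fun _ => continuousOn_const) (C := 1) (by simp)
  | succ n ih =>
    simp_rw [pow_succ]
    exact ih.bilin (ContinuousLinearMap.mul ℝ ℝ) uReg_id

end OneParameter

/-! ### The formal expansion in `ε` and its defect. -/

section Expansion

open Filter Topology

variable {d m : ℕ} {Ω : Type*} [MeasurableSpace Ω]

/-- Sequences of good and bounded maps starting with `K₀`. -/
structure GoodSeq (K₀ : Torus m → Phase d) (κ : ℕ → Torus m → Ω → Phase d) : Prop where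
  zero : ∀ θ ω, κ 0 θ ω = K₀ θ
  good : ∀ i, GoodMap fun p : Torus m × Ω => κ i p.1 p.2
  bounded : ∀ i, ∃ B, ∀ θ ω, ‖κ i θ ω‖ ≤ B

/-- The map `F_ε` along a partial sum, as a function of `ε`. -/
noncomputable def along (F : Phase d → Torus m → ℝ → Ω → Phase d) (κ : ℕ → Torus m → Ω → Phase d) (N : ℕ)
    (p : Torus m × Ω) (s : ℝ) : Phase d := F (partialSum κ N s p.1 p.2) p.1 s p.2

theorem partialSum_one (κ : ℕ → Torus m → Ω → Phase d) (s : ℝ) (θ : Torus m) (ω : Ω) :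
    partialSum κ 1 s θ ω = κ 0 θ ω := by
  simp [partialSum]

theorem partialSum_succ (κ : ℕ → Torus m → Ω → Phase d) (n : ℕ) (s : ℝ) (θ : Torus m) (ω : Ω) :
    partialSum κ (n + 1) s θ ω = partialSum κ n s θ ω + s ^ n • κ n θ ω :=
  Finset.sum_range_succ _ _

theorem partialSum_succ_zero (κ : ℕ → Torus m → Ω → Phase d) (n : ℕ) (θ : Torus m) (ω : Ω) :
    partialSum κ (n + 1) 0 θ ω = κ 0 θ ω := by
  rw [partialSum, Finset.sum_range_succ']
  simp

theorem continuous_partialSum (κ : ℕ → Torus m → Ω → Phase d) (n : ℕ) (θ : Torus m) (ω : Ω) :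
    Continuous fun s => partialSum κ n s θ ω :=
  continuous_finsetSum _ fun i _ => (continuous_pow i).smul continuous_const

theorem GoodMap.partialSum {κ : ℕ → Torus m → Ω → Phase d}
    (h : ∀ i, GoodMap fun p : Torus m × Ω => κ i p.1 p.2) (n : ℕ) (s : ℝ) :
    GoodMap fun p : Torus m × Ω => partialSum κ n s p.1 p.2 :=
  ⟨Finset.measurable_fun_sum _ fun i _ => (h i).1.const_smul (s ^ i),
    fun ω => continuous_finsetSum _ fun i _ => ((h i).2 ω).fun_const_smul _⟩

namespace GoodSeq

variable {K₀ : Torus m → Phase d} {κ : ℕ → Torus m → Ω → Phase d}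

theorem exists_norm_sub_le (h : GoodSeq K₀ κ) (N : ℕ) : ∃ B, 0 ≤ B ∧ ∀ s : ℝ, |s| ≤ 1 → ∀ θ ω,
    ‖RandomTorus.partialSum κ (N + 1) s θ ω - K₀ θ‖ ≤ B * |s| := by
  induction N with
  | zero => exact ⟨0, le_rfl, fun s _ θ ω => by simp [partialSum_one, h.zero]⟩
  | succ N ih =>
    obtain ⟨B, hB0, hB⟩ := ih
    obtain ⟨B', hB'⟩ := h.bounded (N + 1)
    refine ⟨B + max B' 0, by positivity, fun s hs θ ω => ?_⟩
    rw [partialSum_succ, add_sub_right_comm, add_mul]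
    refine (norm_add_le _ _).trans (add_le_add (hB s hs θ ω) ?_)
    rw [norm_smul, norm_pow, Real.norm_eq_abs, mul_comm, pow_succ]
    have h1 : |s| ^ N ≤ 1 := pow_le_one₀ (abs_nonneg s) hs
    refine mul_le_mul ((hB' θ ω).trans (le_max_left _ _)) ?_ (by positivity) (le_max_right _ _)
    nlinarith [abs_nonneg s]

theorem exists_mem_ball (h : GoodSeq K₀ κ) (N : ℕ) {R : ℝ} (hR : 0 < R) :
    ∃ s₀ > 0, ∀ s ∈ Ioo (-s₀) s₀, ∀ θ ω,
      RandomTorus.partialSum κ (N + 1) s θ ω ∈ Metric.ball (K₀ θ) R := by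
  obtain ⟨B, hB0, hB⟩ := h.exists_norm_sub_le N
  refine ⟨min 1 (R / (B + 1)), by positivity, fun s hs θ ω => ?_⟩
  have hs' := abs_lt.2 hs
  have h1 : |s| ≤ 1 := (hs'.trans_le (min_le_left _ _)).le
  have h2 : |s| < R / (B + 1) := hs'.trans_le (min_le_right _ _)
  rw [lt_div_iff₀ (by positivity)] at h2
  rw [mem_ball_iff_norm]
  refine (hB s h1 θ ω).trans_lt ?_
  nlinarith [abs_nonneg s]

theorem uReg_partialSum (h : GoodSeq K₀ κ) (n r : ℕ) {s₀ : ℝ} :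
    UReg (Ioo (-s₀) s₀) univ r
      (fun ω s (t : Cover m) => RandomTorus.partialSum κ n s (proj t) ω) := by
  induction n with
  | zero =>
    exact UReg.const (c := fun _ _ => 0) (fun _ => continuousOn_const) (C := 0) (by simp)
  | succ n ih =>
    simp_rw [partialSum_succ]
    obtain ⟨B, hB⟩ := h.bounded n
    refine ih.add ((uReg_pow n).bilin (ContinuousLinearMap.lsmul ℝ ℝ)
      (UReg.const (c := fun ω t => κ n (proj t) ω) (fun ω => ?_) (C := B) fun ω t _ => hB _ _))
    exact (((h.good n).2 ω).comp continuous_proj).continuousOn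

end GoodSeq

namespace UniformSystem

variable {U : Set (Phase d)} {l : ℕ} {C : ℝ} {a : Torus m}
  {F : Phase d → Torus m → ℝ → Ω → Phase d} {F₀ : Phase d → Torus m → Phase d}
  {K₀ : Torus m → Phase d} {κ : ℕ → Torus m → Ω → Phase d}

/-- Boundedness of the coefficients keeps the partial sums near the torus for `|s| < s₀` uniformly
in `(θ, ω)`. The chain rule then gives bounds with the same uniformity, and good Taylor
coefficients. -/
theorem exists_regular_along (h : UniformSystem U l C a F F₀ K₀) (hκ : GoodSeq K₀ κ) (N : ℕ) :
    ∃ s₀ > 0, (∀ p, ContDiffOn ℝ l (along F κ (N + 1) p) (Ioo (-s₀) s₀)) ∧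
      (∀ k ≤ l, ∃ B, ∀ p, ∀ s ∈ Ioo (-s₀) s₀, ‖iteratedDeriv k (along F κ (N + 1) p) s‖ ≤ B) ∧
      ∀ k ≤ l, GoodMap fun p => taylorCoef (along F κ (N + 1) p) k := by
  obtain ⟨R, hR, hRU⟩ := h.exists_radius one_pos
  obtain ⟨s₀, hs₀, hball⟩ := hκ.exists_mem_ball N hR
  have hU : ∀ s ∈ Ioo (-s₀) s₀, ∀ θ ω, partialSum κ (N + 1) s θ ω ∈ U := fun s hs θ ω =>
    (hRU θ).1 (hball s hs θ ω)
  have hreg : UReg (Ioo (-s₀) s₀) univ l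
      (fun ω s (t : Cover m) => along F κ (N + 1) (proj t, ω) s) :=
    h.jReg.comp isOpen_univ h.isOpen (dReg_id (S := Ioo (-s₀) s₀))
      (hκ.uReg_partialSum (N + 1) l).dReg (fun _ _ _ _ => mem_univ _)
      fun ω s hs t => hU s hs (proj t) ω
  have hd : ∀ p, ContDiffOn ℝ l (along F κ (N + 1) p) (Ioo (-s₀) s₀) := by
    rintro ⟨θ, ω⟩
    obtain ⟨t, rfl⟩ := proj_surjective θ
    exact hreg.contDiffOn isOpen_Ioo (i := ω) (mem_univ t)
  have h0 : (0 : ℝ) ∈ Ioo (-s₀) s₀ := ⟨neg_lt_zero.2 hs₀, hs₀⟩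
  refine ⟨s₀, hs₀, hd, fun k hk => ?_, fun k hk => ⟨?_, fun ω => ?_⟩⟩
  · obtain ⟨-, B, hB⟩ := hreg.iteratedDeriv isOpen_Ioo hk
    refine ⟨B, ?_⟩
    rintro ⟨θ, ω⟩ s hs
    obtain ⟨t, rfl⟩ := proj_surjective θ
    exact hB ω s hs t (mem_univ t)
  · have hm : Measurable fun p => iteratedDeriv k (along F κ (N + 1) p) 0 := by
      refine measurable_iteratedDeriv (fun s hs => ?_)
        (fun p => (hd p).of_le (by exact_mod_cast hk)) h0
      exact (h.goodMap_comp (GoodMap.partialSum hκ.good (N + 1) s) (fun p => hU s hs _ _) s).1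
    exact hm.const_smul ((k.factorial : ℝ)⁻¹)
  · rw [← isOpenQuotientMap_proj.continuous_comp_iff, ← continuousOn_univ]
    refine ContinuousOn.fun_const_smul (c := (k.factorial : ℝ)⁻¹) ?_
    exact ((hreg.iteratedDeriv isOpen_Ioo hk).1 ω).comp (f := fun t : Cover m => ((0 : ℝ), t))
      (by fun_prop) fun t _ => ⟨h0, mem_univ _⟩

/-- The effect of an additional term in the partial sum. -/
theorem isLittleO_along (h : UniformSystem U l C a F F₀ K₀) (hκ : GoodSeq K₀ κ) (N : ℕ)
    (p : Torus m × Ω) :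
    (fun s => along F κ (N + 2) p s - along F κ (N + 1) p s -
      s ^ (N + 1) • transferMatrix F₀ K₀ p.1 (κ (N + 1) p.1 p.2)) =o[𝓝[≠] 0]
      fun s : ℝ => s ^ (N + 1) := by
  obtain ⟨θ, ω⟩ := p
  obtain ⟨t, rfl⟩ := proj_surjective θ
  obtain ⟨-, gs, gz, hs, hz, rs, rz⟩ := h.jReg.of_le h.one_le
  have hq : ContinuousOn (fun p : ℝ × Phase d => (p.1, p.2, t)) (univ ×ˢ U) := by fun_prop
  -- Strict differentiability at `(0, K₀)` is essential: the values at two moving points are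
  -- compared, and their distance is of order `s ^ (N + 1)` only.
  have h1 := hasStrictFDerivAt_of_partial isOpen_univ h.isOpen
    (g := fun s z => F z (proj t) s ω) (gx := fun s z => gs ω s z t) (gy := fun s z => gz ω s z t)
    (fun s hs' z hz' => hs ω s hs' z hz' t) (fun s hs' z hz' => hz ω s hs' z hz' t)
    ((asOuter_continuousOn rs.uCont ω).comp hq fun p hp => ⟨hp.1, hp.2, mem_univ _⟩)
    ((asOuter_continuousOn rz.uCont ω).comp hq fun p hp => ⟨hp.1, hp.2, mem_univ _⟩)
    (mem_univ (0 : ℝ)) (h.mem (proj t))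
  have hM : gz ω 0 (K₀ (proj t)) t = transferMatrix F₀ K₀ (proj t) := by
    refine (HasFDerivAt.fderiv ?_).symm
    refine (hz ω 0 (mem_univ _) _ (h.mem _) t).congr_of_eventuallyEq ?_
    filter_upwards [h.isOpen.mem_nhds (h.mem (proj t))] with w hw using (h.zero ω w hw _).symm
  have hcurve : ∀ n, Tendsto (fun s : ℝ => (s, partialSum κ (n + 1) s (proj t) ω)) (𝓝[≠] 0)
      (𝓝 (0, K₀ (proj t))) := by
    intro n
    have := ((continuous_id.prodMk (continuous_partialSum κ (n + 1) (proj t) ω)).tendsto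
      (0 : ℝ)).mono_left (nhdsWithin_le_nhds (s := {0}ᶜ))
    simpa only [id_eq, partialSum_succ_zero, hκ.zero] using this
  have h2 := h1.isLittleO.comp_tendsto ((hcurve (N + 1)).prodMk_nhds (hcurve N))
  have h3 : (fun s : ℝ => ((s, partialSum κ (N + 1 + 1) s (proj t) ω) : ℝ × Phase d) -
      (s, partialSum κ (N + 1) s (proj t) ω)) =
      fun s => ((0 : ℝ), s ^ (N + 1) • κ (N + 1) (proj t) ω) := by
    ext1 s
    rw [Prod.mk_sub_mk, sub_self, partialSum_succ κ (N + 1), add_sub_cancel_left]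
  refine (h2.congr_left fun s => ?_).trans_isBigO ?_
  · simp only [Function.comp_apply]
    rw [congrFun h3 s]
    simp [along, hM]
  · refine Asymptotics.IsBigO.of_bound ‖κ (N + 1) (proj t) ω‖ (Eventually.of_forall fun s => ?_)
    simp only [Function.comp_apply]
    rw [congrFun h3 s, Prod.norm_mk, norm_zero, norm_smul, mul_comm]
    exact le_of_eq (max_eq_right (by positivity))

/-- The term `s ^ (k + 1) • κ (k + 1)` changes the curve by `M₀ κ (k + 1)` at its own order, up to
`o(s ^ (k + 1))`. The condition `k + 1 < l` leaves one further bounded derivative for the Taylor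
remainders. -/
theorem coeff_eq (h : UniformSystem U l C a F F₀ K₀) (hκ : GoodSeq K₀ κ) {k : ℕ} (hk : k + 1 < l)
    (θ : Torus m) (ω : Ω) : coeff F κ (k + 1) θ ω =
      remainder F κ k θ ω + transferMatrix F₀ K₀ θ (κ (k + 1) θ ω) := by
  obtain ⟨s₀, hs₀, d0, b0, -⟩ := h.exists_regular_along hκ k
  obtain ⟨s₁, hs₁, d1, b1, -⟩ := h.exists_regular_along hκ (k + 1)
  obtain ⟨B, hB⟩ := b0 (k + 1 + 1) (by omega)
  obtain ⟨B', hB'⟩ := b1 (k + 1 + 1) (by omega)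
  have e0 : Ioo (-min s₀ s₁) (min s₀ s₁) ⊆ Ioo (-s₀) s₀ :=
    Ioo_subset_Ioo (neg_le_neg (min_le_left _ _)) (min_le_left _ _)
  have e1 : Ioo (-min s₀ s₁) (min s₀ s₁) ⊆ Ioo (-s₁) s₁ :=
    Ioo_subset_Ioo (neg_le_neg (min_le_right _ _)) (min_le_right _ _)
  have hle : ((k + 1 + 1 : ℕ) : WithTop ℕ∞) ≤ l := by exact_mod_cast (by omega : k + 1 + 1 ≤ l)
  exact taylorCoef_eq_add (lt_min hs₀ hs₁) (((d1 (θ, ω)).of_le hle).mono e1)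
    (((d0 (θ, ω)).of_le hle).mono e0) (fun s hs => hB' (θ, ω) s (e1 hs))
    (fun s hs => hB (θ, ω) s (e0 hs)) (h.isLittleO_along hκ k (θ, ω))

/-- The added term has order `N + 1 > k`, so its effect is `o(s ^ k)`. It follows that one partial
sum of length `l` encodes all the `F_k` with `k < l`. -/
theorem taylorCoef_along_succ (h : UniformSystem U l C a F F₀ K₀) (hκ : GoodSeq K₀ κ) {k N : ℕ}
    (hk : k < l) (hkN : k ≤ N) (p : Torus m × Ω) :
    taylorCoef (along F κ (N + 2) p) k = taylorCoef (along F κ (N + 1) p) k := by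
  obtain ⟨s₀, hs₀, d0, b0, -⟩ := h.exists_regular_along hκ N
  obtain ⟨s₁, hs₁, d1, b1, -⟩ := h.exists_regular_along hκ (N + 1)
  obtain ⟨B, hB⟩ := b0 (k + 1) (by omega)
  obtain ⟨B', hB'⟩ := b1 (k + 1) (by omega)
  have e0 : Ioo (-min s₀ s₁) (min s₀ s₁) ⊆ Ioo (-s₀) s₀ :=
    Ioo_subset_Ioo (neg_le_neg (min_le_left _ _)) (min_le_left _ _)
  have e1 : Ioo (-min s₀ s₁) (min s₀ s₁) ⊆ Ioo (-s₁) s₁ :=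
    Ioo_subset_Ioo (neg_le_neg (min_le_right _ _)) (min_le_right _ _)
  have hle : ((k + 1 : ℕ) : WithTop ℕ∞) ≤ l := by exact_mod_cast (by omega : k + 1 ≤ l)
  have hpow : (fun s : ℝ => s ^ (N + 1)) =o[𝓝[≠] 0] fun s : ℝ => s ^ k :=
    (Asymptotics.isLittleO_pow_pow (Nat.lt_succ_of_le hkN)).mono nhdsWithin_le_nhds
  have h1 := (h.isLittleO_along hκ N p).trans hpow
  have h2 : (fun s : ℝ => s ^ (N + 1) • transferMatrix F₀ K₀ p.1 (κ (N + 1) p.1 p.2)) =o[𝓝[≠] 0]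
      fun s : ℝ => s ^ k := by
    refine (Asymptotics.IsBigO.of_bound ‖transferMatrix F₀ K₀ p.1 (κ (N + 1) p.1 p.2)‖
      (Eventually.of_forall fun s => ?_)).trans_isLittleO hpow
    rw [norm_smul, mul_comm]
  have := taylorCoef_eq_add (c := 0) (lt_min hs₀ hs₁) (((d1 p).of_le hle).mono e1)
    (((d0 p).of_le hle).mono e0) (fun s hs => hB' p s (e1 hs))
    (fun s hs => hB p s (e0 hs)) ((h1.add h2).congr_left fun s => by simp)
  rwa [add_zero] at this

theorem taylorCoef_along (h : UniformSystem U l C a F F₀ K₀) (hκ : GoodSeq K₀ κ) {k N : ℕ}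
    (hk : k < l) (hkN : k + 1 ≤ N) (p : Torus m × Ω) :
    taylorCoef (along F κ N p) k = coeff F κ k p.1 p.2 := by
  induction N, hkN using Nat.le_induction with
  | base => rfl
  | succ N hN ih =>
    obtain ⟨n, rfl⟩ : ∃ n, N = n + 1 := ⟨N - 1, by omega⟩
    rw [h.taylorCoef_along_succ hκ hk (by omega), ih]

/-- The formal expansion of the invariant torus. -/
theorem exists_goodSeq (h : UniformSystem U l C a F F₀ K₀)
    {GS GU : ℕ → Torus m → Phase d →L[ℝ] Phase d} {C' lam : ℝ}
    (hD : Dichotomy (transferMatrix F₀ K₀) a GS GU C' lam) (hS : ∀ k, Continuous (GS k))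
    (hU : ∀ k, Continuous (GU k)) (Φ : Ω ≃ᵐ Ω) :
    ∃ κ : ℕ → Torus m → Ω → Phase d, GoodSeq K₀ κ ∧ ∀ k, k + 1 < l → ∀ θ ω,
      κ (k + 1) (θ + a) (Φ ω) =
        transferMatrix F₀ K₀ θ (κ (k + 1) θ ω) + remainder F κ k θ ω := by
  have key : ∀ n, n + 1 ≤ l → ∃ κ : ℕ → Torus m → Ω → Phase d, GoodSeq K₀ κ ∧ ∀ k < n, ∀ θ ω,
      κ (k + 1) (θ + a) (Φ ω) =
        transferMatrix F₀ K₀ θ (κ (k + 1) θ ω) + remainder F κ k θ ω := by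
    intro n hn
    induction n with
    | zero =>
      refine ⟨fun i θ ω => if i = 0 then K₀ θ else 0, ⟨fun θ ω => if_pos rfl, fun i => ?_,
        fun i => ?_⟩, fun k hk => absurd hk (by omega)⟩
      · rcases eq_or_ne i 0 with rfl | hi
        · simpa using GoodMap.of_torus h.continuous_K
        · simpa [hi] using GoodMap.of_torus (m := m) (d := d) continuous_zero
      · rcases eq_or_ne i 0 with rfl | hi
        · obtain ⟨B, hB⟩ := (isCompact_range h.continuous_K).isBounded.exists_norm_le
          exact ⟨B, fun θ ω => by simpa using hB _ (mem_range_self θ)⟩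
        · exact ⟨0, fun θ ω => by simp [hi]⟩
    | succ n ih =>
      obtain ⟨κ, hκ, hs⟩ := ih (by omega)
      obtain ⟨s₀, hs₀, -, hb, hg⟩ := h.exists_regular_along hκ n
      obtain ⟨B, hB⟩ := hb (n + 1) (by omega)
      have hr : GoodMap fun p : Torus m × Ω => remainder F κ n p.1 p.2 := hg (n + 1) (by omega)
      have hrb : ∀ p : Torus m × Ω, ‖remainder F κ n p.1 p.2‖ ≤ ((n + 1).factorial : ℝ)⁻¹ * B := by
        intro p
        rw [remainder, norm_smul, norm_inv, Real.norm_natCast]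
        gcongr
        exact hB p 0 ⟨neg_lt_zero.2 hs₀, hs₀⟩
      have hπ : ∀ p : Torus m × Ω, (skew a Φ.toEquiv p).1 = p.1 + a := fun _ => rfl
      let ν : Torus m × Ω → Phase d := greenMap GS GU Prod.fst (skew a Φ.toEquiv)
        fun p => remainder F κ n p.1 p.2
      let κ' : ℕ → Torus m → Ω → Phase d := fun i θ ω => if i = n + 1 then ν (θ, ω) else κ i θ ω
      have hlow : ∀ i, i ≤ n → κ' i = κ i := by
        intro i hi
        have : i ≠ n + 1 := by omega
        simp only [κ', if_neg this]
      -- The system of equations is triangular: these remainders involve only coefficients of index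
      -- at most `n`, so redefining the one of index `n + 1` preserves the equations already solved.
      have hrem : ∀ k, k ≤ n → remainder F κ' k = remainder F κ k := by
        intro k hk
        have : ∀ s, partialSum κ' (k + 1) s = partialSum κ (k + 1) s := by
          intro s
          ext1 θ; ext1 ω
          refine Finset.sum_congr rfl fun i hi => ?_
          rw [hlow i (by have := Finset.mem_range.1 hi; omega)]
        ext1 θ; ext1 ω
        simp only [remainder, this]
      refine ⟨κ', ⟨fun θ ω => ?_, fun i => ?_, fun i => ?_⟩, fun k hk θ ω => ?_⟩
      · rw [hlow 0 (by omega), hκ.zero]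
      · rcases eq_or_ne i (n + 1) with rfl | hi
        · simpa only [κ', if_true] using GoodMap.greenMap hD hS hU Φ hr hrb
        · simpa only [κ', if_neg hi] using hκ.good i
      · rcases eq_or_ne i (n + 1) with rfl | hi
        · exact ⟨_, fun θ ω => by
            simpa only [κ', if_true] using hD.norm_greenMap_le hπ hrb (θ, ω)⟩
        · simpa only [κ', if_neg hi] using hκ.bounded i
      · rw [hrem k (by omega)]
        rcases eq_or_ne k n with rfl | hkn
        · simp only [κ', if_true]
          exact hD.greenMap_step hπ hrb (θ, ω)
        · rw [hlow (k + 1) (by omega)]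
          exact hs k (by omega) θ ω
  obtain ⟨κ, hκ, hs⟩ := key (l - 1) (by have := h.one_le; omega)
  exact ⟨κ, hκ, fun k hk => hs k (by omega)⟩

/-- The partial sum of order `l` is invariant up to an error of order `l`. -/
theorem exists_norm_along_sub_le (h : UniformSystem U l C a F F₀ K₀) (hκ : GoodSeq K₀ κ)
    {Φ : Ω ≃ᵐ Ω} (hs : ∀ k, k + 1 < l → ∀ θ ω, κ (k + 1) (θ + a) (Φ ω) =
      transferMatrix F₀ K₀ θ (κ (k + 1) θ ω) + remainder F κ k θ ω) :
    ∃ s₀ > 0, ∃ B, 0 ≤ B ∧ ∀ s ∈ Ioo (-s₀) s₀, ∀ θ ω,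
      ‖F (partialSum κ l s θ ω) θ s ω - partialSum κ l s (θ + a) (Φ ω)‖ ≤ B * |s| ^ l := by
  obtain ⟨N, rfl⟩ : ∃ N, l = N + 1 := ⟨l - 1, by have := h.one_le; omega⟩
  obtain ⟨s₀, hs₀, hd, hb, -⟩ := h.exists_regular_along hκ N
  obtain ⟨B, hB⟩ := hb (N + 1) le_rfl
  refine ⟨s₀, hs₀, max B 0, le_max_right _ _, fun s hs' θ ω => ?_⟩
  have h1 := norm_sub_taylor_le (hd (θ, ω)) (hB (θ, ω)) hs'
  -- The Taylor polynomial of the image of the partial sum is the partial sum at the image point;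
  -- the defect is the Taylor remainder.
  have h2 : ∀ k < N + 1, taylorCoef (along F κ (N + 1) (θ, ω)) k = κ k (θ + a) (Φ ω) := by
    intro k hk
    rw [h.taylorCoef_along hκ hk hk]
    cases k with
    | zero =>
      simp [coeff, partialSum_one, hκ.zero, h.zero ω _ (h.mem θ), h.invariant]
    | succ k => rw [h.coeff_eq hκ hk, hs k hk, add_comm]
  rw [Finset.sum_congr rfl fun k hk => by rw [h2 k (Finset.mem_range.1 hk)]] at h1
  exact h1.trans (mul_le_mul_of_nonneg_right (le_max_left _ _) (by positivity))

end UniformSystem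

end Expansion

/-! ### Existence, approximation and regularity of the random torus. -/

section InvariantTorus

open Filter Topology

universe u

variable {d m : ℕ} {Ω : Type u} [MeasurableSpace Ω]

namespace UniformSystem

variable {U : Set (Phase d)} {l : ℕ} {C : ℝ} {a : Torus m}
  {F : Phase d → Torus m → ℝ → Ω → Phase d} {F₀ : Phase d → Torus m → Phase d}
  {K₀ : Torus m → Phase d} {GS GU : ℕ → Torus m → Phase d →L[ℝ] Phase d} {C' lam η R ε : ℝ}

/-- With `K_ε = K₀ + v`, invariance reads `v ∘ τ = M₀ v + ψ v`. The error `ψ` is at most `C * |ε|`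
at `v = 0`, and it is `η`-Lipschitz as long as `K₀ + v` stays within `R` of the torus. -/
theorem exists_invariant_torus (h : UniformSystem U l C a F F₀ K₀)
    (hD : Dichotomy (transferMatrix F₀ K₀) a GS GU C' lam) (hS : ∀ k, Continuous (GS k))
    (hU : ∀ k, Continuous (GU k)) (Φ : Ω ≃ᵐ Ω) (hη : 0 ≤ η) (hG : greenBound C' lam * η ≤ 1 / 2)
    (hR0 : 0 < R)
    (hR : ∀ θ, Metric.ball (K₀ θ) R ⊆ U ∧ ∀ z ∈ Metric.ball (K₀ θ) R,
      ∀ z' ∈ Metric.ball (K₀ θ) R,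
        ‖F₀ z θ - F₀ z' θ - transferMatrix F₀ K₀ θ (z - z')‖ ≤ η / 2 * ‖z - z'‖)
    (hε : C * |ε| ≤ η / 2) (hεR : 2 * greenBound C' lam * (C * |ε|) < R / 2) :
    ∃ x : Torus m × Ω → Phase d, GoodMap x ∧ (∀ p, dist (x p) (K₀ p.1) < R / 2) ∧
      ∀ θ ω, F (x (θ, ω)) θ ε ω = x (θ + a, Φ ω) := by
  set M := transferMatrix F₀ K₀ with hM
  have hC := h.bound_nonneg
  have hMc : Continuous M := h.continuous_transferMatrix
  have hπ : ∀ p : Torus m × Ω, (skew a Φ.toEquiv p).1 = p.1 + a := fun _ => rfl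
  have hball : ∀ θ (v : Phase d), ‖v‖ ≤ 2 * greenBound C' lam * (C * |ε|) →
      K₀ θ + v ∈ Metric.ball (K₀ θ) R := by
    intro θ v hv
    rw [mem_ball_iff_norm, add_sub_cancel_left]
    linarith
  have hK : GoodMap fun p : Torus m × Ω => K₀ p.1 := GoodMap.of_torus h.continuous_K
  have hK' : GoodMap fun p : Torus m × Ω => K₀ (p.1 + a) :=
    GoodMap.of_torus (K := fun θ => K₀ (θ + a)) (h.continuous_K.comp (continuous_add_const a))
  let ψ : Torus m × Ω → Phase d → Phase d := fun p v =>
    F (K₀ p.1 + v) p.1 ε p.2 - K₀ (p.1 + a) - M p.1 v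
  have hψ0 : ∀ p, ‖ψ p 0‖ ≤ C * |ε| := by
    intro p
    have := (h.fibre p.2).norm_sub_le h.one_le (h.mem p.1) p.1 ε
    rw [h.zero p.2 _ (h.mem p.1), h.invariant] at this
    simpa [ψ] using this
  have hψ : ∀ p v v', ‖v‖ ≤ 2 * greenBound C' lam * (C * |ε|) →
      ‖v'‖ ≤ 2 * greenBound C' lam * (C * |ε|) → ‖ψ p v - ψ p v'‖ ≤ η * ‖v - v'‖ := by
    intro p v v' hv hv'
    have := h.norm_linearization_le hR hε p.2 p.1 (hball p.1 v hv) (hball p.1 v' hv')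
    rw [add_sub_add_left_eq_sub, map_sub] at this
    refine le_trans (le_of_eq ?_) this
    congr 1
    simp only [ψ]
    abel
  obtain ⟨x, hx, hxb, hxe⟩ := hD.exists_solution hπ hη hG (by positivity) hψ0 hψ GoodMap
    (GoodMap.of_torus (K := fun _ => (0 : Phase d)) continuous_const)
    (fun x hx hxb => by
      have hg : GoodMap fun p => ψ p (x p) :=
        ((h.goodMap_comp (hK.add hx) (fun p => (hR p.1).1 (hball p.1 _ (hxb p))) ε).sub hK').sub
          (GoodMap.apply_clm hMc hx)
      refine GoodMap.greenMap hD hS hU Φ hg (b := η * (2 * greenBound C' lam * (C * |ε|)) + C * |ε|)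
        fun p => ?_
      have h1 := hψ p (x p) 0 (hxb p) (by simpa using (norm_nonneg _).trans (hxb p))
      have h2 := norm_add_le (ψ p (x p) - ψ p 0) (ψ p 0)
      rw [sub_add_cancel] at h2
      rw [sub_zero] at h1
      have h3 := mul_le_mul_of_nonneg_left (hxb p) hη
      linarith [hψ0 p])
    (fun _ _ => GoodMap.of_tendstoUniformly)
  refine ⟨fun p => K₀ p.1 + x p, hK.add hx, fun p => ?_, fun θ ω => ?_⟩
  · rw [dist_eq_norm, add_sub_cancel_left]
    exact (hxb p).trans_lt hεR
  · have := hxe (θ, ω)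
    rw [skew_apply] at this
    change F (K₀ θ + x (θ, ω)) θ ε ω = K₀ (θ + a) + x (θ + a, Φ ω)
    change x (θ + a, Φ ω) = _ at this
    rw [this]
    simp only [ψ]
    abel

/-- Approximately invariant maps near the torus are close to the invariant one. -/
theorem norm_sub_le_of_approx (h : UniformSystem U l C a F F₀ K₀)
    (hD : Dichotomy (transferMatrix F₀ K₀) a GS GU C' lam) (Φ : Ω ≃ᵐ Ω) (hη : 0 ≤ η)
    (hG : greenBound C' lam * η ≤ 1 / 2)
    (hR : ∀ θ, Metric.ball (K₀ θ) R ⊆ U ∧ ∀ z ∈ Metric.ball (K₀ θ) R,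
      ∀ z' ∈ Metric.ball (K₀ θ) R,
        ‖F₀ z θ - F₀ z' θ - transferMatrix F₀ K₀ θ (z - z')‖ ≤ η / 2 * ‖z - z'‖)
    (hε : C * |ε| ≤ η / 2) {x y : Torus m → Ω → Phase d} {c : ℝ} (hc : 0 ≤ c)
    (hx : ∀ θ ω, x θ ω ∈ Metric.ball (K₀ θ) R) (hy : ∀ θ ω, y θ ω ∈ Metric.ball (K₀ θ) R)
    (hxe : ∀ θ ω, F (x θ ω) θ ε ω = x (θ + a) (Φ ω))
    (hye : ∀ θ ω, ‖F (y θ ω) θ ε ω - y (θ + a) (Φ ω)‖ ≤ c) (θ : Torus m) (ω : Ω) :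
    ‖x θ ω - y θ ω‖ ≤ 2 * greenBound C' lam * c := by
  refine hD.norm_apply_le (π := Prod.fst) (τ := skew a Φ.toEquiv)
    (x := fun p : Torus m × Ω => x p.1 p.2 - y p.1 p.2) (b := R + R) (fun _ => rfl) hη hG hc
    (fun p => ?_) (fun p => ?_) (θ, ω)
  · rw [← dist_eq_norm]
    exact (dist_triangle_right _ _ (K₀ p.1)).trans (add_le_add (hx p.1 p.2).le (hy p.1 p.2).le)
  · have h1 := h.norm_linearization_le hR hε p.2 p.1 (hx p.1 p.2) (hy p.1 p.2)
    change ‖x (p.1 + a) (Φ p.2) - y (p.1 + a) (Φ p.2) - _‖ ≤ _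
    rw [← hxe]
    refine le_trans (le_of_eq ?_) ((norm_add_le _ _).trans (add_le_add h1 (hye p.1 p.2)))
    congr 1
    abel

/-- Regularity of invariant tori along an invariant family of realizations. -/
theorem reg_of_invariant (h : UniformSystem U l C (proj α) F F₀ K₀)
    (hD : Dichotomy (transferMatrix F₀ K₀) (proj α) GS GU C' lam) {Φ : Ω ≃ᵐ Ω} (hη : 0 ≤ η)
    (hG : greenBound C' lam * η ≤ 1 / 2) (hR0 : 0 < R)
    (hR : ∀ θ, Metric.ball (K₀ θ) R ⊆ U ∧ ∀ z ∈ Metric.ball (K₀ θ) R,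
      ∀ z' ∈ Metric.ball (K₀ θ) R,
        ‖F₀ z θ - F₀ z' θ - transferMatrix F₀ K₀ θ (z - z')‖ ≤ η / 2 * ‖z - z'‖)
    (hε : C * |ε| ≤ η / 2) {x : Torus m → Ω → Phase d}
    (hx : GoodMap fun p : Torus m × Ω => x p.1 p.2)
    (hxR : ∀ θ ω, dist (x θ ω) (K₀ θ) < R / 2)
    (hxe : ∀ θ ω, F (x θ ω) θ ε ω = x (θ + proj α) (Φ ω)) {ι : Type*} {e : ι → Ω}
    {σ : Equiv.Perm ι} (hσ : ∀ i, e (σ i) = Φ (e i)) {r : ℕ}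
    (hF : JReg U univ r fun i z (t : Cover m) (_ : Unit) => F z (proj t) ε (e i)) :
    Reg r fun i t => x (proj t) (e i) := by
  -- This gives a threshold `h₀`, uniform in `t`, below which a shifted point of the random torus
  -- stays in the ball where the linear approximation at the unshifted base point is valid.
  have hu : UniformContinuous (K₀ ∘ proj (m := m)) := by
    have h1 : UniformContinuous K₀ := CompactSpace.uniformContinuous_of_continuous h.continuous_K
    refine h1.comp ?_
    exact uniformContinuous_of_continuousAt_zero
      (AddMonoidHom.mk' (proj (m := m)) proj_add) continuous_proj.continuousAt
  obtain ⟨h₀, hh₀, hK⟩ := Metric.uniformContinuous_iff.1 hu (R / 2) (by positivity)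
  obtain ⟨B, hB⟩ := (isCompact_range h.continuous_K).isBounded.exists_norm_le
  refine hD.reg_of_nonlinear (σ := σ) hη hG h.isOpen hF (K := fun t => K₀ (proj t)) hh₀ hR0
    (fun t => (hR _).1) (fun t s hs => hK (by simpa [dist_eq_norm] using hs)) ?_ ?_ ?_ ?_
  · exact fun i t z hz z' hz' => h.norm_linearization_le hR hε _ _ hz hz'
  · refine reg_zero_iff.2 ⟨fun i => (hx.2 (e i)).comp continuous_proj, R / 2 + B, fun i t => ?_⟩
    have h1 := norm_add_le (x (proj t) (e i) - K₀ (proj t)) (K₀ (proj t))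
    rw [sub_add_cancel, ← dist_eq_norm] at h1
    exact h1.trans (add_le_add (hxR _ _).le (hB _ (mem_range_self _)))
  · exact fun i t => hxR _ _
  · intro i t
    rw [hxe, hσ, proj_add]

end UniformSystem

/-- Realizations of frozen systems of class `C^r` form regular families. -/
theorem FrozenLInfC.ae_jReg {P : Measure Ω} {U : Set (Phase d)} (hU : IsOpen U) {r : ℕ}
    {F : Phase d → Torus m → ℝ → Ω → Phase d} {ε : ℝ} (h : FrozenLInfC P U r F ε) :
    ∃ p : Ω → Prop, (∀ᵐ ω ∂P, p ω) ∧ ∀ {ι : Type u} (e : ι → Ω), (∀ i, p (e i)) →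
      JReg U univ r fun i z (t : Cover m) (_ : Unit) => F z (proj t) ε (e i) := by
  obtain ⟨C, hC⟩ := h.bounded
  have mem : ∀ {j k : ℕ}, j + k ≤ r → (k, j, 0) ∈ jointIndex r := by
    intro j k hjk
    exact ⟨by simpa [add_comm] using hjk, rfl⟩
  let Q : ℕ → ℕ → Ω → Prop := fun j k ω =>
    (∀ z ∈ U, ContDiff ℝ k
      fun t : Cover m => iteratedFDeriv ℝ j (fun z => F z (proj t) ε ω) z) ∧
    ContinuousOn (fun p : Phase d × Cover m × ℝ => iteratedFDeriv ℝ k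
      (fun t => iteratedFDeriv ℝ j (fun z => F z (proj t) ε ω) p.1) p.2.1) (U ×ˢ univ) ∧
    ∀ z ∈ U, ∀ t : Cover m, ‖iteratedFDeriv ℝ k
      (fun t => iteratedFDeriv ℝ j (fun z => F z (proj t) ε ω) z) t‖ ≤ C
  have hQ : ∀ᵐ ω ∂P, ∀ j k : ℕ, j + k ≤ r → Q j k ω := by
    refine ae_all_iff.2 fun j => ae_all_iff.2 fun k => ?_
    by_cases hjk : j + k ≤ r
    · filter_upwards [h.diff_theta k j 0 (mem hjk), h.continuous k j 0 (mem hjk),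
        hC k j 0 (mem hjk)] with ω h1 h2 h3 _
      exact ⟨fun z hz => h1 z hz 0, h2, fun z hz t => h3 z hz t 0⟩
    · exact Eventually.of_forall fun ω hjk' => absurd hjk' hjk
  -- The condition concerns one realization at a time, with `C` fixed beforehand, so every family of
  -- such realizations is automatically uniform.
  refine ⟨fun ω => (∀ θ : Torus m, ContDiffOn ℝ r (fun z => F z θ ε ω) U) ∧
    ∀ j k : ℕ, j + k ≤ r → Q j k ω, ?_, fun e he => ?_⟩
  · filter_upwards [h.diff_z 0 r 0 (mem (k := 0) le_rfl), hQ] with ω h1 h2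
    exact ⟨fun θ => h1 θ 0, h2⟩
  · refine (HReg.of_iteratedFDeriv hU isOpen_univ (fun i t _ _ => (he i).1 (proj t))
      (fun j k hjk i z hz _ => (((he i).2 j k hjk).1 z hz).contDiffOn)
      fun j k hjk => ⟨fun i => ?_, C, fun i t _ q hq => ((he i).2 j k hjk).2.2 q.1 hq.1 t⟩).jReg hU
      isOpen_univ
    exact ((he i).2 j k hjk).2.1.comp (f := fun p : Cover m × Phase d × Unit => (p.2.1, p.1, (0 : ℝ)))
      (by fun_prop) fun p hp => ⟨hp.2.1, mem_univ _⟩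

theorem Reg.randomMap {P : Measure Ω} {κ : Torus m → Ω → Phase d}
    (hm : Measurable fun p : Torus m × Ω => κ p.1 p.2) {G : Set Ω} (hG : ∀ᵐ ω ∂P, ω ∈ G) {r : ℕ}
    (h : Reg r fun (ω : G) t => κ (proj t) ω) : RandomMap P r κ := by
  have hb : ∀ i : ℕ, ∃ B, i ≤ r → ∀ ω ∈ G, ∀ t : Cover m,
      ‖iteratedFDeriv ℝ i (fun t' : Cover m => κ (proj t') ω) t‖ ≤ B := by
    intro i
    by_cases hi : i ≤ r
    · obtain ⟨-, B, hB⟩ := UReg.iteratedFDeriv isOpen_univ h hi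
      exact ⟨B, fun _ ω hω t => hB ⟨ω, hω⟩ t (mem_univ _) () (mem_univ _)⟩
    · exact ⟨0, fun hi' => absurd hi' hi⟩
  choose B hB using hb
  refine ⟨hm, ?_, ∑ i ∈ Finset.range (r + 1), |B i|, fun i hi => ?_⟩
  · filter_upwards [hG] with ω hω
    exact contDiffOn_univ.1 (UReg.contDiffOn isOpen_univ h (i := ⟨ω, hω⟩) (mem_univ ()))
  · filter_upwards [hG] with ω hω t
    exact ((hB i hi ω hω t).trans (le_abs_self _)).trans
      (Finset.single_le_sum (f := fun i => |B i|) (fun _ _ => abs_nonneg _)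
        (Finset.mem_range.2 (by omega)))

end InvariantTorus

/-! ### From almost sure hypotheses to sure ones, and uniqueness. -/

section Almost

open Filter Topology

universe u

variable {d m : ℕ} {Ω : Type u} [MeasurableSpace Ω] {P : Measure Ω}

/-- After a modification on an invariant null set, a random system is regular everywhere. -/
theorem exists_uniformSystem [IsProbabilityMeasure P] {Φ : Ω ≃ᵐ Ω} (hΦ : MeasurePreserving Φ P P)
    {U : Set (Phase d)} (hU : IsOpen U) {l : ℕ} (hl : 1 ≤ l)
    {F : Phase d → Torus m → ℝ → Ω → Phase d} (hF : LInfC P U (boxIndex 0 l l) F)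
    {F₀ : Phase d → Torus m → Phase d} (hF₀ : ∀ᵐ ω ∂P, ∀ z ∈ U, ∀ θ, F z θ 0 ω = F₀ z θ)
    {a : Torus m} {K₀ : Torus m → Phase d} (hK₀ : NormallyHyperbolicTorus U F₀ a K₀) :
    ∃ (C : ℝ) (G : Set Ω) (F' : Phase d → Torus m → ℝ → Ω → Phase d),
      UniformSystem U l C a F' F₀ K₀ ∧ (∀ᵐ ω ∂P, ω ∈ G) ∧
      ∀ ω ∈ G, ∀ z θ s, F' z θ s ω = F z θ s ω := by
  classical
  obtain ⟨C, hC⟩ := hF.ae_fibreReg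
  obtain ⟨G, hGm, hG, hGp, -⟩ := exists_invariant hΦ (hC.and hF₀)
  obtain ⟨ω₀, hω₀⟩ := hG.exists
  -- Bad realizations are replaced by the realization at one good `ω₀`. The shift on the base is
  -- untouched, and the construction needs no compatibility between `s` and `Φ`.
  let s : Ω → Ω := G.piecewise id fun _ => ω₀
  have hs : Measurable s := measurable_id.piecewise hGm measurable_const
  have hsG : ∀ ω, s ω ∈ G := by
    intro ω
    by_cases hω : ω ∈ G
    · simp [s, hω]
    · simpa [s, hω] using hω₀
  refine ⟨C, G, fun z θ ε ω => F z θ ε (s ω), ?_, hG, fun ω hω z θ ε => ?_⟩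
  · exact
      { isOpen := hU
        one_le := hl
        fibre := fun ω => (hGp _ (hsG ω)).1
        measurable := fun ε => (hF.measurable ε).comp (measurable_fst.prodMk
          ((measurable_fst.comp measurable_snd).prodMk
            (hs.comp (measurable_snd.comp measurable_snd))))
        zero := fun ω => (hGp _ (hsG ω)).2
        continuous_K := hK₀.continuous
        mem := hK₀.mem
        invariant := hK₀.invariant
        nonempty := ⟨ω₀⟩ }
  · simp only [s, piecewise_eq_of_mem _ _ _ hω, id_eq]

/-- Uniqueness of bounded solutions of the cohomological equation. -/
theorem Dichotomy.ae_eq_of_solvesCohomological {M : Torus m → Phase d →L[ℝ] Phase d} {a : Torus m}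
    {GS GU : ℕ → Torus m → Phase d →L[ℝ] Phase d} {C lam : ℝ} (h : Dichotomy M a GS GU C lam)
    {Φ : Ω ≃ᵐ Ω} (hΦ : MeasurePreserving Φ P P) {R κ κ' : Torus m → Ω → Phase d}
    (hκ : RandomMap P 0 κ) (hκ' : RandomMap P 0 κ') (e : SolvesCohomological P Φ a M R κ)
    (e' : SolvesCohomological P Φ a M R κ') : ∀ᵐ ω ∂P, ∀ θ, κ' θ ω = κ θ ω := by
  have hb : ∀ {κ : Torus m → Ω → Phase d}, RandomMap P 0 κ →
      ∃ B, ∀ᵐ ω ∂P, ∀ θ, ‖κ θ ω‖ ≤ B := by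
    intro κ hκ
    obtain ⟨B, hB⟩ := hκ.bounded
    refine ⟨B, ?_⟩
    filter_upwards [hB 0 le_rfl] with ω hω θ
    obtain ⟨t, rfl⟩ := proj_surjective θ
    simpa using hω t
  obtain ⟨B, hB⟩ := hb hκ
  obtain ⟨B', hB'⟩ := hb hκ'
  obtain ⟨G, -, hG, hGp, hGi⟩ := exists_invariant hΦ ((hB.and hB').and (Eventually.and e e'))
  filter_upwards [hG] with ω hω θ
  -- Restricted to an invariant set of full measure, the difference is a bounded solution of the
  -- homogeneous equation at every point; the a priori estimate with `c = 0` makes it vanish.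
  have := h.norm_apply_le_of_eq (π := Prod.fst)
    (τ := skew a (Equiv.Perm.subtypePerm Φ.toEquiv (p := (· ∈ G)) hGi))
    (x := fun p => κ' p.1 p.2 - κ p.1 p.2) (r := fun _ => 0) (b := B' + B) (c := 0)
    (fun _ => rfl) (fun p => (norm_sub_le _ _).trans
      (add_le_add ((hGp _ p.2.2).1.2 p.1) ((hGp _ p.2.2).1.1 p.1)))
    (fun p => ?_) (fun _ => norm_zero.le) (θ, ⟨ω, hω⟩)
  · rw [mul_zero, norm_le_zero_iff, sub_eq_zero] at this
    exact this
  · have h1 := (hGp _ p.2.2).2.1 p.1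
    have h2 := (hGp _ p.2.2).2.2 p.1
    change κ' (p.1 + a) (Φ p.2) - κ (p.1 + a) (Φ p.2) = _
    rw [map_sub, _root_.add_zero]
    rw [sub_eq_iff_eq_add] at h1 h2
    rw [h1, h2]
    abel

end Almost

end RandomTorus

/-! ### Assembly of the main theorem. -/

theorem mainTheorem2 {d m : ℕ} {Ω : Type*} [MeasurableSpace Ω]
    (P : Measure Ω) [IsProbabilityMeasure P]
    (Φ : Ω ≃ᵐ Ω) (hΦ : MeasurePreserving Φ P P)
    (α : RandomTorus.Cover m)
    (U : Set (RandomTorus.Phase d)) (hU : IsOpen U)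
    (l : ℕ) (hl : 1 ≤ l)
    (F : RandomTorus.Phase d → RandomTorus.Torus m → ℝ → Ω → RandomTorus.Phase d)
    (hF : RandomTorus.LInfC P U (RandomTorus.boxIndex 0 l l) F)
    (F₀ : RandomTorus.Phase d → RandomTorus.Torus m → RandomTorus.Phase d)
    (hF₀ : ∀ᵐ ω ∂P, ∀ z ∈ U, ∀ θ : RandomTorus.Torus m, F z θ 0 ω = F₀ z θ)
    (K₀ : RandomTorus.Torus m → RandomTorus.Phase d)
    (hK₀ : RandomTorus.NormallyHyperbolicTorus U F₀ (RandomTorus.proj α) K₀) :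
    ∃ (ε₀ : ℝ) (C : ℝ) (κ : ℕ → RandomTorus.Torus m → Ω → RandomTorus.Phase d)
      (K : ℝ → RandomTorus.Torus m → Ω → RandomTorus.Phase d),
      0 < ε₀ ∧
      -- the coefficients of the expansion
      (∀ θ ω, κ 0 θ ω = K₀ θ) ∧
      (∀ k : ℕ, k + 1 < l →
        RandomTorus.RandomMap P 0 (κ (k + 1)) ∧
        RandomTorus.SolvesCohomological P Φ (RandomTorus.proj α)
          (RandomTorus.transferMatrix F₀ K₀) (RandomTorus.remainder F κ k) (κ (k + 1)) ∧
        (∀ κ' : RandomTorus.Torus m → Ω → RandomTorus.Phase d,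
          RandomTorus.RandomMap P 0 κ' →
          RandomTorus.SolvesCohomological P Φ (RandomTorus.proj α)
            (RandomTorus.transferMatrix F₀ K₀) (RandomTorus.remainder F κ k) κ' →
          ∀ᵐ ω ∂P, ∀ θ, κ' θ ω = κ (k + 1) θ ω) ∧
        (∀ᵐ ω ∂P, ∀ θ : RandomTorus.Torus m,
          κ (k + 1) (θ + RandomTorus.proj α) (Φ ω) = RandomTorus.coeff F κ (k + 1) θ ω)) ∧
      -- the random invariant torus and its expansion
      (∀ ε : ℝ, |ε| < ε₀ →
        RandomTorus.RandomMap P 0 (K ε) ∧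
        (∀ θ ω, K ε θ ω ∈ U) ∧
        (∀ᵐ ω ∂P, ∀ θ : RandomTorus.Torus m,
          F (K ε θ ω) θ ε ω = K ε (θ + RandomTorus.proj α) (Φ ω)) ∧
        (∀ᵐ ω ∂P, ∀ θ : RandomTorus.Torus m,
          ‖K ε θ ω - RandomTorus.partialSum κ l ε θ ω‖ ≤ C * |ε| ^ l)) ∧
      -- regularity of the random invariant torus
      (∀ r : ℕ, RandomTorus.LInfC P U (RandomTorus.boxIndex r l l) F →
        (∀ ε : ℝ, RandomTorus.FrozenLInfC P U r F ε) →
        ∀ ε : ℝ, |ε| < ε₀ → RandomTorus.RandomMap P r (K ε)) := by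
  obtain ⟨C, G, F', h, hG, hFG⟩ := RandomTorus.exists_uniformSystem hΦ hU hl hF hF₀ hK₀
  obtain ⟨PS, PU, C₀, lamS, lamU, hyp⟩ := hK₀.hyperbolic
  obtain ⟨GS, GU, C', lam, hD, hGS, hGU⟩ := hyp.exists_dichotomy h.continuous_transferMatrix
  have hg := hD.greenBound_nonneg
  obtain ⟨η, hη, hGη⟩ : ∃ η : ℝ, 0 < η ∧ RandomTorus.greenBound C' lam * η ≤ 1 / 2 := by
    refine ⟨1 / 2 / (RandomTorus.greenBound C' lam + 1), by positivity, ?_⟩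
    rw [← mul_div_assoc, div_le_iff₀ (by positivity)]
    linarith
  -- Half of `η` is spent on the nonlinearity of `F₀` near the torus, the other half on the
  -- perturbation in `ε`.
  obtain ⟨R, hR0, hR⟩ := h.exists_radius (half_pos hη)
  obtain ⟨κ, hκ, hstep⟩ := h.exists_goodSeq hD hGS hGU Φ
  obtain ⟨s₀, hs₀, B, hB0, hB⟩ := h.exists_norm_along_sub_le hκ hstep
  obtain ⟨s₁, hs₁, hball⟩ := hκ.exists_mem_ball (l - 1) hR0
  rw [Nat.sub_add_cancel hl] at hball
  -- The four requirements are: the Taylor bound holds, the partial sum stays in the ball, the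
  -- perturbation costs at most `η / 2`, and the fixed point lies within `R / 2`. None of them
  -- involves `r`.
  obtain ⟨ε₀, hε₀, hsmall⟩ : ∃ ε₀ > 0, ∀ ε : ℝ, |ε| < ε₀ →
      ε ∈ Ioo (-s₀) s₀ ∧ ε ∈ Ioo (-s₁) s₁ ∧ C * |ε| ≤ η / 2 ∧
        2 * RandomTorus.greenBound C' lam * (C * |ε|) < R / 2 := by
    have c1 : Filter.Tendsto (fun ε : ℝ => C * |ε|) (nhds 0) (nhds 0) := by
      simpa using ((continuous_abs.const_mul C).tendsto (0 : ℝ))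
    have c2 : Filter.Tendsto (fun ε : ℝ => 2 * RandomTorus.greenBound C' lam * (C * |ε|))
        (nhds 0) (nhds 0) := by
      simpa using c1.const_mul (2 * RandomTorus.greenBound C' lam)
    obtain ⟨ε₀, hε₀, hs⟩ := Metric.eventually_nhds_iff.1
      ((c1.eventually_le_const (half_pos hη)).and (c2.eventually_lt_const (half_pos hR0)))
    refine ⟨min ε₀ (min s₀ s₁), by positivity, fun ε hε => ?_⟩
    simp only [lt_min_iff] at hε
    exact ⟨abs_lt.1 hε.2.1, abs_lt.1 hε.2.2, hs (by simpa using hε.1)⟩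
  have hK : ∀ ε : ℝ, ∃ x : RandomTorus.Torus m × Ω → RandomTorus.Phase d, |ε| < ε₀ →
      RandomTorus.GoodMap x ∧ (∀ p, dist (x p) (K₀ p.1) < R / 2) ∧
        ∀ θ ω, F' (x (θ, ω)) θ ε ω = x (θ + RandomTorus.proj α, Φ ω) := by
    intro ε
    by_cases hε : |ε| < ε₀
    · obtain ⟨-, -, h1, h2⟩ := hsmall ε hε
      obtain ⟨x, hx⟩ := h.exists_invariant_torus hD hGS hGU Φ hη.le hGη hR0 hR h1 h2
      exact ⟨x, fun _ => hx⟩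
    · exact ⟨0, fun hε' => absurd hε' hε⟩
  choose K hK using hK
  have hKR : ∀ ε, |ε| < ε₀ → ∀ θ ω, K ε (θ, ω) ∈ Metric.ball (K₀ θ) R := fun ε hε θ ω =>
    ((hK ε hε).2.1 (θ, ω)).trans (half_lt_self hR0)
  have hcoeff : ∀ ω ∈ G, ∀ k θ, RandomTorus.coeff F' κ k θ ω = RandomTorus.coeff F κ k θ ω :=
    fun ω hω k θ => by simp only [RandomTorus.coeff, hFG ω hω]
  have hrem : ∀ ω ∈ G, ∀ k θ,
      RandomTorus.remainder F' κ k θ ω = RandomTorus.remainder F κ k θ ω :=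
    fun ω hω k θ => by simp only [RandomTorus.remainder, hFG ω hω]
  refine ⟨ε₀, 2 * RandomTorus.greenBound C' lam * B, κ, fun ε θ ω => K ε (θ, ω), hε₀, hκ.zero,
    fun k hk => ?_, fun ε hε => ?_, fun r _ hFr ε hε => ?_⟩
  · have hr : RandomTorus.RandomMap P 0 (κ (k + 1)) := by
      obtain ⟨b, hb⟩ := hκ.bounded (k + 1)
      exact (hκ.good (k + 1)).randomMap hb
    have hs : RandomTorus.SolvesCohomological P Φ (RandomTorus.proj α)
        (RandomTorus.transferMatrix F₀ K₀) (RandomTorus.remainder F κ k) (κ (k + 1)) := by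
      filter_upwards [hG] with ω hω θ
      rw [hstep k hk, hrem ω hω, sub_add_cancel_left]
    refine ⟨hr, hs, fun κ' hr' hs' => hD.ae_eq_of_solvesCohomological hΦ hr hr' hs hs', ?_⟩
    filter_upwards [hG] with ω hω θ
    rw [← hcoeff ω hω, h.coeff_eq hκ hk, hstep k hk, add_comm]
  · obtain ⟨hε1, hε2, hε3, -⟩ := hsmall ε hε
    obtain ⟨hg, hd, he⟩ := hK ε hε
    obtain ⟨b, hb⟩ := (isCompact_range h.continuous_K).isBounded.exists_norm_le
    refine ⟨hg.randomMap (B := R + b) fun θ ω => ?_, fun θ ω => (hR θ).1 (hKR ε hε θ ω), ?_,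
      Filter.Eventually.of_forall fun ω θ => ?_⟩
    · have h1 := norm_add_le (K ε (θ, ω) - K₀ θ) (K₀ θ)
      rw [sub_add_cancel, ← dist_eq_norm] at h1
      exact h1.trans (add_le_add (hKR ε hε θ ω).le (hb _ (mem_range_self θ)))
    · filter_upwards [hG] with ω hω θ
      rw [← hFG ω hω, he]
    · rw [mul_assoc]
      -- The partial sum is the approximate torus, with defect `B * |ε| ^ l`.
      exact h.norm_sub_le_of_approx hD Φ hη.le hGη hR hε3 (by positivity)
        (x := fun θ ω => K ε (θ, ω)) (hKR ε hε) (hball ε hε2) he (hB ε hε1) θ ω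
  · obtain ⟨-, -, hε3, -⟩ := hsmall ε hε
    obtain ⟨hg, hd, he⟩ := hK ε hε
    obtain ⟨p, hp, hpJ⟩ := (hFr ε).ae_jReg hU
    -- The bounds of class `C^r` hold outside a null set depending on `r` and `ε`. The torus already
    -- constructed is restricted to an invariant set of good realizations, over which the regularity
    -- argument applies with `ω` as a mere index.
    obtain ⟨G', -, hG', hG'p, hG'i⟩ := RandomTorus.exists_invariant hΦ (hp.and hG)
    refine RandomTorus.Reg.randomMap hg.1 hG' ?_
    refine h.reg_of_invariant hD (Φ := Φ) (x := fun θ ω => K ε (θ, ω)) hη.le hGη hR0 hR hε3 hg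
      (fun θ ω => hd (θ, ω)) he (e := ((↑) : G' → Ω))
      (σ := Equiv.Perm.subtypePerm Φ.toEquiv (p := (· ∈ G')) hG'i) (fun _ => rfl) ?_
    have e : (fun (i : G') z (t : RandomTorus.Cover m) (_ : Unit) =>
        F' z (RandomTorus.proj t) ε i) =
        fun (i : G') z t _ => F z (RandomTorus.proj t) ε i := by
      ext1 i; ext1 z; ext1 t
      rw [hFG i (hG'p i i.2).2]
    rw [e]
    exact hpJ _ fun i => (hG'p i i.2).1
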